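/- Let $R>0$, $\Omega=(-R,R)$, and consider the boundary value problem $$Lu:=a u''+b u'+c u=f \ \text{ in }\Omega,\qquad Bu:=g_1u'+g_2u=g\ \text{ on }\partial\Omega=\{-R,R\},$$ with real data $a,b,c\in L^\infty(\Omega)$, $f\in L^2(\Omega)$, $g_1,g_2,g:\partial\Omega\to\mathbb R$, and constants $\Lambda_1,\Lambda_2,\Lambda_3>0$ with $\|a\|_{L^\infty}\le\Lambda_1$, $\|b\|_{L^\infty}\le\Lambda_2$, $\|c\|_{L^\infty}\le\Lambda_3$. A solution is a real function $u\in H^2(\Omega)$ with $Lu=f$ a.e. in $\Omega$ and $Bu=g$ on $\partial\Omega$ in the sense of traces. For $h$ on $\partial\Omega$ put $\|h\|_{L^2(\partial\Omega)}^2=h(-R)^2+h(R)^2$. For a penalty parameter $\gamma\ge 0$, an integer $N\ge1$, hidden weights $k=(k_1,\dots,k_N)$ and $\boldsymbol\alpha\in\mathbb R^{2N}$, let $$u_N(x)=\sum_{i=1}^N\alpha_i\cos(k_ix)+\sum_{i=1}^N\alpha_{N+i}\sin(k_ix),\qquad \mathcal L(\boldsymbol\alpha;k)=\|Lu_N-f\|_{L^2(\Omega)}^2+\gamma\|Bu_N-g\|_{L^2(\partial\Omega)}^2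 .$$ The minimum over $\boldsymbol\alpha$ exists for every $k$. Let $k_1,\dots,k_N$ be independent and uniformly distributed on $(0,S)$ with $S=N/(11R)$, let $\mathbb E$ be the expectation over $k$, and let $\Xi=\{R,\Lambda_1,\Lambda_2,\Lambda_3,\|g_1\|_{L^2(\partial\Omega)},\|g_2\|_{L^2(\partial\Omega)},\gamma\}$; a constant $C(\Xi,\dots)$ depends only on the quantities listed, and never on $N$. For an open interval $U$ and $s>1$, $G^s(U)$ is the set of $h\in C^\infty(U)$ such that for every compact $K\subset U$ there are $M,C>0$ with $\max_K|h^{(n)}|\le MC^n(n!)^s$ for all integers $n\ge0$; such a $C$ is called a Gevrey constant of $h$ on $K$. $G^s_0(U)$ is the set of elements of $G^s(U)$ with compact support in $U$. Let $u$ be a solution of the problem. Then, for all integers $N\ge1$: (a) If, for some $\rho>0$, $u$ extends to an analytic function in the strip $|\operatorname{Im}z|<\rho$ with $\|u(\cdot+iy)\|_{L^2(\mathbb R)}$ bounded uniformly in $y\in(-\rho,\rho)$, then $$\mathbb E\min_{\boldsymbol\alpha\in\mathbb R^{2N}}\mathcal L(\boldsymbol\alpha;k)\le C(\Xi,u,\rho)\,e^{-\kappa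 N},\qquad \kappa=\min\Big(\frac12,\frac{\rho}{11R}\Big).$$ (b) If, for some $\rho>0$ and $s>1$, $u$ has an extension in $G^s(-R-\rho,R+\rho)$, with Gevrey constant $C_u$ on $[-R,R]$, then there is $\kappa=\kappa(C_u,\rho,s,R)>0$ such that $$\mathbb E\min_{\boldsymbol\alpha\in\mathbb R^{2N}}\mathcal L(\boldsymbol\alpha;k)\le C(\Xi,u,\rho,s)\,\exp\big(-\kappa N^{1/s}\big).$$ Moreover, let $\varphi\in G^s_0(-R-\rho,R+\rho)$ satisfy $\varphi\equiv1$ on $[-R,R]$, and let $C_{\varphi u}>0$ be a Gevrey constant, on the whole interval $(-R-\rho,R+\rho)$, of the product of $\varphi$ and the extension of $u$. Then the bound holds with $\kappa=C_{\varphi u}^{-1/s}(11R)^{-1/s}/(2s)$ (the prefactor may then depend on $\varphi$, on $C_{\varphi u}$ and on the extension as well). (c) If $u\in H^s(\Omega)$ for a real $s\ge2$, then $$\mathbb E\min_{\boldsymbol\alpha\in\mathbb R^{2N}}\mathcal L(\boldsymbol\alpha;k)\le C(\Xi,s)\,\|u\|_{H^s(\Omega)}^2\,N^{-2s+4}.$$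 Here $\|u\|_{H^s(\Omega)}^2=\sum_{j=0}^{m}\|u^{(j)}\|_{L^2(\Omega)}^2$, with $m=\lfloor s\rfloor$ and weak derivatives, plus, if $\sigma=s-m>0$, the term $\iint_{\Omega\times\Omega}|u^{(m)}(x)-u^{(m)}(y)|^2|x-y|^{-1-2\sigma}\,dx\,dy$. -/

import Mathlib

open MeasureTheory
open scoped ContDiff

noncomputable section

namespace RFM

/-! ### Weak derivatives and Sobolev spaces on `Ω = (-R, R)` -/

/-- `v` is an `n`-th order weak derivative of `u` on the open set `Ω ⊆ ℝ`. -/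
def HasWeakDeriv (Ω : Set ℝ) (n : ℕ) (u v : ℝ → ℝ) : Prop :=
  LocallyIntegrableOn u Ω ∧ LocallyIntegrableOn v Ω ∧
    ∀ φ : ℝ → ℝ, ContDiff ℝ ∞ φ → HasCompactSupport φ → tsupport φ ⊆ Ω →
      ∫ x in Ω, u x * iteratedDeriv n φ x = (-1) ^ n * ∫ x in Ω, v x * φ x

open Classical in
/-- The `n`-th weak derivative of `u` on `Ω` (unique up to null sets; `0` if there is none). -/
def weakDeriv (Ω : Set ℝ) (n : ℕ) (u : ℝ → ℝ) : ℝ → ℝ :=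
  if h : ∃ v, HasWeakDeriv Ω n u v then h.choose else 0

/-- The squared Gagliardo (Sobolev–Slobodeckij) seminorm of order `σ ∈ (0, 1)` on `Ω`:
`∬ |v x - v y|² / |x - y|^(1 + 2σ)`. -/
def gagliardoSq (Ω : Set ℝ) (σ : ℝ) (v : ℝ → ℝ) : ENNReal :=
  ∫⁻ x in Ω, ∫⁻ y in Ω, ENNReal.ofReal (|v x - v y| ^ 2 / |x - y| ^ (1 + 2 * σ))

/-- `u ∈ H^s(-R, R)` for a real `s ≥ 0`: the weak derivatives of order at most `⌊s⌋` exist and are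
square integrable and, if `s` is not an integer, the one of order `⌊s⌋` has finite Gagliardo
seminorm of order `s - ⌊s⌋`. -/
def MemHs (R s : ℝ) (u : ℝ → ℝ) : Prop :=
  (∀ j ≤ ⌊s⌋₊, ∃ v, HasWeakDeriv (Set.Ioo (-R) R) j u v ∧
    MemLp v 2 (volume.restrict (Set.Ioo (-R) R))) ∧
  (Int.fract s ≠ 0 →
    gagliardoSq (Set.Ioo (-R) R) (Int.fract s) (weakDeriv (Set.Ioo (-R) R) ⌊s⌋₊ u) < ⊤)

open Classical in
/-- The squared norm `‖u‖²` of `H^s(-R, R)`, meant for `u` with `MemHs R s u`. -/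
def hsNormSq (R s : ℝ) (u : ℝ → ℝ) : ℝ :=
  (∑ j ∈ Finset.range (⌊s⌋₊ + 1),
    ∫ x in Set.Ioo (-R) R, weakDeriv (Set.Ioo (-R) R) j u x ^ 2) +
  if Int.fract s = 0 then 0
  else (gagliardoSq (Set.Ioo (-R) R) (Int.fract s)
    (weakDeriv (Set.Ioo (-R) R) ⌊s⌋₊ u)).toReal

/-! ### Gevrey classes -/

/-- On `K`, the derivatives of `f` grow with Gevrey index `s` and constant `C`:
`|f⁽ⁿ⁾| ≤ M Cⁿ (n!)ˢ` for some `M > 0`. -/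
def GevreyBound (s : ℝ) (K : Set ℝ) (C : ℝ) (f : ℝ → ℝ) : Prop :=
  ∃ M : ℝ, 0 < M ∧ ∀ n : ℕ, ∀ x ∈ K,
    |iteratedDeriv n f x| ≤ M * C ^ n * (Nat.factorial n : ℝ) ^ s

/-- The Gevrey class `G^s(U)`, `U ⊆ ℝ` open. -/
def GevreyOn (s : ℝ) (U : Set ℝ) (f : ℝ → ℝ) : Prop :=
  ContDiffOn ℝ ∞ f U ∧
    ∀ K ⊆ U, IsCompact K → ∃ C : ℝ, 0 < C ∧ GevreyBound s K C f

/-- The class `G^s_0(U)` of Gevrey functions with compact support in `U` (extended by zero). -/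
def GevreyCompact (s : ℝ) (U : Set ℝ) (f : ℝ → ℝ) : Prop :=
  GevreyOn s U f ∧ HasCompactSupport f ∧ tsupport f ⊆ U

/-! ### Analytic functions in a strip -/

/-- `F` is analytic in the strip `|Im z| < ρ`, and its `L²` norms on the horizontal lines of the
strip are uniformly bounded. -/
def AnalyticInStrip (ρ : ℝ) (F : ℂ → ℂ) : Prop :=
  AnalyticOnNhd ℂ F {z : ℂ | |z.im| < ρ} ∧
    ∃ M : ℝ, ∀ y : ℝ, |y| < ρ →
      eLpNorm (fun x : ℝ => F ((x : ℂ) + (y : ℂ) * Complex.I)) 2 volume ≤ ENNReal.ofReal M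

/-! ### The two-point boundary value problem -/

/-- The data of `a u'' + b u' + c u = f` in `(-R, R)`, `g₁ u' + g₂ u = g` on `{-R, R}`. Only the
values of `g₁`, `g₂`, `g` at `±R` matter. -/
structure BVP (R : ℝ) where
  a : ℝ → ℝ
  b : ℝ → ℝ
  c : ℝ → ℝ
  f : ℝ → ℝ
  g₁ : ℝ → ℝ
  g₂ : ℝ → ℝ
  g : ℝ → ℝ
  memLp_a : MemLp a ⊤ (volume.restrict (Set.Ioo (-R) R))
  memLp_b : MemLp b ⊤ (volume.restrict (Set.Ioo (-R) R))
  memLp_c : MemLp c ⊤ (volume.restrict (Set.Ioo (-R) R))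
  memLp_f : MemLp f 2 (volume.restrict (Set.Ioo (-R) R))

/-- The squared norm of `L²(∂Ω)`, `∂Ω = {-R, R}`. -/
def bdNormSq (R : ℝ) (h : ℝ → ℝ) : ℝ := h (-R) ^ 2 + h R ^ 2

/-- The coefficients are bounded by `Λ₁, Λ₂, Λ₃` in `L^∞(Ω)`, and `g₁, g₂` by `G₁, G₂` in
`L²(∂Ω)`. -/
structure BVP.Bounded {R : ℝ} (P : BVP R) (Λ₁ Λ₂ Λ₃ G₁ G₂ : ℝ) : Prop where
  a_le : ∀ᵐ x ∂(volume.restrict (Set.Ioo (-R) R)), |P.a x| ≤ Λ₁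
  b_le : ∀ᵐ x ∂(volume.restrict (Set.Ioo (-R) R)), |P.b x| ≤ Λ₂
  c_le : ∀ᵐ x ∂(volume.restrict (Set.Ioo (-R) R)), |P.c x| ≤ Λ₃
  g₁_le : √(bdNormSq R P.g₁) ≤ G₁
  g₂_le : √(bdNormSq R P.g₂) ≤ G₂

/-- `u` is a (strong) solution: `u ∈ H²(-R, R)`, the equation holds almost everywhere, and the
boundary condition holds for the traces, that is, for the values at `±R` of the representatives
of `u` and `u'` that are continuous on `[-R, R]`. -/
structure BVP.IsSolution {R : ℝ} (P : BVP R) (u : ℝ → ℝ) : Prop where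
  mem : MemHs R 2 u
  interior : ∀ᵐ x ∂(volume.restrict (Set.Ioo (-R) R)),
    P.a x * weakDeriv (Set.Ioo (-R) R) 2 u x + P.b x * weakDeriv (Set.Ioo (-R) R) 1 u x
      + P.c x * u x = P.f x
  boundary : ∃ u₀ u₁ : ℝ → ℝ,
    ContinuousOn u₀ (Set.Icc (-R) R) ∧ ContinuousOn u₁ (Set.Icc (-R) R) ∧
    u₀ =ᵐ[volume.restrict (Set.Ioo (-R) R)] u ∧
    u₁ =ᵐ[volume.restrict (Set.Ioo (-R) R)] weakDeriv (Set.Ioo (-R) R) 1 u ∧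
    ∀ x ∈ ({-R, R} : Set ℝ), P.g₁ x * u₁ x + P.g₂ x * u₀ x = P.g x

/-! ### The random feature method -/

/-- The trial function with hidden weights `k` and trainable parameters `α ∈ ℝ^{2N}` (the pair of
the cosine and the sine coefficients). -/
def trial {N : ℕ} (k : Fin N → ℝ) (α : (Fin N → ℝ) × (Fin N → ℝ)) (x : ℝ) : ℝ :=
  ∑ i, α.1 i * Real.cos (k i * x) + ∑ i, α.2 i * Real.sin (k i * x)

/-- The loss `‖L u_N - f‖²_{L²(Ω)} + γ ‖B u_N - g‖²_{L²(∂Ω)}` of the trial function. -/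
def BVP.loss {R : ℝ} (P : BVP R) (γ : ℝ) {N : ℕ} (k : Fin N → ℝ)
    (α : (Fin N → ℝ) × (Fin N → ℝ)) : ℝ :=
  (∫ x in Set.Ioo (-R) R,
    (P.a x * deriv (deriv (trial k α)) x + P.b x * deriv (trial k α) x
      + P.c x * trial k α x - P.f x) ^ 2) +
  γ * bdNormSq R (fun x => P.g₁ x * deriv (trial k α) x + P.g₂ x * trial k α x - P.g x)

/-- The law of `N` independent hidden weights, each uniform on `(0, S)`. -/
def weightLaw (N : ℕ) (S : ℝ) : Measure (Fin N → ℝ) :=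
  Measure.pi fun _ => ProbabilityTheory.cond volume (Set.Ioo 0 S)

/-- `𝔼 min_α ℒ(α; k) ≤ ε` for independent weights `k_1, …, k_N` uniform on `(0, S)`: the minimum
over `α ∈ ℝ^{2N}` is attained for every `k`, is integrable as a function of `k`, and its
expectation is at most `ε`. -/
def BVP.ExpectedMinLossLE {R : ℝ} (P : BVP R) (γ : ℝ) (N : ℕ) (S ε : ℝ) : Prop :=
  ∃ m : (Fin N → ℝ) → ℝ,
    (∀ k, IsLeast (Set.range fun α => P.loss γ k α) (m k)) ∧
    Integrable m (weightLaw N S) ∧ ∫ k, m k ∂(weightLaw N S) ≤ ε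

end RFM

end

/-! The estimate is deterministic at heart: for every `k` with pairwise distinct entries in `(0,
S)`, hence for almost every `k`, some `α` makes the loss small. The probabilistic part consists of
attaining the minimum, its measurability in `k`, and integrating a pointwise bound
(`BVP.expectedMinLossLE_of_forall`).

Trial functions can imitate polynomials. The monomial `x ^ m` is the `m`-th derivative at `ξ = 0` of
`ξ ↦ cos (ξ x - m π / 2)`. Replacing this function of `ξ` by its Lagrange interpolant at the nodes
`k i` turns the derivative into a linear combination of the functions `cos (k i x - m π / 2)`, which
is a trial function. Repeated use of Rolle's theorem bounds the remainder by the `N`-th derivative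
in `ξ` times `S ^ (N - m) / (N - m)!`, and `S R = N / 11` makes this geometrically small in `N`. The
coefficients of a polynomial of degree at most `n + 1` that is bounded on `[-R, R]` grow at most
like `3 ^ n` (a Chebyshev argument, `sum_abs_coeff_mul_pow_le`). With `n = N / 5` the remainder
wins, and an error of order `exp (-N / 4)` is left in the second derivative, while the value and the
first derivative at `0` are matched exactly (`exists_trial_approx_polynomial`,
`exists_trial_l2norm_le`).

An error `E = u_N - u` is recovered from `E''`, `E' 0` and `E 0` by integration, so the loss is at
most a constant times the square of `‖E''‖ + |E' 0| + |E 0|` (`BVP.loss_le`). It therefore suffices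
to approximate `u''` in `L²(-R, R)` by polynomials of degree less than `N / 5` and to integrate
twice with the right initial values. The loss is then at most a constant times `(dist + C exp (-N /
4)) ^ 2`; the square of the second term is the origin of the cap `1 / 2` on the analytic rate.

The polynomial distance is controlled by an `L²` Jackson inequality, a consequence of the spectral
gap `d (d + 1)` of the Legendre operator on the orthogonal complement of the polynomials of degree
less than `d`. Applied to `k` derivatives it gains the factor `R ^ k d! / (d + k)!`
(`bestApprox_le_of_tower`). The regularity classes differ in the choice of `k`: for analytic `u`,
Cauchy's estimates and the largest term of a binomial expansion; for Gevrey `u`, a `k` of order `N ^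
(1 / s)`; for `u` in `H^s`, the fixed number `⌊s⌋ - 2`, followed by a smoothing by Steklov means
that exploits the Gagliardo seminorm (`bestApprox_le_gagliardo`). -/

open MeasureTheory
open scoped ContDiff

noncomputable section

namespace RFM

section

/-! ### Interpolation of smooth functions -/

/-- `h n` is the `n`-th derivative of `h 0` on the whole line. -/
def IsTower (h : ℕ → ℝ → ℝ) : Prop := ∀ n x, HasDerivAt (h n) (h (n + 1) x) x

/-- Rolle's theorem for a finite set of zeros. -/
theorem exists_finset_zeros_deriv {f f' : ℝ → ℝ} (hf : ∀ x, HasDerivAt f (f' x) x) {a b : ℝ}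
    {s : Finset ℝ} {r : ℕ} (hs : s.card = r + 1) (hsub : ∀ x ∈ s, x ∈ Set.Icc a b)
    (hz : ∀ x ∈ s, f x = 0) :
    ∃ t : Finset ℝ, t.card = r ∧ (∀ x ∈ t, x ∈ Set.Icc a b) ∧ ∀ x ∈ t, f' x = 0 := by
  classical
  let z := s.orderEmbOfFin hs
  have hzs : ∀ i, z i ∈ s := fun i => s.orderEmbOfFin_mem hs i
  have hex : ∀ i : Fin r, ∃ c ∈ Set.Ioo (z i.castSucc) (z i.succ), f' c = 0 := fun i =>
    exists_hasDerivAt_eq_zero (z.strictMono i.castSucc_lt_succ)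
      (fun x _ => (hf x).continuousAt.continuousWithinAt)
      (by rw [hz _ (hzs _), hz _ (hzs _)]) (fun x _ => hf x)
  choose c hc hc0 using hex
  have hmono : StrictMono c := by
    intro i j hij
    have h1 : z i.succ ≤ z j.castSucc := z.monotone (by
      rw [Fin.le_def]; simpa using hij)
    exact (hc i).2.trans_le (h1.trans (hc j).1.le)
  refine ⟨Finset.univ.image c, ?_, ?_, ?_⟩
  · rw [Finset.card_image_of_injective _ hmono.injective]; simp
  · intro x hx
    obtain ⟨i, -, rfl⟩ := Finset.mem_image.1 hx
    exact ⟨(hsub _ (hzs _)).1.trans (hc i).1.le, (hc i).2.le.trans (hsub _ (hzs _)).2⟩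
  · intro x hx
    obtain ⟨i, -, rfl⟩ := Finset.mem_image.1 hx
    exact hc0 i

/-- Rolle's theorem iterated: each differentiation costs one zero. -/
theorem IsTower.exists_finset_zeros {h : ℕ → ℝ → ℝ} (hh : IsTower h) {a b : ℝ} (m : ℕ) :
    ∀ {r : ℕ} {s : Finset ℝ}, s.card = r + m → (∀ x ∈ s, x ∈ Set.Icc a b) →
      (∀ x ∈ s, h 0 x = 0) →
      ∃ t : Finset ℝ, t.card = r ∧ (∀ x ∈ t, x ∈ Set.Icc a b) ∧ ∀ x ∈ t, h m x = 0 := by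
  induction m with
  | zero => intro r s hs hsub hz; exact ⟨s, by simpa using hs, hsub, hz⟩
  | succ m ih =>
    intro r s hs hsub hz
    obtain ⟨t, ht, htsub, htz⟩ := ih (r := r + 1) (by omega) hsub hz
    exact exists_finset_zeros_deriv (hh m) ht htsub htz

theorem IsTower.shift {h : ℕ → ℝ → ℝ} (hh : IsTower h) (m : ℕ) :
    IsTower fun n => h (n + m) := fun n x => by
  have := hh (n + m) x
  rwa [show n + m + 1 = n + 1 + m by ring] at this

theorem IsTower.sub {h g : ℕ → ℝ → ℝ} (hh : IsTower h) (hg : IsTower g) :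
    IsTower fun n x => h n x - g n x := fun n x => (hh n x).fun_sub (hg n x)

theorem IsTower.const_mul {h : ℕ → ℝ → ℝ} (hh : IsTower h) (c : ℝ) :
    IsTower fun n x => c * h n x := fun n x => (hh n x).const_mul c

theorem isTower_polynomial (p : Polynomial ℝ) :
    IsTower fun n x => (Polynomial.derivative^[n] p).eval x := fun n x => by
  simp only [Function.iterate_succ_apply']
  exact Polynomial.hasDerivAt _ x

/-- A smooth function with `r` zeros in `[0, S]` whose `r`-th derivative is at most `B` there is at
most `B S ^ r / r!`. -/
theorem IsTower.abs_le_of_zeros {h : ℕ → ℝ → ℝ} (hh : IsTower h) {S B : ℝ} {s : Finset ℝ} {r : ℕ}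
    (hs : s.card = r) (hsub : ∀ x ∈ s, x ∈ Set.Icc 0 S) (hz : ∀ x ∈ s, h 0 x = 0)
    (hB : ∀ x ∈ Set.Icc 0 S, |h r x| ≤ B) {ξ : ℝ} (hξ : ξ ∈ Set.Icc 0 S) :
    |h 0 ξ| ≤ B * S ^ r / (r.factorial : ℝ) := by
  classical
  have hS : 0 ≤ S := hξ.1.trans hξ.2
  have hB0 : 0 ≤ B := (abs_nonneg _).trans (hB ξ hξ)
  by_cases hmem : ξ ∈ s
  · rw [hz ξ hmem, abs_zero]; positivity
  set P : Polynomial ℝ := ∏ z ∈ s, (Polynomial.X - Polynomial.C z) with hP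
  have hPmonic : P.Monic := Polynomial.monic_prod_of_monic _ _ fun z _ => Polynomial.monic_X_sub_C z
  have hPdeg : P.natDegree = r := by
    rw [hP, Polynomial.natDegree_prod_of_monic _ _ fun z _ => Polynomial.monic_X_sub_C z]
    simp [hs]
  have hPeval : ∀ x, P.eval x = ∏ z ∈ s, (x - z) := fun x => by
    rw [hP, Polynomial.eval_prod]; simp
  have hPne : P.eval ξ ≠ 0 := by
    rw [hPeval, Finset.prod_ne_zero_iff]
    intro z hz' h0
    exact hmem (by rwa [sub_eq_zero.1 h0])
  -- With this multiple, `h 0 - l P` vanishes at `ξ` as well as on `s`. These `r + 1` zeros leave a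
  -- point `c` with `h r c = l r!`, because `P` is monic of degree `r`.
  set l := h 0 ξ / P.eval ξ with hl
  have htow := hh.sub ((isTower_polynomial P).const_mul l)
  obtain ⟨t, ht, htsub, htz⟩ := htow.exists_finset_zeros r (r := 1) (s := insert ξ s)
    (a := 0) (b := S) (by rw [Finset.card_insert_of_notMem hmem, hs]; ring)
    (by
      intro x hx
      rcases Finset.mem_insert.1 hx with rfl | hx
      · exact hξ
      · exact hsub x hx)
    (by
      intro x hx
      rcases Finset.mem_insert.1 hx with rfl | hx
      · simp [hl, hPne]
      · have : P.eval x = 0 := by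
          rw [hPeval]; exact Finset.prod_eq_zero hx (sub_self x)
        simp [hz x hx, this])
  obtain ⟨c, hc⟩ := Finset.card_pos.1 (by omega : 0 < t.card)
  have hder : (Polynomial.derivative^[r] P).eval c = (r.factorial : ℝ) := by
    have hd : (Polynomial.derivative^[r] P).natDegree = 0 := by
      have := Polynomial.natDegree_iterate_derivative P r
      omega
    rw [Polynomial.eq_C_of_natDegree_eq_zero hd, Polynomial.eval_C,
      Polynomial.coeff_iterate_derivative]
    have : P.coeff (0 + r) = 1 := by
      rw [zero_add, ← hPdeg]; exact hPmonic.coeff_natDegree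
    rw [this, zero_add, Nat.descFactorial_self]; simp
  have hcz := htz c hc
  simp only [hder] at hcz
  have hle : |l| * (r.factorial : ℝ) ≤ B := by
    have := hB c (htsub c hc)
    rwa [sub_eq_zero.1 hcz, abs_mul, Nat.abs_cast] at this
  have hprod : |P.eval ξ| ≤ S ^ r := by
    rw [hPeval, Finset.abs_prod, ← hs, ← Finset.prod_const]
    refine Finset.prod_le_prod (fun _ _ => abs_nonneg _) fun z hz' => ?_
    have := hsub z hz'
    rw [abs_le]; constructor <;> linarith [this.1, this.2, hξ.1, hξ.2]
  have hfac : (0 : ℝ) < r.factorial := by positivity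
  have h0 : h 0 ξ = l * P.eval ξ := by rw [hl, div_mul_cancel₀ _ hPne]
  rw [h0, abs_mul, le_div_iff₀ hfac]
  calc |l| * |P.eval ξ| * r.factorial = (|l| * r.factorial) * |P.eval ξ| := by ring
    _ ≤ B * S ^ r := mul_le_mul hle hprod (abs_nonneg _) hB0

/-- The weights of the `m`-th derivative at `0` of Lagrange interpolation at the nodes `k`. -/
def lagrangeWeight {N : ℕ} (k : Fin N → ℝ) (m : ℕ) (i : Fin N) : ℝ :=
  (Polynomial.derivative^[m] (Lagrange.basis Finset.univ k i)).eval 0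

/-- The difference of `G 0` and its interpolant vanishes at the `N` nodes, so its `m`-th derivative
has `N - m` zeros in `[0, S]`. Another `N - m` derivatives lead to `G N` alone, since the
interpolant has degree less than `N`. -/
theorem IsTower.abs_sub_interpolation_le {G : ℕ → ℝ → ℝ} (hG : IsTower G) {N : ℕ}
    {k : Fin N → ℝ} (hk : Function.Injective k) {S B : ℝ} (hS : 0 ≤ S)
    (hkS : ∀ i, k i ∈ Set.Icc 0 S) (hB : ∀ x ∈ Set.Icc 0 S, |G N x| ≤ B) {m : ℕ} (hm : m ≤ N) :
    |G m 0 - ∑ i, lagrangeWeight k m i * G 0 (k i)| ≤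
      B * S ^ (N - m) / ((N - m).factorial : ℝ) := by
  classical
  set I := Lagrange.interpolate Finset.univ k (fun i => G 0 (k i)) with hI
  have hdeg : I.degree < N := by
    have := Lagrange.degree_interpolate_lt (s := Finset.univ) (v := k) (fun i => G 0 (k i))
      hk.injOn
    rwa [Finset.card_univ, Fintype.card_fin] at this
  have htow := hG.sub (isTower_polynomial I)
  obtain ⟨t, ht, htsub, htz⟩ := htow.exists_finset_zeros m (r := N - m)
    (s := Finset.univ.image k) (a := 0) (b := S)
    (by rw [Finset.card_image_of_injective _ hk]; simp; omega)
    (by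
      intro x hx
      obtain ⟨i, -, rfl⟩ := Finset.mem_image.1 hx
      exact hkS i)
    (by
      intro x hx
      obtain ⟨i, -, rfl⟩ := Finset.mem_image.1 hx
      rw [Function.iterate_zero_apply, hI, Lagrange.eval_interpolate_at_node (s := Finset.univ)
        (v := k) (fun i => G 0 (k i)) hk.injOn (Finset.mem_univ i), sub_self])
  have h1 := (htow.shift m).abs_le_of_zeros ht htsub (by simpa using htz) (B := B)
    (by
      intro x hx
      have hz : Polynomial.derivative^[N] I = 0 :=
        Polynomial.iterate_derivative_eq_zero_of_degree_lt hdeg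
      simpa [Nat.sub_add_cancel hm, hz] using hB x hx)
    (Set.left_mem_Icc.2 hS)
  have h2 : (Polynomial.derivative^[m] I).eval 0 = ∑ i, lagrangeWeight k m i * G 0 (k i) := by
    rw [hI, Lagrange.interpolate_apply, Polynomial.iterate_derivative_sum,
      Polynomial.eval_finsetSum]
    refine Finset.sum_congr rfl fun i _ => ?_
    rw [Polynomial.iterate_derivative_C_mul, Polynomial.eval_mul, Polynomial.eval_C,
      lagrangeWeight, mul_comm]
  simpa [h2] using h1

/-! ### Towers in the frequency variable -/

/-- Differentiation in the frequency multiplies by `x` and advances the phase by `π / 2`. With `θ =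
-m π / 2`, the `m`-th derivative at frequency `0` is exactly `x ^ m`. -/
theorem isTower_cos (x θ : ℝ) :
    IsTower fun n ξ => x ^ n * Real.cos (ξ * x + θ + n * (Real.pi / 2)) := fun n ξ => by
  have h1 : HasDerivAt (fun ξ : ℝ => ξ * x + θ + n * (Real.pi / 2)) x ξ := by
    simpa using (((hasDerivAt_id ξ).mul_const x).add_const θ).add_const (n * (Real.pi / 2))
  have h2 := (h1.cos).const_mul (x ^ n)
  refine h2.congr_deriv ?_
  have h3 : ξ * x + θ + ((n + 1 : ℕ) : ℝ) * (Real.pi / 2)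
      = ξ * x + θ + n * (Real.pi / 2) + Real.pi / 2 := by push_cast; ring
  simp only [h3, Real.cos_add_pi_div_two]
  ring

/-- Leibniz' rule. The truncated index `n - 1` at `n = 0` is harmless, as its coefficient is `0`. -/
theorem IsTower.id_mul {f : ℕ → ℝ → ℝ} (hf : IsTower f) :
    IsTower fun n ξ => ξ * f n ξ + n * f (n - 1) ξ := fun n ξ => by
  cases n with
  | zero =>
    have := (hasDerivAt_id' ξ).fun_mul (hf 0 ξ)
    have e : (fun ξ => ξ * f 0 ξ + ((0 : ℕ) : ℝ) * f (0 - 1) ξ) = fun ξ => ξ * f 0 ξ := by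
      funext y; rw [Nat.cast_zero, zero_mul, add_zero]
    rw [show (fun n ξ => ξ * f n ξ + n * f (n - 1) ξ) 0 = fun ξ => ξ * f 0 ξ from e]
    refine this.congr_deriv ?_
    simp only [zero_add, Nat.cast_one, Nat.sub_self]
    ring
  | succ n =>
    have := ((hasDerivAt_id' ξ).fun_mul (hf (n + 1) ξ)).fun_add
      ((hf n ξ).const_mul ((n + 1 : ℕ) : ℝ))
    refine this.congr_deriv ?_
    simp only [Nat.add_sub_cancel]
    push_cast
    ring

theorem IsTower.sq_mul {f : ℕ → ℝ → ℝ} (hf : IsTower f) :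
    IsTower fun n ξ => ξ ^ 2 * f n ξ + 2 * n * ξ * f (n - 1) ξ + n * (n - 1) * f (n - 2) ξ := by
  have h := hf.id_mul.id_mul
  have e : (fun (n : ℕ) (ξ : ℝ) =>
      ξ ^ 2 * f n ξ + 2 * n * ξ * f (n - 1) ξ + n * (n - 1) * f (n - 2) ξ) =
      fun (n : ℕ) (ξ : ℝ) => ξ * (ξ * f n ξ + n * f (n - 1) ξ) +
        n * (ξ * f (n - 1) ξ + ((n - 1 : ℕ) : ℝ) * f (n - 1 - 1) ξ) := by
    funext n ξ
    rcases n with _ | n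
    · simp; ring
    · simp only [Nat.add_sub_cancel, Nat.cast_add, Nat.cast_one]
      have : n + 1 - 2 = n - 1 := by omega
      rw [this]; ring
  rw [e]; exact h

/-! ### Trial functions approximating polynomials -/

/-- The coefficients of the derivative of a trial function. -/
def dcoef {N : ℕ} (k : Fin N → ℝ) (α : (Fin N → ℝ) × (Fin N → ℝ)) :
    (Fin N → ℝ) × (Fin N → ℝ) :=
  (fun i => k i * α.2 i, fun i => -(k i * α.1 i))

theorem hasDerivAt_trial {N : ℕ} (k : Fin N → ℝ) (α : (Fin N → ℝ) × (Fin N → ℝ)) (x : ℝ) :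
    HasDerivAt (trial k α) (trial k (dcoef k α) x) x := by
  have hk : ∀ i, HasDerivAt (fun x : ℝ => k i * x) (k i) x := fun i => by
    simpa using (hasDerivAt_id x).const_mul (k i)
  have h1 : HasDerivAt (fun x => ∑ i, α.1 i * Real.cos (k i * x))
      (∑ i, α.1 i * (-Real.sin (k i * x) * k i)) x :=
    HasDerivAt.fun_sum fun i _ => ((hk i).cos).const_mul _
  have h2 : HasDerivAt (fun x => ∑ i, α.2 i * Real.sin (k i * x))
      (∑ i, α.2 i * (Real.cos (k i * x) * k i)) x :=
    HasDerivAt.fun_sum fun i _ => ((hk i).sin).const_mul _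
  refine (h1.fun_add h2).congr_deriv ?_
  simp only [trial, dcoef]
  rw [add_comm]
  congr 1 <;> refine Finset.sum_congr rfl fun i _ => ?_ <;> ring

theorem deriv_trial {N : ℕ} (k : Fin N → ℝ) (α : (Fin N → ℝ) × (Fin N → ℝ)) :
    deriv (trial k α) = trial k (dcoef k α) :=
  funext fun x => (hasDerivAt_trial k α x).deriv

/-- The coefficients of the trial function that replaces the polynomial `p`. -/
def polyCoef {N : ℕ} (k : Fin N → ℝ) (p : Polynomial ℝ) (n : ℕ) : (Fin N → ℝ) × (Fin N → ℝ) :=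
  (fun i => ∑ m ∈ Finset.range n, p.coeff m * (lagrangeWeight k m i * Real.cos (m * (Real.pi / 2))),
   fun i => ∑ m ∈ Finset.range n, p.coeff m * (lagrangeWeight k m i * Real.sin (m * (Real.pi / 2))))

/-- The addition formula merges the cosine and sine coefficients into phase-shifted cosines. This is
the form in which Lagrange interpolation in the frequency acts on each monomial. -/
theorem trial_polyCoef {N : ℕ} (k : Fin N → ℝ) (p : Polynomial ℝ) (n : ℕ) (x : ℝ) :
    trial k (polyCoef k p n) x = ∑ m ∈ Finset.range n, p.coeff m *
      ∑ i, lagrangeWeight k m i * Real.cos (k i * x - m * (Real.pi / 2)) := by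
  simp only [trial, polyCoef, Real.cos_sub, Finset.sum_mul, Finset.mul_sum]
  rw [Finset.sum_comm, Finset.sum_comm (s := Finset.univ) (t := Finset.range n),
    ← Finset.sum_add_distrib]
  refine Finset.sum_congr rfl fun m _ => ?_
  rw [← Finset.sum_add_distrib]
  refine Finset.sum_congr rfl fun i _ => ?_
  ring

theorem trial_dcoef_polyCoef {N : ℕ} (k : Fin N → ℝ) (p : Polynomial ℝ) (n : ℕ) (x : ℝ) :
    trial k (dcoef k (polyCoef k p n)) x = ∑ m ∈ Finset.range n, p.coeff m *
      ∑ i, lagrangeWeight k m i * (k i * Real.cos (k i * x - m * (Real.pi / 2) + Real.pi / 2)) := by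
  simp only [trial, polyCoef, dcoef, Real.cos_add_pi_div_two, Real.sin_sub, Finset.sum_mul,
    Finset.mul_sum, ← Finset.sum_neg_distrib]
  rw [Finset.sum_comm, Finset.sum_comm (s := Finset.univ) (t := Finset.range n),
    ← Finset.sum_add_distrib]
  refine Finset.sum_congr rfl fun m _ => ?_
  rw [← Finset.sum_add_distrib]
  refine Finset.sum_congr rfl fun i _ => ?_
  ring

theorem trial_dcoef_dcoef_polyCoef {N : ℕ} (k : Fin N → ℝ) (p : Polynomial ℝ) (n : ℕ) (x : ℝ) :
    trial k (dcoef k (dcoef k (polyCoef k p n))) x = ∑ m ∈ Finset.range n, p.coeff m *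
      ∑ i, lagrangeWeight k m i * (-(k i ^ 2 * Real.cos (k i * x - m * (Real.pi / 2)))) := by
  simp only [trial, polyCoef, dcoef, Real.cos_sub, Finset.sum_mul, Finset.mul_sum,
    ← Finset.sum_neg_distrib]
  rw [Finset.sum_comm, Finset.sum_comm (s := Finset.univ) (t := Finset.range n),
    ← Finset.sum_add_distrib]
  refine Finset.sum_congr rfl fun m _ => ?_
  rw [← Finset.sum_add_distrib]
  refine Finset.sum_congr rfl fun i _ => ?_
  ring

/-! ### Exact matching at the origin and the interpolation error in the second derivative. -/

section

variable {N : ℕ} {k : Fin N → ℝ} {S : ℝ}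

/-- At `x = 0` the interpolated function of the frequency is constant, so its interpolation is
exact; the error bound is applied with `B = 0`. -/
theorem sum_lagrangeWeight_cos_zero (hk : Function.Injective k) (hS : 0 ≤ S)
    (hkS : ∀ i, k i ∈ Set.Icc 0 S) (hN : 2 ≤ N) {m : ℕ} (hm : m ≤ N) :
    ∑ i, lagrangeWeight k m i * Real.cos (k i * 0 - m * (Real.pi / 2)) = 0 ^ m := by
  have h := (isTower_cos 0 (-(m * (Real.pi / 2)))).abs_sub_interpolation_le hk hS hkS (B := 0)
    (by intro x _; rw [zero_pow (by omega)]; simp) hm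
  simp only [zero_mul, zero_div, abs_nonpos_iff, pow_zero, one_mul, mul_zero, Nat.cast_zero,
    add_zero, zero_add, neg_add_cancel, Real.cos_zero, mul_one, sub_eq_zero] at h
  simp only [mul_zero, zero_sub]
  exact h.symm

/-- At `x = 0` the `x`-derivative is, up to sign, a linear function of the frequency. Two nodes
suffice for exact interpolation, which is where `2 ≤ N` enters. -/
theorem sum_lagrangeWeight_deriv_zero (hk : Function.Injective k) (hS : 0 ≤ S)
    (hkS : ∀ i, k i ∈ Set.Icc 0 S) (hN : 2 ≤ N) {m : ℕ} (hm : m ≤ N) :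
    ∑ i, lagrangeWeight k m i * (k i * Real.cos (k i * 0 - m * (Real.pi / 2) + Real.pi / 2))
      = m * 0 ^ (m - 1) := by
  have h := (isTower_cos 0 (-(m * (Real.pi / 2)) + Real.pi / 2)).id_mul.abs_sub_interpolation_le
    hk hS hkS (B := 0)
    (by intro x _; rw [zero_pow (by omega), zero_pow (by omega)]; simp) hm
  simp only [zero_mul, zero_div, abs_nonpos_iff, pow_zero, one_mul, mul_zero, Nat.cast_zero,
    add_zero, zero_add, sub_eq_zero] at h
  simp only [mul_zero, zero_sub]
  rw [← h]
  rcases m with _ | m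
  · simp
  · have : -(((m + 1 : ℕ) : ℝ) * (Real.pi / 2)) + Real.pi / 2
        + ((m + 1 - 1 : ℕ) : ℝ) * (Real.pi / 2) = 0 := by
      simp only [Nat.add_sub_cancel]; push_cast; ring
    rw [this]; simp

/-- Two derivatives in `x` produce the factor `-ξ ^ 2`. The interpolation error is that of `ξ ↦ -ξ ^
2 cos (ξ x - m π / 2)`, whose `N`-th derivative has three terms by Leibniz' rule. -/
theorem sum_lagrangeWeight_deriv_two (hk : Function.Injective k) (hS : 0 ≤ S)
    (hkS : ∀ i, k i ∈ Set.Icc 0 S) (hN : 2 ≤ N) {m : ℕ} (hm : m ≤ N) {R x : ℝ}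
    (hSR : S * R ≤ N) (hx : |x| ≤ R) :
    |m * (m - 1) * x ^ (m - 2) -
      ∑ i, lagrangeWeight k m i * (-(k i ^ 2 * Real.cos (k i * x - m * (Real.pi / 2))))| ≤
      4 * N ^ 2 * R ^ (N - 2) * S ^ (N - m) / ((N - m).factorial : ℝ) := by
  have hR : 0 ≤ R := (abs_nonneg x).trans hx
  have h := ((isTower_cos x (-(m * (Real.pi / 2)))).sq_mul.const_mul (-1)).abs_sub_interpolation_le
    hk hS hkS (B := 4 * N ^ 2 * R ^ (N - 2))
    (by
      intro ξ hξ
      obtain ⟨M, rfl⟩ : ∃ M, N = M + 2 := ⟨N - 2, by omega⟩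
      have hc : ∀ (j : ℕ) (y : ℝ), |x ^ j * Real.cos y| ≤ R ^ j := fun j y => by
        rw [abs_mul, abs_pow]
        calc |x| ^ j * |Real.cos y| ≤ R ^ j * 1 :=
              mul_le_mul (pow_le_pow_left₀ (abs_nonneg _) hx _) (Real.abs_cos_le_one _)
                (abs_nonneg _) (by positivity)
          _ = R ^ j := mul_one _
      simp only [show M + 2 - 1 = M + 1 by omega, show M + 2 - 2 = M by omega]
      rw [abs_mul, abs_neg, abs_one, one_mul]
      set A := x ^ (M + 2) * Real.cos (ξ * x + -(m * (Real.pi / 2)) + ((M + 2 : ℕ) : ℝ) *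
        (Real.pi / 2)) with hA
      set A' := x ^ (M + 1) * Real.cos (ξ * x + -(m * (Real.pi / 2)) + ((M + 1 : ℕ) : ℝ) *
        (Real.pi / 2)) with hA'
      set A'' := x ^ M * Real.cos (ξ * x + -(m * (Real.pi / 2)) + (M : ℝ) *
        (Real.pi / 2)) with hA''
      have b0 : |A| ≤ R ^ (M + 2) := hc _ _
      have b1 : |A'| ≤ R ^ (M + 1) := hc _ _
      have b2 : |A''| ≤ R ^ M := hc _ _
      have hξ0 := hξ.1
      set n : ℝ := ((M + 2 : ℕ) : ℝ) with hn
      have hn2 : 2 ≤ n := by rw [hn]; push_cast; linarith [Nat.cast_nonneg (α := ℝ) M]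
      have hξR : ξ * R ≤ n := (mul_le_mul_of_nonneg_right hξ.2 hR).trans hSR
      have hξR0 : 0 ≤ ξ * R := mul_nonneg hξ0 hR
      have hn1 : 0 ≤ n - 1 := by linarith
      calc |ξ ^ 2 * A + 2 * n * ξ * A' + n * (n - 1) * A''|
          ≤ |ξ ^ 2 * A| + |2 * n * ξ * A'| + |n * (n - 1) * A''| := abs_add_three _ _ _
        _ = ξ ^ 2 * |A| + 2 * n * ξ * |A'| + n * (n - 1) * |A''| := by
            rw [abs_mul (ξ ^ 2) A, abs_mul (2 * n * ξ) A', abs_mul (n * (n - 1)) A'',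
              abs_of_nonneg (by positivity : 0 ≤ ξ ^ 2),
              abs_of_nonneg (by positivity : 0 ≤ 2 * n * ξ),
              abs_of_nonneg (by positivity : 0 ≤ n * (n - 1))]
        _ ≤ ξ ^ 2 * R ^ (M + 2) + 2 * n * ξ * R ^ (M + 1) + n * (n - 1) * R ^ M := by
            gcongr
        -- The factor `4 N ^ 2` comes from `ξ R ≤ N`: the bracket is at most `(N + N) ^ 2`.
        _ = ((ξ * R) ^ 2 + 2 * n * (ξ * R) + n * (n - 1)) * R ^ M := by ring
        _ ≤ (n ^ 2 + 2 * n * n + n * n) * R ^ M := by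
            gcongr
            linarith
        _ = 4 * n ^ 2 * R ^ M := by ring)
    hm
  refine le_trans (le_of_eq ?_) h
  congr 1
  congr 1
  · simp only [zero_mul, zero_add, mul_zero, ne_eq, OfNat.ofNat_ne_zero, not_false_eq_true,
      zero_pow]
    rcases m with _ | _ | m
    · simp
    · simp
    · have e : -(((m + 1 + 1 : ℕ) : ℝ) * (Real.pi / 2)) + ((m + 1 + 1 - 2 : ℕ) : ℝ) *
          (Real.pi / 2) = -Real.pi := by
        simp only [show m + 1 + 1 - 2 = m by omega]; push_cast; ring
      rw [e]; simp
  · refine Finset.sum_congr rfl fun i _ => ?_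
    simp only [Nat.cast_zero, zero_mul, mul_zero, add_zero, pow_zero, one_mul]
    rw [← sub_eq_add_neg]
    ring

/-- A polynomial of low degree is matched by a trial function to second order at `0`, with a tiny
error in the second derivative. -/
theorem exists_trial_approx_polynomial (hk : Function.Injective k) (hS : 0 ≤ S)
    (hkS : ∀ i, k i ∈ Set.Icc 0 S) (hN : 2 ≤ N) {R : ℝ} (hSR : S * R ≤ N) (p : Polynomial ℝ)
    {n : ℕ} (hp : p.natDegree < n) (hn : n ≤ N) :
    ∃ α, trial k α 0 = p.eval 0 ∧ trial k (dcoef k α) 0 = p.derivative.eval 0 ∧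
      ∀ x, |x| ≤ R → |trial k (dcoef k (dcoef k α)) x - p.derivative.derivative.eval x| ≤
        ∑ m ∈ Finset.range n, |p.coeff m| *
          (4 * N ^ 2 * R ^ (N - 2) * S ^ (N - m) / ((N - m).factorial : ℝ)) := by
  have hev : ∀ x, p.eval x = ∑ m ∈ Finset.range n, p.coeff m * x ^ m := fun x =>
    Polynomial.eval_eq_sum_range' hp x
  have hp' : p = ∑ m ∈ Finset.range n, Polynomial.C (p.coeff m) * Polynomial.X ^ m :=
    p.as_sum_range_C_mul_X_pow' hp
  have hd1 : ∀ x, p.derivative.eval x = ∑ m ∈ Finset.range n, p.coeff m * (m * x ^ (m - 1)) := by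
    intro x
    conv_lhs => rw [hp']
    simp [Polynomial.eval_finsetSum, Polynomial.derivative_X_pow]
  have hd2 : ∀ x, p.derivative.derivative.eval x =
      ∑ m ∈ Finset.range n, p.coeff m * (m * (m - 1) * x ^ (m - 2)) := by
    intro x
    conv_lhs => rw [hp']
    simp only [Polynomial.derivative_sum, Polynomial.derivative_C_mul, Polynomial.derivative_X_pow,
      Polynomial.eval_finsetSum, Polynomial.eval_mul, Polynomial.eval_C, Polynomial.eval_pow,
      Polynomial.eval_X]
    refine Finset.sum_congr rfl fun m _ => ?_
    rcases m with _ | m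
    · simp
    · rw [Nat.sub_sub]
      push_cast
      simp only [add_sub_cancel_right]
      ring
  have hle : ∀ m ∈ Finset.range n, m ≤ N := fun m hm => by
    have := Finset.mem_range.1 hm; omega
  refine ⟨polyCoef k p n, ?_, ?_, ?_⟩
  · rw [trial_polyCoef, hev]
    refine Finset.sum_congr rfl fun m hm => ?_
    rw [sum_lagrangeWeight_cos_zero hk hS hkS hN (hle m hm)]
  · rw [trial_dcoef_polyCoef, hd1]
    refine Finset.sum_congr rfl fun m hm => ?_
    rw [sum_lagrangeWeight_deriv_zero hk hS hkS hN (hle m hm)]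
  · intro x hx
    rw [trial_dcoef_dcoef_polyCoef, hd2, abs_sub_comm, ← Finset.sum_sub_distrib]
    refine (Finset.abs_sum_le_sum_abs _ _).trans (Finset.sum_le_sum fun m hm => ?_)
    rw [← mul_sub, abs_mul]
    exact mul_le_mul_of_nonneg_left
      (sum_lagrangeWeight_deriv_two hk hS hkS hN (hle m hm) hSR hx) (abs_nonneg _)

end

end

section

/-! ### Coefficients of bounded polynomials -/

theorem sum_abs_coeff_X_mul (p : Polynomial ℝ) (M : ℕ) :
    ∑ m ∈ Finset.range M, |(Polynomial.X * p).coeff m| ≤ ∑ m ∈ Finset.range M, |p.coeff m| := by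
  cases M with
  | zero => simp
  | succ M =>
    rw [Finset.sum_range_succ']
    simp only [Polynomial.coeff_X_mul, Polynomial.coeff_X_mul_zero, abs_zero, add_zero]
    rw [Finset.sum_range_succ]
    exact le_add_of_nonneg_right (abs_nonneg _)

/-- The recurrence `T (n + 2) = 2 X T (n + 1) - T n` gives `2 * 3 ^ (n + 1) + 3 ^ n ≤ 3 ^ (n + 2)`
for the `ℓ¹` norms of the coefficients. -/
theorem sum_abs_coeff_chebyshev (n : ℕ) :
    ∀ M, ∑ m ∈ Finset.range M, |(Polynomial.Chebyshev.T ℝ n).coeff m| ≤ 3 ^ n := by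
  have h1 : ∀ M, ∑ m ∈ Finset.range M, |(1 : Polynomial ℝ).coeff m| ≤ 1 := by
    intro M
    simp only [Polynomial.coeff_one]
    calc ∑ m ∈ Finset.range M, |if m = 0 then (1 : ℝ) else 0|
        = ∑ m ∈ Finset.range M, if m = 0 then (1 : ℝ) else 0 := by
          refine Finset.sum_congr rfl fun m _ => ?_
          split_ifs <;> simp
      _ ≤ 1 := by
          rw [Finset.sum_ite_eq']
          split_ifs <;> norm_num
  induction n using Nat.twoStepInduction with
  | zero => intro M; simpa using h1 M
  | one =>
    intro M
    have := (sum_abs_coeff_X_mul 1 M).trans (h1 M)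
    simp only [mul_one] at this
    simp only [Nat.cast_one, Polynomial.Chebyshev.T_one, pow_one]
    linarith
  | more n ih0 ih1 =>
    intro M
    have hT : Polynomial.Chebyshev.T ℝ ((n + 2 : ℕ) : ℤ) =
        2 * (Polynomial.X * Polynomial.Chebyshev.T ℝ ((n + 1 : ℕ) : ℤ))
          - Polynomial.Chebyshev.T ℝ (n : ℤ) := by
      have := Polynomial.Chebyshev.T_add_two ℝ (n : ℤ)
      push_cast
      rw [this]; ring
    have hc : ∀ m, |(Polynomial.Chebyshev.T ℝ ((n + 2 : ℕ) : ℤ)).coeff m| ≤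
        2 * |(Polynomial.X * Polynomial.Chebyshev.T ℝ ((n + 1 : ℕ) : ℤ)).coeff m|
          + |(Polynomial.Chebyshev.T ℝ (n : ℤ)).coeff m| := by
      intro m
      rw [hT, Polynomial.coeff_sub, Polynomial.coeff_ofNat_mul]
      refine (abs_sub _ _).trans ?_
      rw [abs_mul]; norm_num
    refine (Finset.sum_le_sum fun m _ => hc m).trans ?_
    rw [Finset.sum_add_distrib, ← Finset.mul_sum]
    have a := (sum_abs_coeff_X_mul _ M).trans (ih1 M)
    have b := ih0 M
    have : (0 : ℝ) < 3 ^ n := by positivity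
    calc _ ≤ 2 * (3 : ℝ) ^ (n + 1) + 3 ^ n := by gcongr
      _ ≤ 3 ^ (n + 2) := by rw [pow_succ, pow_succ, pow_succ]; linarith

/-- Chebyshev's extremal property of the leading coefficient, applied to `p / B` and to `-p / B`. -/
theorem abs_coeff_le_of_abs_le {n : ℕ} {p : Polynomial ℝ} (hp : p.natDegree ≤ n) {B : ℝ}
    (hB : 0 < B) (h : ∀ x ∈ Set.Icc (-1 : ℝ) 1, |p.eval x| ≤ B) :
    |p.coeff n| ≤ 2 ^ (n - 1) * B := by
  have key : ∀ c : ℝ, |c| ≤ B⁻¹ → c * p.coeff n ≤ 2 ^ (n - 1) := by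
    intro c hc
    have := Polynomial.Chebyshev.coeff_le_of_forall_abs_le_one (n := n) (P := Polynomial.C c * p)
      (Polynomial.degree_le_of_natDegree_le ((Polynomial.natDegree_C_mul_le _ _).trans hp))
      (fun x hx => by
        rw [Polynomial.eval_mul, Polynomial.eval_C, abs_mul]
        calc |c| * |p.eval x| ≤ B⁻¹ * B :=
              mul_le_mul hc (h x hx) (abs_nonneg _) (by positivity)
          _ = 1 := inv_mul_cancel₀ hB.ne')
    rwa [Polynomial.coeff_C_mul] at this
  have h1 := key B⁻¹ (by rw [abs_of_pos (by positivity)])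
  have h2 := key (-B⁻¹) (by rw [abs_neg, abs_of_pos (by positivity)])
  rw [neg_mul] at h2
  have h3 : |B⁻¹ * p.coeff n| ≤ 2 ^ (n - 1) := abs_le'.2 ⟨h1, h2⟩
  rw [abs_mul, abs_of_pos (by positivity : 0 < B⁻¹), inv_mul_le_iff₀ hB] at h3
  linarith

/-- Subtract the multiple `c T` of the Chebyshev polynomial that removes the top coefficient.
Extremality gives `|c| ≤ B`, so the rest has lower degree and is bounded by `2 B`. The induction
closes because `3 ^ (n + 1) B + 3 ^ (n + 1) (2 B) = 3 ^ (n + 2) B`. -/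
theorem sum_abs_coeff_le_of_abs_le {n : ℕ} : ∀ {p : Polynomial ℝ}, p.natDegree ≤ n → ∀ {B : ℝ},
    0 < B → (∀ x ∈ Set.Icc (-1 : ℝ) 1, |p.eval x| ≤ B) → ∀ M,
    ∑ m ∈ Finset.range M, |p.coeff m| ≤ 3 ^ (n + 1) * B := by
  induction n with
  | zero =>
    intro p hp B hB h M
    have h0 : p = Polynomial.C (p.coeff 0) := Polynomial.eq_C_of_natDegree_le_zero hp
    have hc : |p.coeff 0| ≤ B := by
      have := h 0 (by simp)
      rw [h0, Polynomial.eval_C] at this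
      exact this
    have : ∀ m, |p.coeff m| = if m = 0 then |p.coeff 0| else 0 := by
      intro m
      conv_lhs => rw [h0]
      rw [Polynomial.coeff_C]
      split_ifs <;> simp
    rw [Finset.sum_congr rfl fun m _ => this m, Finset.sum_ite_eq']
    rw [zero_add, pow_one]
    split_ifs <;> linarith
  | succ n ih =>
    intro p hp B hB h M
    set T := Polynomial.Chebyshev.T ℝ ((n + 1 : ℕ) : ℤ) with hT
    set c := p.coeff (n + 1) / 2 ^ n with hc
    have hcB : |c| ≤ B := by
      have := abs_coeff_le_of_abs_le hp hB h
      rw [Nat.add_sub_cancel] at this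
      rw [hc, abs_div, abs_of_pos (by positivity : (0 : ℝ) < 2 ^ n), div_le_iff₀ (by positivity)]
      linarith
    have hTdeg : T.natDegree = n + 1 := by
      rw [hT, Polynomial.Chebyshev.natDegree_T, Int.natAbs_natCast]
    have hTlead : T.coeff (n + 1) = 2 ^ n := by
      have := Polynomial.Chebyshev.leadingCoeff_T (R := ℝ) ((n + 1 : ℕ) : ℤ)
      rwa [← hT, Polynomial.leadingCoeff, hTdeg, Int.natAbs_natCast, Nat.add_sub_cancel] at this
    set q := p - Polynomial.C c * T with hq
    have hqdeg : q.natDegree ≤ n := by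
      rw [Polynomial.natDegree_le_iff_coeff_eq_zero]
      intro m hm
      rw [hq, Polynomial.coeff_sub, Polynomial.coeff_C_mul]
      rcases (Nat.succ_le_of_lt hm).eq_or_lt with h1 | h1
      · have h2 : m = n + 1 := h1.symm
        rw [h2, hTlead, hc, div_mul_cancel₀ _ (by positivity), sub_self]
      · rw [Polynomial.coeff_eq_zero_of_natDegree_lt (by omega),
          Polynomial.coeff_eq_zero_of_natDegree_lt (by omega)]
        ring
    have hqB : ∀ x ∈ Set.Icc (-1 : ℝ) 1, |q.eval x| ≤ 2 * B := by
      intro x hx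
      have h1 : |T.eval x| ≤ 1 :=
        Polynomial.Chebyshev.abs_eval_T_real_le_one _ (abs_le.2 ⟨hx.1, hx.2⟩)
      rw [hq, Polynomial.eval_sub, Polynomial.eval_mul, Polynomial.eval_C]
      refine (abs_sub _ _).trans ?_
      rw [abs_mul]
      have := mul_le_mul hcB h1 (abs_nonneg _) hB.le
      linarith [h x hx]
    have hsum := ih hqdeg (by positivity : 0 < 2 * B) hqB M
    have hT3 := sum_abs_coeff_chebyshev (n + 1) M
    have hpc : ∀ m, |p.coeff m| ≤ |c| * |T.coeff m| + |q.coeff m| := by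
      intro m
      have : p.coeff m = c * T.coeff m + q.coeff m := by
        rw [hq, Polynomial.coeff_sub, Polynomial.coeff_C_mul]; ring
      rw [this, ← abs_mul]
      exact abs_add_le _ _
    refine (Finset.sum_le_sum fun m _ => hpc m).trans ?_
    rw [Finset.sum_add_distrib, ← Finset.mul_sum]
    calc _ ≤ B * (3 : ℝ) ^ (n + 1) + 3 ^ (n + 1) * (2 * B) := by
          gcongr
      _ = 3 ^ (n + 1 + 1) * B := by ring

/-- The coefficients of a polynomial of degree at most `n` that is bounded by `B` on `[-R, R]`. -/
theorem sum_abs_coeff_mul_pow_le {n : ℕ} {p : Polynomial ℝ} (hp : p.natDegree ≤ n) {B R : ℝ}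
    (hR : 0 ≤ R) (hB : 0 < B) (h : ∀ x, |x| ≤ R → |p.eval x| ≤ B) (M : ℕ) :
    ∑ m ∈ Finset.range M, |p.coeff m| * R ^ m ≤ 3 ^ (n + 1) * B := by
  have := sum_abs_coeff_le_of_abs_le (p := p.comp (Polynomial.C R * Polynomial.X)) (n := n)
    (Polynomial.natDegree_comp_le.trans (by
      calc p.natDegree * (Polynomial.C R * Polynomial.X).natDegree ≤ p.natDegree * 1 :=
            Nat.mul_le_mul_left _ ((Polynomial.natDegree_C_mul_le _ _).trans Polynomial.natDegree_X_le)
        _ ≤ n := by omega)) hB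
    (fun x hx => by
      rw [Polynomial.eval_comp]
      simp only [Polynomial.eval_mul, Polynomial.eval_C, Polynomial.eval_X]
      refine h _ ?_
      rw [abs_mul, abs_of_nonneg hR]
      exact mul_le_of_le_one_right hR (abs_le.2 ⟨hx.1, hx.2⟩)) M
  refine le_trans (le_of_eq (Finset.sum_congr rfl fun m _ => ?_)) this
  rw [Polynomial.comp_C_mul_X_coeff, abs_mul, abs_pow, abs_of_nonneg hR]

end

section

/-! ### Orthogonal polynomials on `[-R, R]` -/

/-- The `L²(-R, R)` inner product of two polynomials. -/
def polyInner (R : ℝ) (p q : Polynomial ℝ) : ℝ := ∫ x in (-R)..R, p.eval x * q.eval x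

/-- The Legendre operator `p ↦ -((R² - x²) p')'`. -/
def legendreOp (R : ℝ) (p : Polynomial ℝ) : Polynomial ℝ :=
  -Polynomial.derivative
    ((Polynomial.C (R ^ 2) - Polynomial.X ^ 2) * Polynomial.derivative p)

/-- The Dirichlet form `∫ (R² - x²) p' q'`. -/
def legendreForm (R : ℝ) (p q : Polynomial ℝ) : ℝ :=
  ∫ x in (-R)..R, (R ^ 2 - x ^ 2) * (p.derivative.eval x * q.derivative.eval x)

theorem polyInner_comm (R : ℝ) (p q : Polynomial ℝ) : polyInner R p q = polyInner R q p := by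
  simp only [polyInner, mul_comm]

theorem polyInner_add_left (R : ℝ) (p q r : Polynomial ℝ) :
    polyInner R (p + q) r = polyInner R p r + polyInner R q r := by
  simp only [polyInner, Polynomial.eval_add, add_mul]
  exact intervalIntegral.integral_add ((p.continuous.mul r.continuous).intervalIntegrable _ _)
    ((q.continuous.mul r.continuous).intervalIntegrable _ _)

theorem polyInner_C_mul_left (R c : ℝ) (p r : Polynomial ℝ) :
    polyInner R (Polynomial.C c * p) r = c * polyInner R p r := by
  simp only [polyInner, Polynomial.eval_mul, Polynomial.eval_C, mul_assoc]
  exact intervalIntegral.integral_const_mul _ _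

theorem polyInner_sub_left (R : ℝ) (p q r : Polynomial ℝ) :
    polyInner R (p - q) r = polyInner R p r - polyInner R q r := by
  have := polyInner_add_left R (p - q) q r
  rw [sub_add_cancel] at this
  linarith

theorem polyInner_add_right (R : ℝ) (p q r : Polynomial ℝ) :
    polyInner R p (q + r) = polyInner R p q + polyInner R p r := by
  rw [polyInner_comm, polyInner_add_left, polyInner_comm R q, polyInner_comm R r]

theorem polyInner_C_mul_right (R c : ℝ) (p r : Polynomial ℝ) :
    polyInner R p (Polynomial.C c * r) = c * polyInner R p r := by
  rw [polyInner_comm, polyInner_C_mul_left, polyInner_comm]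

theorem polyInner_self_pos {R : ℝ} (hR : 0 < R) {p : Polynomial ℝ} (hp : p ≠ 0) :
    0 < polyInner R p p := by
  refine intervalIntegral.integral_pos (by linarith) (p.continuous.mul p.continuous).continuousOn
    (fun x _ => mul_self_nonneg _) ?_
  by_contra! hcon
  refine hp (Polynomial.eq_zero_of_infinite_isRoot p
    ((Set.Icc_infinite (by linarith : -R < R)).mono fun x hx => ?_))
  have := hcon x hx
  exact mul_self_eq_zero.1 (le_antisymm this (mul_self_nonneg _))

/-- Integration by parts, without boundary terms because the weight `R ^ 2 - x ^ 2` vanishes at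
`±R`. -/
theorem legendreForm_eq_polyInner (R : ℝ) (p q : Polynomial ℝ) :
    legendreForm R p q = polyInner R (legendreOp R p) q := by
  set u : Polynomial ℝ :=
    (Polynomial.C (R ^ 2) - Polynomial.X ^ 2) * Polynomial.derivative p with hu
  have huev : ∀ x, u.eval x = (R ^ 2 - x ^ 2) * p.derivative.eval x := fun x => by simp [hu]
  have h := intervalIntegral.integral_mul_deriv_eq_deriv_mul (a := -R) (b := R)
    (u := fun x => u.eval x) (v := fun x => q.eval x) (fun x _ => u.hasDerivAt x)
    (fun x _ => q.hasDerivAt x) (u.derivative.continuous.intervalIntegrable _ _)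
    (q.derivative.continuous.intervalIntegrable _ _)
  have h0 : u.eval R = 0 := by rw [huev]; ring
  have h1 : u.eval (-R) = 0 := by rw [huev]; ring
  rw [h0, h1, zero_mul, zero_mul, sub_zero, zero_sub] at h
  have e1 : legendreForm R p q = ∫ x in (-R)..R, u.eval x * q.derivative.eval x := by
    simp only [legendreForm, huev, mul_assoc]
  rw [e1, h, polyInner, ← intervalIntegral.integral_neg]
  simp only [legendreOp, ← hu, Polynomial.eval_neg, neg_mul]

theorem legendreForm_comm (R : ℝ) (p q : Polynomial ℝ) :
    legendreForm R p q = legendreForm R q p := by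
  simp only [legendreForm, mul_comm (p.derivative.eval _)]

theorem legendreForm_add_left (R : ℝ) (p q r : Polynomial ℝ) :
    legendreForm R (p + q) r = legendreForm R p r + legendreForm R q r := by
  rw [legendreForm_comm, legendreForm_eq_polyInner, polyInner_add_right, legendreForm_comm R p,
    legendreForm_comm R q, legendreForm_eq_polyInner, legendreForm_eq_polyInner]

theorem legendreForm_add_self (R : ℝ) (p q : Polynomial ℝ) :
    legendreForm R (p + q) (p + q) =
      legendreForm R p p + 2 * legendreForm R p q + legendreForm R q q := by
  rw [legendreForm_add_left, legendreForm_comm R p (p + q), legendreForm_comm R q (p + q),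
    legendreForm_add_left, legendreForm_add_left, legendreForm_comm R q p]
  ring

theorem legendreForm_C_mul_left (R c : ℝ) (p r : Polynomial ℝ) :
    legendreForm R (Polynomial.C c * p) r = c * legendreForm R p r := by
  rw [legendreForm_comm, legendreForm_eq_polyInner, polyInner_C_mul_right, legendreForm_comm R p,
    legendreForm_eq_polyInner]

theorem legendreForm_self_nonneg {R : ℝ} (hR : 0 < R) (p : Polynomial ℝ) :
    0 ≤ legendreForm R p p :=
  intervalIntegral.integral_nonneg (by linarith) fun x hx =>
    mul_nonneg (by nlinarith [hx.1, hx.2]) (mul_self_nonneg _)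

theorem legendreForm_self_le {R : ℝ} (hR : 0 < R) (p : Polynomial ℝ) :
    legendreForm R p p ≤ R ^ 2 * polyInner R p.derivative p.derivative := by
  rw [polyInner, ← intervalIntegral.integral_const_mul]
  refine intervalIntegral.integral_mono_on (by linarith) ?_ ?_ fun x _ => ?_
  · exact ((continuous_const.sub (continuous_pow 2)).mul
      (p.derivative.continuous.mul p.derivative.continuous)).intervalIntegrable _ _
  · exact (continuous_const.mul
      (p.derivative.continuous.mul p.derivative.continuous)).intervalIntegrable _ _
  · exact mul_le_mul_of_nonneg_right (by nlinarith [sq_nonneg x]) (mul_self_nonneg _)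

/-- In the monomial basis the operator is upper triangular with diagonal `m (m + 1)`: it does not
raise degrees, and the diagonal entries are its eigenvalues. -/
theorem coeff_legendreOp (R : ℝ) (p : Polynomial ℝ) (m : ℕ) :
    (legendreOp R p).coeff m =
      m * (m + 1) * p.coeff m - R ^ 2 * ((m + 1) * (m + 2)) * p.coeff (m + 2) := by
  rw [legendreOp, Polynomial.coeff_neg, Polynomial.coeff_derivative, sub_mul,
    Polynomial.coeff_sub, Polynomial.coeff_C_mul, Polynomial.coeff_derivative]
  rcases m with _ | m
  · have : (Polynomial.X ^ 2 * Polynomial.derivative p).coeff (0 + 1) = 0 := by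
      rw [Polynomial.coeff_X_pow_mul']; simp
    rw [this]; push_cast; ring
  · rw [show m + 1 + 1 = m + 2 from rfl, Polynomial.coeff_X_pow_mul, Polynomial.coeff_derivative]
    push_cast
    ring

/-- `p` has degree less than `d`. -/
def DegLT (d : ℕ) (p : Polynomial ℝ) : Prop := ∀ m, d ≤ m → p.coeff m = 0

theorem DegLT.add {d : ℕ} {p q : Polynomial ℝ} (hp : DegLT d p) (hq : DegLT d q) :
    DegLT d (p + q) := fun m hm => by rw [Polynomial.coeff_add, hp m hm, hq m hm, add_zero]

theorem DegLT.C_mul {d : ℕ} {p : Polynomial ℝ} (hp : DegLT d p) (c : ℝ) :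
    DegLT d (Polynomial.C c * p) := fun m hm => by rw [Polynomial.coeff_C_mul, hp m hm, mul_zero]

theorem DegLT.mono {d e : ℕ} {p : Polynomial ℝ} (hp : DegLT d p) (h : d ≤ e) : DegLT e p :=
  fun m hm => hp m (h.trans hm)

theorem DegLT.legendreOp {d : ℕ} {p : Polynomial ℝ} (hp : DegLT d p) (R : ℝ) :
    DegLT d (legendreOp R p) := fun m hm => by
  rw [coeff_legendreOp, hp m hm, hp (m + 2) (by omega)]; ring

theorem degLT_natDegree_succ (p : Polynomial ℝ) : DegLT (p.natDegree + 1) p :=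
  fun _ hm => Polynomial.coeff_eq_zero_of_natDegree_lt hm

/-- One step of Gram–Schmidt: the projection onto degree less than `d` makes `X ^ d` orthogonal to
all lower degrees, and the component along the resulting monic polynomial `Q` is added. -/
theorem exists_orthogonal_projection {R : ℝ} (hR : 0 < R) (d : ℕ) :
    ∀ p : Polynomial ℝ, ∃ q, DegLT d q ∧ ∀ r, DegLT d r → polyInner R (p - q) r = 0 := by
  induction d with
  | zero =>
    intro p
    refine ⟨0, fun _ _ => Polynomial.coeff_zero _, fun r hr => ?_⟩
    have : r = 0 := Polynomial.ext fun m => by simpa using hr m (Nat.zero_le m)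
    simp [this, polyInner]
  | succ d ih =>
    intro p
    obtain ⟨t, ht, hto⟩ := ih (Polynomial.X ^ d)
    obtain ⟨q, hq, hqo⟩ := ih p
    set Q := Polynomial.X ^ d - t with hQ
    have hQd : Q.coeff d = 1 := by
      rw [hQ, Polynomial.coeff_sub, Polynomial.coeff_X_pow_self, ht d le_rfl, sub_zero]
    have hQdeg : DegLT (d + 1) Q := fun m hm => by
      rw [hQ, Polynomial.coeff_sub, Polynomial.coeff_X_pow, if_neg (by omega), ht m (by omega),
        sub_zero]
    have hQ0 : Q ≠ 0 := fun h => by rw [h] at hQd; simp at hQd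
    have hQpos := polyInner_self_pos hR hQ0
    refine ⟨q + Polynomial.C (polyInner R (p - q) Q / polyInner R Q Q) * Q,
      (hq.mono d.le_succ).add (hQdeg.C_mul _), fun r hr => ?_⟩
    have hr' : DegLT d (r - Polynomial.C (r.coeff d) * Q) := fun m hm => by
      rw [Polynomial.coeff_sub, Polynomial.coeff_C_mul]
      rcases hm.eq_or_lt with rfl | h
      · rw [hQd]; ring
      · rw [hr m h, hQdeg m h]; ring
    have hrs : r = (r - Polynomial.C (r.coeff d) * Q) + Polynomial.C (r.coeff d) * Q := by ring
    have key : ∀ c s, polyInner R (p - q - Polynomial.C c * Q) s =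
        polyInner R (p - q) s - c * polyInner R Q s := fun c s => by
      rw [polyInner_sub_left R (p - q), polyInner_C_mul_left]
    rw [hrs, polyInner_add_right, polyInner_C_mul_right, ← sub_sub, key, key, hqo _ hr', hto _ hr',
      div_mul_cancel₀ _ hQpos.ne']
    ring

/-- The spectral gap of the Legendre operator on polynomials orthogonal to low degrees. -/
theorem le_legendreForm_self {R : ℝ} (hR : 0 < R) (d n : ℕ) :
    ∀ p : Polynomial ℝ, DegLT n p → (∀ r, DegLT d r → polyInner R p r = 0) →
      (d * (d + 1) : ℝ) * polyInner R p p ≤ legendreForm R p p := by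
  induction n with
  | zero =>
    intro p hp _
    have : p = 0 := Polynomial.ext fun m => by simpa using hp m (Nat.zero_le m)
    simp [this, polyInner, legendreForm]
  | succ n ih =>
    intro p hp hpo
    rcases le_or_gt (n + 1) d with hnd | hnd
    -- In this case `p` has degree less than `d` and is orthogonal to itself.
    · rw [hpo p (hp.mono hnd), mul_zero]
      exact legendreForm_self_nonneg hR p
    -- `Q` is the monic orthogonal polynomial of degree `n`. Splitting off its multiple decouples
    -- both the inner product and the Dirichlet form.
    obtain ⟨t, ht, hto⟩ := exists_orthogonal_projection hR n (Polynomial.X ^ n)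
    set Q := Polynomial.X ^ n - t with hQ
    have hQn : Q.coeff n = 1 := by
      rw [hQ, Polynomial.coeff_sub, Polynomial.coeff_X_pow_self, ht n le_rfl, sub_zero]
    have hQdeg : DegLT (n + 1) Q := fun m hm => by
      rw [hQ, Polynomial.coeff_sub, Polynomial.coeff_X_pow, if_neg (by omega), ht m (by omega),
        sub_zero]
    set c := p.coeff n with hc
    set p' := p - Polynomial.C c * Q with hp'
    have hp'deg : DegLT n p' := fun m hm => by
      rw [hp', Polynomial.coeff_sub, Polynomial.coeff_C_mul]
      rcases hm.eq_or_lt with rfl | h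
      · rw [hQn, hc]; ring
      · rw [hp m h, hQdeg m h]; ring
    have hp'o : ∀ r, DegLT d r → polyInner R p' r = 0 := fun r hr => by
      rw [hp', polyInner_sub_left, polyInner_C_mul_left, hpo r hr, hto r (hr.mono (by omega))]
      ring
    have hsplit : p = Polynomial.C c * Q + p' := by rw [hp']; ring
    have hQQ : legendreForm R Q Q = n * (n + 1) * polyInner R Q Q := by
      -- `Q` behaves as an eigenfunction: the leading terms cancel, so the remainder has degree less
      -- than `n` and is orthogonal to `Q`.
      have he : DegLT n (legendreOp R Q - Polynomial.C (n * (n + 1) : ℝ) * Q) := fun m hm => by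
        rw [Polynomial.coeff_sub, Polynomial.coeff_C_mul, coeff_legendreOp,
          hQdeg (m + 2) (by omega)]
        rcases hm.eq_or_lt with rfl | h
        · ring
        · rw [hQdeg m h]; ring
      have h0 := hto _ he
      rw [polyInner_comm, polyInner_sub_left, polyInner_C_mul_left,
        ← legendreForm_eq_polyInner] at h0
      linarith
    have hQp' : legendreForm R Q p' = 0 := by
      rw [legendreForm_comm, legendreForm_eq_polyInner, polyInner_comm]
      exact hto _ (hp'deg.legendreOp R)
    have hip : polyInner R p p = c ^ 2 * polyInner R Q Q + polyInner R p' p' := by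
      conv_lhs => rw [hsplit]
      rw [polyInner_add_left, polyInner_add_right, polyInner_add_right, polyInner_C_mul_left,
        polyInner_C_mul_right, polyInner_C_mul_left, polyInner_comm R p', polyInner_C_mul_left,
        hto _ hp'deg]
      ring
    have hform : legendreForm R p p = c ^ 2 * legendreForm R Q Q + legendreForm R p' p' := by
      conv_lhs => rw [hsplit]
      rw [legendreForm_add_self, legendreForm_C_mul_left, legendreForm_C_mul_left, hQp',
        legendreForm_comm R Q, legendreForm_C_mul_left]
      ring
    have hrec := ih p' hp'deg hp'o
    rw [hip, hform, hQQ]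
    have hQ0 : 0 ≤ polyInner R Q Q :=
      intervalIntegral.integral_nonneg (by linarith) fun x _ => mul_self_nonneg _
    have hdn : (d : ℝ) ≤ n := by exact_mod_cast Nat.lt_succ_iff.1 hnd
    have hd0 : (0 : ℝ) ≤ d := Nat.cast_nonneg d
    have hdd : (d * (d + 1) : ℝ) ≤ n * (n + 1) := by gcongr
    have := mul_le_mul_of_nonneg_right hdd (mul_nonneg (sq_nonneg c) hQ0)
    nlinarith

/-- Jackson's inequality in `L²` for polynomials. -/
theorem exists_polyInner_sub_le {R : ℝ} (hR : 0 < R) {d : ℕ} (hd : 0 < d) (p : Polynomial ℝ) :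
    ∃ q, DegLT d q ∧ polyInner R (p - q) (p - q) ≤
      (R / d) ^ 2 * polyInner R p.derivative p.derivative := by
  obtain ⟨q, hq, hqo⟩ := exists_orthogonal_projection hR d p
  refine ⟨q, hq, ?_⟩
  have h1 := le_legendreForm_self hR d _ (p - q) (degLT_natDegree_succ _) hqo
  -- Pythagoras for the Dirichlet form: the operator preserves degree less than `d`, so the cross
  -- term is an inner product of `p - q` with such a polynomial.
  have h2 : legendreForm R p p = legendreForm R (p - q) (p - q) + legendreForm R q q := by
    have := legendreForm_add_self R (p - q) q
    rw [sub_add_cancel] at this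
    rw [this, legendreForm_comm R (p - q) q, legendreForm_eq_polyInner R q (p - q),
      polyInner_comm, hqo _ (hq.legendreOp R)]
    ring
  have h3 := legendreForm_self_nonneg hR q
  have h4 := legendreForm_self_le hR p
  have hd' : (0 : ℝ) < d := by exact_mod_cast hd
  have h5 : 0 ≤ polyInner R (p - q) (p - q) :=
    intervalIntegral.integral_nonneg (by linarith) fun x _ => mul_self_nonneg _
  rw [div_pow, div_mul_eq_mul_div, le_div_iff₀ (by positivity)]
  nlinarith

end

section

/-! ### Best polynomial approximation in `L²(-R, R)` -/

/-- Lebesgue measure on `(-R, R)`. -/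
abbrev vol (R : ℝ) : Measure ℝ := volume.restrict (Set.Ioo (-R) R)

/-- The norm of `L²(-R, R)`. -/
def l2norm (R : ℝ) (h : ℝ → ℝ) : ℝ := √(∫ x in Set.Ioo (-R) R, h x ^ 2)

theorem l2norm_nonneg (R : ℝ) (h : ℝ → ℝ) : 0 ≤ l2norm R h := Real.sqrt_nonneg _

theorem l2norm_sq (R : ℝ) (h : ℝ → ℝ) :
    l2norm R h ^ 2 = ∫ x in Set.Ioo (-R) R, h x ^ 2 :=
  Real.sq_sqrt (integral_nonneg fun _ => sq_nonneg _)

theorem eLpNorm_two_eq {R : ℝ} {h : ℝ → ℝ} (hh : MemLp h 2 (vol R)) :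
    eLpNorm h 2 (vol R) = ENNReal.ofReal (l2norm R h) := by
  rw [hh.eLpNorm_eq_integral_rpow_norm (by norm_num) (by norm_num), l2norm, Real.sqrt_eq_rpow]
  congr 1
  simp

theorem integral_abs_le {R : ℝ} (hR : 0 < R) {h : ℝ → ℝ} (hh : MemLp h 2 (vol R)) :
    ∫ x in Set.Ioo (-R) R, |h x| ≤ √(2 * R) * l2norm R h := by
  have h1 := integral_mul_le_Lp_mul_Lq_of_nonneg (μ := vol R) (f := fun _ => (1 : ℝ))
    (g := fun x => |h x|) Real.HolderConjugate.two_two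
    (Filter.Eventually.of_forall fun _ => zero_le_one)
    (Filter.Eventually.of_forall fun _ => abs_nonneg _) (by simpa using memLp_const 1)
    (by rw [ENNReal.ofReal_ofNat]; exact hh.abs)
  simp only [one_mul, Real.rpow_two, sq_abs, ← Real.sqrt_eq_rpow] at h1
  refine h1.trans (le_of_eq ?_)
  rw [l2norm]
  congr 2
  rw [one_pow, integral_const, smul_eq_mul, mul_one, Measure.real, Measure.restrict_apply_univ,
    Real.volume_Ioo, ENNReal.toReal_ofReal (by linarith)]
  ring

theorem abs_integral_zero_le {R : ℝ} (hR : 0 < R) {h : ℝ → ℝ} (hh : MemLp h 2 (vol R)) {x : ℝ}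
    (hx : x ∈ Set.Icc (-R) R) : |∫ t in (0 : ℝ)..x, h t| ≤ √(2 * R) * l2norm R h := by
  refine le_trans ?_ (integral_abs_le hR hh)
  have h1 : Integrable h (vol R) := hh.integrable (by norm_num)
  have h2 := intervalIntegral.norm_integral_le_integral_norm_uIoc (f := h) (a := 0) (b := x)
    (μ := volume)
  rw [← Real.norm_eq_abs]
  refine h2.trans ?_
  have h3 : IntegrableOn (fun x => ‖h x‖) (Set.Ioc (-R) R) volume := by
    rw [integrableOn_Ioc_iff_integrableOn_Ioo]; exact h1.norm
  calc ∫ t in Set.uIoc 0 x, ‖h t‖ ≤ ∫ t in Set.Ioc (-R) R, ‖h t‖ :=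
        setIntegral_mono_set h3 (Filter.Eventually.of_forall fun _ => norm_nonneg _)
          (Filter.Eventually.of_forall fun t ht => by
            rcases Set.mem_uIoc.1 ht with ht | ht
            · exact ⟨by linarith [ht.1], ht.2.trans hx.2⟩
            · exact ⟨lt_of_le_of_lt hx.1 ht.1, by linarith [ht.2]⟩)
    _ = ∫ t in Set.Ioo (-R) R, |h t| := by
        rw [integral_Ioc_eq_integral_Ioo]; rfl

/-- `f` is a primitive on `(-R, R)` of the square integrable function `g`. -/
structure IsPrimitive (R : ℝ) (f g : ℝ → ℝ) : Prop where
  memLp : MemLp g 2 (vol R)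
  eq : ∀ x ∈ Set.Ioo (-R) R, f x = f 0 + ∫ t in (0 : ℝ)..x, g t

theorem intervalIntegrable_of_memLp {R : ℝ} {g : ℝ → ℝ} (hg : MemLp g 2 (vol R)) {x y : ℝ}
    (hx : x ∈ Set.Icc (-R) R) (hy : y ∈ Set.Icc (-R) R) : IntervalIntegrable g volume x y := by
  have h1 : IntegrableOn g (Set.Ioc (-R) R) volume := by
    rw [integrableOn_Ioc_iff_integrableOn_Ioo]; exact hg.integrable (by norm_num)
  rw [intervalIntegrable_iff]
  refine h1.mono_set fun t ht => ?_
  rw [Set.mem_uIoc] at ht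
  rcases ht with ht | ht
  · exact ⟨lt_of_le_of_lt hx.1 ht.1, ht.2.trans hy.2⟩
  · exact ⟨lt_of_le_of_lt hy.1 ht.1, ht.2.trans hx.2⟩

theorem continuousOn_integral_zero {R : ℝ} (hR : 0 < R) {g : ℝ → ℝ} (hg : MemLp g 2 (vol R)) :
    ContinuousOn (fun x => ∫ t in (0 : ℝ)..x, g t) (Set.Icc (-R) R) := by
  have := intervalIntegral.continuousOn_primitive_interval' (μ := volume) (f := g) (a := 0)
    (b₁ := -R) (b₂ := R)
    (intervalIntegrable_of_memLp hg (by constructor <;> linarith) (by constructor <;> linarith))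
    (by rw [Set.uIcc_of_le (by linarith)]; constructor <;> linarith)
  rwa [Set.uIcc_of_le (by linarith)] at this

theorem IsPrimitive.aestronglyMeasurable {R : ℝ} (hR : 0 < R) {f g : ℝ → ℝ}
    (h : IsPrimitive R f g) : AEStronglyMeasurable f (vol R) := by
  have hc : ContinuousOn f (Set.Ioo (-R) R) :=
    (continuousOn_const.add ((continuousOn_integral_zero hR h.memLp).mono
      Set.Ioo_subset_Icc_self)).congr h.eq
  exact hc.aestronglyMeasurable measurableSet_Ioo

theorem IsPrimitive.memLp_left {R : ℝ} (hR : 0 < R) {f g : ℝ → ℝ}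
    (h : IsPrimitive R f g) : MemLp f 2 (vol R) := by
  refine MemLp.of_bound (h.aestronglyMeasurable hR) (|f 0| + √(2 * R) * l2norm R g) ?_
  filter_upwards [ae_restrict_mem measurableSet_Ioo] with x hx
  rw [h.eq x hx, Real.norm_eq_abs]
  exact (abs_add_le _ _).trans
    (add_le_add_right (abs_integral_zero_le hR h.memLp (Set.Ioo_subset_Icc_self hx)) _)

theorem Polynomial_memLp (R : ℝ) (p : Polynomial ℝ) :
    MemLp (fun x => p.eval x) 2 (vol R) := by
  have h1 : MemLp (fun x => p.eval x) 2 (volume.restrict (Set.Icc (-R) R)) := by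
    obtain ⟨C, hC⟩ := isCompact_Icc.exists_bound_of_continuousOn
      (f := fun x => p.eval x) (s := Set.Icc (-R) R) p.continuous.continuousOn
    refine MemLp.of_bound p.continuous.aestronglyMeasurable C ?_
    filter_upwards [ae_restrict_mem measurableSet_Icc] with x hx using hC x hx
  exact h1.mono_measure (Measure.restrict_mono Set.Ioo_subset_Icc_self le_rfl)

theorem exists_polynomial_primitive (c : ℝ) (q : Polynomial ℝ) :
    ∃ p : Polynomial ℝ, p.derivative = q ∧ p.eval 0 = c ∧ ∀ d, DegLT d q → DegLT (d + 1) p := by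
  refine ⟨Polynomial.C c + ∑ m ∈ Finset.range (q.natDegree + 1),
    Polynomial.monomial (m + 1) (q.coeff m / (m + 1)), ?_, ?_, ?_⟩
  · rw [Polynomial.derivative_add, Polynomial.derivative_C, zero_add, Polynomial.derivative_sum]
    conv_rhs => rw [q.as_sum_range]
    refine Finset.sum_congr rfl fun m _ => ?_
    rw [Polynomial.derivative_monomial]
    congr 1
    push_cast
    field_simp
  · simp [Polynomial.eval_finsetSum]
  · intro d hd m hm
    rw [Polynomial.coeff_add, Polynomial.finsetSum_coeff, Polynomial.coeff_C_of_ne_zero (by omega),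
      zero_add]
    refine Finset.sum_eq_zero fun i _ => ?_
    rw [Polynomial.coeff_monomial]
    split_ifs with h
    · rw [hd i (by omega), zero_div]
    · rfl

theorem eval_eq_add_integral_derivative (p : Polynomial ℝ) (x : ℝ) :
    p.eval x = p.eval 0 + ∫ t in (0 : ℝ)..x, p.derivative.eval t := by
  rw [intervalIntegral.integral_eq_sub_of_hasDerivAt (fun t _ => p.hasDerivAt t)
    (p.derivative.continuous.intervalIntegrable _ _)]
  ring

theorem IsPrimitive.sub_polynomial {R : ℝ} (hR : 0 < R) {f g : ℝ → ℝ} (h : IsPrimitive R f g)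
    (p : Polynomial ℝ) :
    IsPrimitive R (fun x => f x - p.eval x) (fun x => g x - p.derivative.eval x) where
  memLp := h.memLp.sub (Polynomial_memLp R _)
  eq x hx := by
    have h0 : (0 : ℝ) ∈ Set.Icc (-R) R := by constructor <;> linarith
    rw [intervalIntegral.integral_sub
      (intervalIntegrable_of_memLp h.memLp h0 (Set.Ioo_subset_Icc_self hx))
      (p.derivative.continuous.intervalIntegrable _ _), h.eq x hx,
      eval_eq_add_integral_derivative p x]
    ring

/-- The distance in `L²(-R, R)` of `f` to the polynomials of degree less than `d`. -/
def bestApprox (R : ℝ) (d : ℕ) (f : ℝ → ℝ) : ENNReal :=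
  ⨅ p : {p : Polynomial ℝ // DegLT d p}, eLpNorm (fun x => f x - p.1.eval x) 2 (vol R)

theorem bestApprox_le {R : ℝ} {d : ℕ} {f : ℝ → ℝ} {p : Polynomial ℝ} (hp : DegLT d p) :
    bestApprox R d f ≤ eLpNorm (fun x => f x - p.eval x) 2 (vol R) :=
  iInf_le (fun p : {p : Polynomial ℝ // DegLT d p} =>
    eLpNorm (fun x => f x - p.1.eval x) 2 (vol R)) ⟨p, hp⟩

theorem bestApprox_le_eLpNorm (R : ℝ) (d : ℕ) (f : ℝ → ℝ) :
    bestApprox R d f ≤ eLpNorm f 2 (vol R) := by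
  have := bestApprox_le (R := R) (f := f) (d := d) (p := 0) (fun _ _ => Polynomial.coeff_zero _)
  simpa using this

theorem bestApprox_le_sub_polynomial {R : ℝ} {d : ℕ} {f : ℝ → ℝ} {p : Polynomial ℝ}
    (hp : DegLT d p) : bestApprox R d f ≤ bestApprox R d (fun x => f x - p.eval x) := by
  refine le_iInf fun q => ?_
  refine (bestApprox_le (hp.add q.2)).trans (le_of_eq ?_)
  congr 1
  ext x
  rw [Polynomial.eval_add]; ring

theorem bestApprox_le_add {R : ℝ} {d : ℕ} {f g : ℝ → ℝ} (hf : AEStronglyMeasurable f (vol R))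
    (hg : AEStronglyMeasurable g (vol R)) :
    bestApprox R d f ≤ eLpNorm (fun x => f x - g x) 2 (vol R) + bestApprox R d g := by
  rw [bestApprox, bestApprox, ENNReal.add_iInf]
  refine le_iInf fun p => (iInf_le _ p).trans ?_
  have := eLpNorm_add_le (p := 2) (hf.sub hg)
    (hg.sub (Polynomial_memLp R p.1).aestronglyMeasurable) (by norm_num)
  refine le_trans (le_of_eq ?_) this
  congr 1
  ext x
  simp

theorem bestApprox_polynomial_le {R : ℝ} (hR : 0 < R) {d : ℕ} (hd : 0 < d) (p : Polynomial ℝ) :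
    bestApprox R d (fun x => p.eval x) ≤
      ENNReal.ofReal (R / d) * eLpNorm (fun x => p.derivative.eval x) 2 (vol R) := by
  obtain ⟨q, hq, hle⟩ := exists_polyInner_sub_le hR hd p
  have hin : ∀ r : Polynomial ℝ, polyInner R r r = l2norm R (fun x => r.eval x) ^ 2 := fun r => by
    rw [l2norm_sq, polyInner, intervalIntegral.integral_of_le (by linarith),
      integral_Ioc_eq_integral_Ioo]
    simp only [sq]
  refine (bestApprox_le hq).trans ?_
  have e : (fun x => p.eval x - q.eval x) = fun x => (p - q).eval x := by
    ext x; rw [Polynomial.eval_sub]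
  rw [e, eLpNorm_two_eq (Polynomial_memLp R _), eLpNorm_two_eq (Polynomial_memLp R _),
    ← ENNReal.ofReal_mul (by positivity)]
  refine ENNReal.ofReal_le_ofReal ?_
  rw [hin, hin, ← mul_pow] at hle
  exact le_of_sq_le_sq hle (mul_nonneg (by positivity) (l2norm_nonneg _ _))

theorem exists_polynomial_eLpNorm_sub_le {R : ℝ} (hR : 0 < R) {g : ℝ → ℝ}
    (hg : MemLp g 2 (vol R)) {ε : ℝ} (hε : 0 < ε) :
    ∃ q : Polynomial ℝ, eLpNorm (fun x => g x - q.eval x) 2 (vol R) ≤ ENNReal.ofReal ε := by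
  obtain ⟨b, hb, hbm⟩ := hg.exists_boundedContinuous_eLpNorm_sub_le (by norm_num)
    (ε := ENNReal.ofReal (ε / 2)) (by simpa using hε)
  have hs : 0 < √(2 * R) := Real.sqrt_pos.2 (by linarith)
  obtain ⟨q, hq⟩ := exists_polynomial_near_of_continuousOn (-R) R b b.continuous.continuousOn
    (ε / 2 / √(2 * R)) (by positivity)
  refine ⟨q, ?_⟩
  have h1 : eLpNorm (fun x => b x - q.eval x) 2 (vol R) ≤ ENNReal.ofReal (ε / 2) := by
    refine (eLpNorm_le_of_ae_bound (C := ε / 2 / √(2 * R)) ?_).trans (le_of_eq ?_)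
    · filter_upwards [ae_restrict_mem measurableSet_Ioo] with x hx
      rw [Real.norm_eq_abs, abs_sub_comm]
      exact (hq x (Set.Ioo_subset_Icc_self hx)).le
    · rw [Measure.restrict_apply_univ, Real.volume_Ioo, ENNReal.ofReal_rpow_of_pos (by linarith),
        ← ENNReal.ofReal_mul (Real.rpow_nonneg (by linarith) _)]
      congr 1
      rw [show R - -R = 2 * R by ring, ENNReal.toReal_ofNat, ← one_div, ← Real.sqrt_eq_rpow]
      field_simp
  have h2 := eLpNorm_add_le (p := 2) (μ := vol R) (hg.sub hbm).aestronglyMeasurable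
    (hbm.sub (Polynomial_memLp R q)).aestronglyMeasurable (by norm_num)
  have e : (fun x => g x - q.eval x) = (g - b) + (b - fun x => q.eval x) := by
    ext x; simp
  rw [e]
  refine h2.trans ((add_le_add hb h1).trans (le_of_eq ?_))
  rw [← ENNReal.ofReal_add (by positivity) (by positivity), add_halves]

theorem l2norm_le_of_abs_le {R : ℝ} (hR : 0 < R) {f : ℝ → ℝ} {C : ℝ}
    (hC : ∀ x ∈ Set.Ioo (-R) R, |f x| ≤ C) :
    eLpNorm f 2 (vol R) ≤ ENNReal.ofReal (√(2 * R) * C) := by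
  refine (eLpNorm_le_of_ae_bound (C := C) ?_).trans (le_of_eq ?_)
  · filter_upwards [ae_restrict_mem measurableSet_Ioo] with x hx using hC x hx
  · rw [Measure.restrict_apply_univ, Real.volume_Ioo, ENNReal.ofReal_rpow_of_pos (by linarith),
      ← ENNReal.ofReal_mul (Real.rpow_nonneg (by linarith) _), show R - -R = 2 * R by ring, ENNReal.toReal_ofNat,
      ← one_div, ← Real.sqrt_eq_rpow]

/-- Density. A polynomial `q` close to `g` in `L²` has a primitive that agrees with `f` at `0` and
is uniformly close to `f` by Cauchy–Schwarz, and the polynomial case applies to this primitive. -/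
theorem IsPrimitive.bestApprox_le {R : ℝ} (hR : 0 < R) {f g : ℝ → ℝ} (h : IsPrimitive R f g)
    {d : ℕ} (hd : 0 < d) :
    bestApprox R d f ≤ ENNReal.ofReal (R / d) * eLpNorm g 2 (vol R) := by
  have hRd : 0 ≤ R / d := by positivity
  refine ENNReal.le_of_forall_pos_le_add fun ε hε _ => ?_
  -- The two occurrences of `δ` below have coefficients `2 R`, from `√(2 R) ^ 2`, and `R / d`;
  -- together they cost exactly `ε`.
  set δ : ℝ := ε / (2 * R + R / d) with hδ
  have hpos : 0 < 2 * R + R / d := by positivity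
  have hδ0 : 0 < δ := by positivity
  obtain ⟨q, hq⟩ := exists_polynomial_eLpNorm_sub_le hR h.memLp hδ0
  obtain ⟨p, hp, hp0, -⟩ := exists_polynomial_primitive (f 0) q
  have hprim := h.sub_polynomial hR p
  rw [hp] at hprim
  have hl2 : l2norm R (fun x => g x - q.eval x) ≤ δ := by
    rw [eLpNorm_two_eq hprim.memLp] at hq
    exact (ENNReal.ofReal_le_ofReal_iff hδ0.le).1 hq
  have h1 : eLpNorm (fun x => f x - p.eval x) 2 (vol R) ≤ ENNReal.ofReal (2 * R * δ) := by
    refine (l2norm_le_of_abs_le hR (C := √(2 * R) * δ) fun x hx => ?_).trans (le_of_eq ?_)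
    · rw [hprim.eq x hx, hp0, sub_self, zero_add]
      exact (abs_integral_zero_le hR hprim.memLp (Set.Ioo_subset_Icc_self hx)).trans
        (mul_le_mul_of_nonneg_left hl2 (Real.sqrt_nonneg _))
    · rw [← mul_assoc, Real.mul_self_sqrt (by linarith)]
  have h2 : eLpNorm (fun x => q.eval x) 2 (vol R) ≤ eLpNorm g 2 (vol R) + ENNReal.ofReal δ := by
    have := eLpNorm_sub_le (p := 2) (μ := vol R) h.memLp.aestronglyMeasurable
      hprim.memLp.aestronglyMeasurable (by norm_num)
    refine le_trans (le_of_eq ?_) (this.trans (add_le_add le_rfl hq))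
    congr 1
    ext x
    simp
  calc bestApprox R d f
      ≤ eLpNorm (fun x => f x - p.eval x) 2 (vol R) + bestApprox R d (fun x => p.eval x) :=
        bestApprox_le_add (h.aestronglyMeasurable hR)
          (Polynomial_memLp R p).aestronglyMeasurable
    _ ≤ ENNReal.ofReal (2 * R * δ) + ENNReal.ofReal (R / d) *
          (eLpNorm g 2 (vol R) + ENNReal.ofReal δ) := by
        refine add_le_add h1 ((bestApprox_polynomial_le hR hd p).trans ?_)
        rw [hp]
        exact mul_le_mul_right h2 _
    _ = ENNReal.ofReal (R / d) * eLpNorm g 2 (vol R) + ε := by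
        have he : ENNReal.ofReal (2 * R * δ) + ENNReal.ofReal (R / d) * ENNReal.ofReal δ
            = (ε : ENNReal) := by
          rw [← ENNReal.ofReal_mul hRd, ← ENNReal.ofReal_add (by positivity) (by positivity),
            ← add_mul, hδ, mul_div_cancel₀ _ hpos.ne', ENNReal.ofReal_coe_nnreal]
        rw [mul_add, ← he]
        ring

/-- Jackson's inequality: one derivative gains a factor `R / (d + 1)`. -/
theorem IsPrimitive.bestApprox_succ_le {R : ℝ} (hR : 0 < R) {f g : ℝ → ℝ}
    (h : IsPrimitive R f g) (d : ℕ) :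
    bestApprox R (d + 1) f ≤ ENNReal.ofReal (R / (d + 1)) * bestApprox R d g := by
  conv_rhs => rw [bestApprox]
  rw [ENNReal.mul_iInf_of_ne (by simpa using (by positivity : 0 < R / ((d : ℝ) + 1)))
    ENNReal.ofReal_ne_top]
  refine le_iInf fun q => ?_
  -- A primitive of `q` has degree less than `d + 1`, so subtracting it is free on the left and
  -- replaces `g` by `g - q` on the right.
  obtain ⟨p, hp, -, hdeg⟩ := exists_polynomial_primitive 0 q.1
  have hprim := h.sub_polynomial hR p
  rw [hp] at hprim
  refine (bestApprox_le_sub_polynomial (hdeg d q.2)).trans ?_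
  simpa using hprim.bestApprox_le hR d.succ_pos

/-- Iterated Jackson inequality. -/
theorem bestApprox_le_of_tower {R : ℝ} (hR : 0 < R) {w : ℕ → ℝ → ℝ} {k : ℕ} :
    (∀ j < k, IsPrimitive R (w j) (w (j + 1))) → ∀ d,
    bestApprox R (d + k) (w 0) ≤
      ENNReal.ofReal (R ^ k * (d.factorial / (d + k).factorial)) * bestApprox R d (w k) := by
  induction k with
  | zero =>
    intro _ d
    have : (d.factorial : ℝ) ≠ 0 := by positivity
    simp [div_self this]
  | succ k ih =>
    intro h d
    -- The first `k` derivatives are used from level `d + 1` upwards and the last one at level `d`;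
    -- the factor `1 / (d + 1)` turns `(d + 1)!` into `d!`.
    have h1 := ih (fun j hj => h j (by omega)) (d + 1)
    have h2 := (h k (by omega)).bestApprox_succ_le hR d
    rw [show d + (k + 1) = d + 1 + k by ring]
    refine h1.trans ((mul_le_mul_right h2 _).trans (le_of_eq ?_))
    rw [← mul_assoc, ← ENNReal.ofReal_mul (by positivity)]
    congr 2
    rw [Nat.factorial_succ]
    push_cast
    field_simp
    ring

end

section

/-! ### Weak derivatives on an interval -/

/-- The fundamental lemma of the calculus of variations, applied to `v - v'`. -/
theorem HasWeakDeriv.ae_eq {R : ℝ} {n : ℕ} {u v v' : ℝ → ℝ}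
    (h : HasWeakDeriv (Set.Ioo (-R) R) n u v) (h' : HasWeakDeriv (Set.Ioo (-R) R) n u v') :
    v =ᵐ[vol R] v' := by
  have h0 := isOpen_Ioo.ae_eq_zero_of_integral_contDiff_smul_eq_zero (μ := volume)
    (U := Set.Ioo (-R) R) (f := fun x => v x - v' x) (h.2.1.sub h'.2.1) (by
      intro φ hφ hc hs
      have hz : ∀ x, x ∉ Set.Ioo (-R) R → φ x • (v x - v' x) = 0 := fun x hx => by
        rw [image_eq_zero_of_notMem_tsupport fun hx' => hx (hs hx'), zero_smul]
      have hint : ∀ w : ℝ → ℝ, LocallyIntegrableOn w (Set.Ioo (-R) R) →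
          IntegrableOn (fun x => w x * φ x) (Set.Ioo (-R) R) := by
        intro w hw
        have h1 : IntegrableOn (fun x => w x * φ x) (tsupport φ) :=
          (hw.integrableOn_compact_subset hs hc.isCompact).mul_continuousOn
            hφ.continuous.continuousOn hc.isCompact
        refine (IntegrableOn.integrable_of_forall_notMem_eq_zero h1 fun x hx => ?_).integrableOn
        rw [image_eq_zero_of_notMem_tsupport hx, mul_zero]
      have h1 := h.2.2 φ hφ hc hs
      rw [h'.2.2 φ hφ hc hs] at h1
      have h2 := mul_left_cancel₀ (pow_ne_zero n (by norm_num : (-1 : ℝ) ≠ 0)) h1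
      rw [← setIntegral_eq_integral_of_forall_compl_eq_zero hz]
      simp only [smul_eq_mul, mul_comm (φ _), sub_mul]
      rw [integral_sub (hint v h.2.1) (hint v' h'.2.1), h2, sub_self])
  rw [Filter.EventuallyEq, ae_restrict_iff' measurableSet_Ioo]
  filter_upwards [h0] with x hx hxm
  linarith [hx hxm]

theorem hasWeakDeriv_weakDeriv {Ω : Set ℝ} {n : ℕ} {u v : ℝ → ℝ} (h : HasWeakDeriv Ω n u v) :
    HasWeakDeriv Ω n u (weakDeriv Ω n u) := by
  have hex : ∃ v, HasWeakDeriv Ω n u v := ⟨v, h⟩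
  rw [weakDeriv, dif_pos hex]
  exact hex.choose_spec

theorem HasWeakDeriv.weakDeriv_ae_eq {R : ℝ} {n : ℕ} {u v : ℝ → ℝ}
    (h : HasWeakDeriv (Set.Ioo (-R) R) n u v) :
    weakDeriv (Set.Ioo (-R) R) n u =ᵐ[vol R] v :=
  (hasWeakDeriv_weakDeriv h).ae_eq h

theorem HasWeakDeriv.zero_ae_eq {R : ℝ} {u v : ℝ → ℝ}
    (h : HasWeakDeriv (Set.Ioo (-R) R) 0 u v) : v =ᵐ[vol R] u :=
  h.ae_eq ⟨h.1, h.1, fun φ _ _ _ => by simp⟩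

/-- A compact subset of `(-R, R)` stays away from the end points. -/
theorem exists_abs_le_of_isCompact {R : ℝ} (hR : 0 < R) {K : Set ℝ} (hK : IsCompact K)
    (hsub : K ⊆ Set.Ioo (-R) R) : ∃ c, 0 ≤ c ∧ c < R ∧ ∀ x ∈ K, |x| ≤ c := by
  rcases K.eq_empty_or_nonempty with rfl | hne
  · exact ⟨0, le_rfl, hR, by simp⟩
  · obtain ⟨x, hx, hmax⟩ := hK.exists_isMaxOn hne continuous_abs.continuousOn
    exact ⟨|x|, abs_nonneg x, abs_lt.2 ⟨(hsub hx).1, (hsub hx).2⟩, fun y hy => hmax hy⟩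

theorem setIntegral_Ioo_eq_interval {R : ℝ} (hR : 0 < R) (f : ℝ → ℝ) :
    ∫ x in Set.Ioo (-R) R, f x = ∫ x in (-R)..R, f x := by
  rw [intervalIntegral.integral_of_le (by linarith), integral_Ioc_eq_integral_Ioo]

/-- Integration by parts of a primitive against a test function. -/
theorem integral_primitive_mul_deriv {R : ℝ} (hR : 0 < R) {g : ℝ → ℝ} (hg : MemLp g 2 (vol R))
    {φ : ℝ → ℝ} (hφ : ContDiff ℝ ∞ φ) (hs : tsupport φ ⊆ Set.Ioo (-R) R) :
    ∫ x in Set.Ioo (-R) R, (∫ t in (0 : ℝ)..x, g t) * deriv φ x =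
      -∫ x in Set.Ioo (-R) R, g x * φ x := by
  have hI : IntervalIntegrable g volume (-R) R :=
    intervalIntegrable_of_memLp hg (by constructor <;> linarith) (by constructor <;> linarith)
  have h0 : (0 : ℝ) ∈ Set.uIcc (-R) R := by
    rw [Set.uIcc_of_le (by linarith)]; constructor <;> linarith
  have h1 := (hI.absolutelyContinuousOnInterval_intervalIntegral
    h0).integral_mul_deriv_eq_deriv_mul
    ((hφ.of_le (by exact_mod_cast le_top : (1 : ℕ∞ω) ≤ ∞)).contDiffOn.absolutelyContinuousOnInterval
      (a := -R) (b := R))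
  have hφ1 : φ R = 0 := image_eq_zero_of_notMem_tsupport fun h => lt_irrefl _ (hs h).2
  have hφ2 : φ (-R) = 0 := image_eq_zero_of_notMem_tsupport fun h => lt_irrefl _ (hs h).1
  rw [setIntegral_Ioo_eq_interval hR, setIntegral_Ioo_eq_interval hR, h1, hφ1, hφ2, mul_zero,
    mul_zero, sub_zero, zero_sub]
  congr 1
  refine intervalIntegral.integral_congr_ae ?_
  filter_upwards [hI.ae_hasDerivAt_integral] with x hx hxm
  rw [(hx (Set.uIoc_subset_uIcc hxm) 0 h0).deriv]

/-- A function whose integral against all derivatives of test functions vanishes is constant. -/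
theorem ae_eq_const_of_integral_deriv_eq_zero {R : ℝ} (hR : 0 < R) {h : ℝ → ℝ}
    (hh : MemLp h 2 (vol R))
    (hz : ∀ φ : ℝ → ℝ, ContDiff ℝ ∞ φ → HasCompactSupport φ → tsupport φ ⊆ Set.Ioo (-R) R →
      ∫ x in Set.Ioo (-R) R, h x * deriv φ x = 0) :
    ∃ c, ∀ᵐ x ∂(vol R), h x = c := by
  have hint : Integrable h (vol R) := hh.integrable (by norm_num)
  -- A fixed test function `θ` of integral `1`; the constant will be the integral of `h θ`.
  let b : ContDiffBump (0 : ℝ) := ⟨R / 4, R / 2, by linarith, by linarith⟩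
  set θ : ℝ → ℝ := b.normed volume with hθ
  have hθs : ContDiff ℝ ∞ θ := b.contDiff_normed
  have hθsupp : ∀ x, R / 2 < |x| → θ x = 0 := fun x hx => by
    refine image_eq_zero_of_notMem_tsupport fun hmem => ?_
    rw [hθ, b.tsupport_normed_eq, Metric.mem_closedBall, dist_zero_right, Real.norm_eq_abs] at hmem
    exact absurd hmem (not_le.2 hx)
  have hθi : ∫ x in (-R)..R, θ x = 1 := by
    rw [← setIntegral_Ioo_eq_interval hR, setIntegral_eq_integral_of_forall_compl_eq_zero]
    · exact b.integral_normed
    · intro x hx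
      refine hθsupp x ?_
      by_contra hcon
      refine hx ?_
      have := abs_le.1 (not_lt.1 hcon)
      constructor <;> linarith [this.1, this.2]
  have hmul : ∀ ψ : ℝ → ℝ, Continuous ψ → Integrable (fun x => h x * ψ x) (vol R) := by
    intro ψ hψ
    have : IntegrableOn (fun x => h x * ψ x) (Set.Icc (-R) R) := by
      refine IntegrableOn.mul_continuousOn ?_ hψ.continuousOn isCompact_Icc
      rw [integrableOn_Icc_iff_integrableOn_Ioo]; exact hint
    exact this.mono_set Set.Ioo_subset_Icc_self
  set c := ∫ x in Set.Ioo (-R) R, h x * θ x with hc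
  refine ⟨c, ?_⟩
  have hloc : LocallyIntegrableOn (fun x => h x - c) (Set.Ioo (-R) R) volume :=
    (IntegrableOn.locallyIntegrableOn hint).sub (locallyIntegrableOn_const c)
  have h0 := isOpen_Ioo.ae_eq_zero_of_integral_contDiff_smul_eq_zero (μ := volume) hloc (by
    intro ψ hψ hψc hψs
    obtain ⟨r, hr0, hrR, hr⟩ := exists_abs_le_of_isCompact hR hψc.isCompact hψs
    have hψz : ∀ x, r < |x| → ψ x = 0 := fun x hx =>
      image_eq_zero_of_notMem_tsupport fun hmem => absurd (hr x hmem) (not_le.2 hx)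
    set I := ∫ x in (-R)..R, ψ x with hI
    -- Removing the mean makes the primitive of `η` compactly supported in `(-R, R)`. It is thus an
    -- admissible test function with derivative `η`.
    set η : ℝ → ℝ := fun x => ψ x - I * θ x with hη
    have hηs : ContDiff ℝ ∞ η := hψ.sub (contDiff_const.mul hθs)
    set ρ := max r (R / 2) with hρ
    have hρR : ρ < R := max_lt hrR (by linarith)
    have hρ0 : 0 ≤ ρ := hr0.trans (le_max_left _ _)
    have hηz : ∀ x, ρ < |x| → η x = 0 := fun x hx => by
      rw [hη]
      simp only
      rw [hψz x (lt_of_le_of_lt (le_max_left _ _) hx),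
        hθsupp x (lt_of_le_of_lt (le_max_right _ _) hx)]
      ring
    have hηi : ∫ x in (-R)..R, η x = 0 := by
      have h1 : IntervalIntegrable (fun x => I * θ x) volume (-R) R :=
        (continuous_const.mul hθs.continuous).intervalIntegrable _ _
      simp only [hη]
      rw [intervalIntegral.integral_sub (hψ.continuous.intervalIntegrable _ _) h1,
        intervalIntegral.integral_const_mul, hθi, ← hI]
      ring
    set φ : ℝ → ℝ := fun x => ∫ t in (-R)..x, η t with hφ
    have hφd : ∀ x, HasDerivAt φ (η x) x := fun x =>
      intervalIntegral.integral_hasDerivAt_right (hηs.continuous.intervalIntegrable _ _)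
        (hηs.continuous.stronglyMeasurableAtFilter _ _) hηs.continuous.continuousAt
    have hφ' : deriv φ = η := funext fun x => (hφd x).deriv
    have hφs : ContDiff ℝ ∞ φ := by
      rw [contDiff_infty_iff_deriv, hφ']
      exact ⟨fun x => (hφd x).differentiableAt, hηs⟩
    have hφz : ∀ x, ρ < |x| → φ x = 0 := by
      intro x hx
      rcases lt_abs.1 hx with h1 | h1
      · have h2 : φ x = (∫ t in (-R)..R, η t) + ∫ t in R..x, η t :=
          (intervalIntegral.integral_add_adjacent_intervals
            (hηs.continuous.intervalIntegrable _ _) (hηs.continuous.intervalIntegrable _ _)).symm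
        rw [h2, hηi, zero_add]
        refine intervalIntegral.integral_zero_ae (Filter.Eventually.of_forall fun t ht => ?_)
        refine hηz t (lt_of_lt_of_le ?_ (le_abs_self t))
        rcases Set.mem_uIoc.1 ht with ht | ht <;> linarith [ht.1]
      · refine intervalIntegral.integral_zero_ae (Filter.Eventually.of_forall fun t ht => ?_)
        refine hηz t (lt_of_lt_of_le ?_ (neg_le_abs t))
        rcases Set.mem_uIoc.1 ht with ht | ht <;> linarith [ht.2]
    have hφt : tsupport φ ⊆ Set.Icc (-ρ) ρ := by
      refine closure_minimal (fun x hx => ?_) isClosed_Icc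
      by_contra hcon
      exact hx (hφz x (not_le.1 fun hle => hcon (abs_le.1 hle)))
    have hφc : HasCompactSupport φ := isCompact_Icc.of_isClosed_subset (isClosed_tsupport φ) hφt
    have key := hz φ hφs hφc
      (hφt.trans fun x hx => ⟨by linarith [hx.1], by linarith [hx.2]⟩)
    rw [hφ'] at key
    have e1 : ∫ x in Set.Ioo (-R) R, h x * η x =
        (∫ x in Set.Ioo (-R) R, h x * ψ x) - I * c := by
      rw [hc, ← integral_const_mul, ← integral_sub (hmul ψ hψ.continuous)
        ((hmul θ hθs.continuous).const_mul I)]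
      refine integral_congr_ae (Filter.Eventually.of_forall fun x => ?_)
      simp only [hη]; ring
    have hzero : ∀ x, x ∉ Set.Ioo (-R) R → ψ x • (h x - c) = 0 := fun x hx => by
      rw [image_eq_zero_of_notMem_tsupport fun hx' => hx (hψs hx'), zero_smul]
    rw [← setIntegral_eq_integral_of_forall_compl_eq_zero hzero]
    have e2 : ∫ x in Set.Ioo (-R) R, ψ x • (h x - c) =
        (∫ x in Set.Ioo (-R) R, h x * ψ x) - c * ∫ x in Set.Ioo (-R) R, ψ x := by
      rw [← integral_const_mul, ← integral_sub (hmul ψ hψ.continuous)]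
      · refine integral_congr_ae (Filter.Eventually.of_forall fun x => ?_)
        simp only [smul_eq_mul]; ring
      · exact ((hψ.continuous.integrable_of_hasCompactSupport hψc).integrableOn).const_mul c
    rw [e2, setIntegral_Ioo_eq_interval hR ψ, ← hI]
    linarith)
  rw [ae_restrict_iff' measurableSet_Ioo]
  filter_upwards [h0] with x hx hxm
  linarith [hx hxm]

theorem memLp_integral_zero {R : ℝ} (hR : 0 < R) {g : ℝ → ℝ} (hg : MemLp g 2 (vol R)) :
    MemLp (fun x => ∫ t in (0 : ℝ)..x, g t) 2 (vol R) :=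
  IsPrimitive.memLp_left hR (f := fun x => ∫ t in (0 : ℝ)..x, g t) ⟨hg, fun x _ => by simp⟩

theorem exists_ae_eq_const_add_integral {R : ℝ} (hR : 0 < R) {f g : ℝ → ℝ}
    (hf : MemLp f 2 (vol R)) (hg : MemLp g 2 (vol R))
    (h : ∀ φ : ℝ → ℝ, ContDiff ℝ ∞ φ → HasCompactSupport φ → tsupport φ ⊆ Set.Ioo (-R) R →
      ∫ x in Set.Ioo (-R) R, f x * deriv φ x = -∫ x in Set.Ioo (-R) R, g x * φ x) :
    ∃ c, ∀ᵐ x ∂(vol R), f x = c + ∫ t in (0 : ℝ)..x, g t := by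
  have hG := memLp_integral_zero hR hg
  obtain ⟨c, hc⟩ := ae_eq_const_of_integral_deriv_eq_zero hR (hf.sub hG) (by
    intro φ hφ hφc hφs
    have hd : MemLp (deriv φ) 2 (vol R) :=
      (((contDiff_infty_iff_deriv.1 hφ).2.continuous.memLp_of_hasCompactSupport
        hφc.deriv)).restrict _
    simp only [Pi.sub_apply, sub_mul]
    have h1 : Integrable (fun x => f x * deriv φ x) (vol R) := hf.integrable_mul hd
    have h2 : Integrable (fun x => (∫ t in (0 : ℝ)..x, g t) * deriv φ x) (vol R) :=
      hG.integrable_mul hd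
    rw [integral_sub h1 h2, h φ hφ hφc hφs,
      integral_primitive_mul_deriv hR hg hφ hφs, sub_self])
  refine ⟨c, ?_⟩
  filter_upwards [hc] with x hx
  simp only [Pi.sub_apply] at hx
  linarith

/-- The representatives of a function in `H^m(-R, R)` and of its derivatives. -/
theorem exists_representatives {R : ℝ} (hR : 0 < R) {m : ℕ} {u : ℝ → ℝ}
    (h : ∀ j ≤ m, ∃ v, HasWeakDeriv (Set.Ioo (-R) R) j u v ∧ MemLp v 2 (vol R)) :
    ∃ w : ℕ → ℝ → ℝ, (∀ j ≤ m, w j =ᵐ[vol R] weakDeriv (Set.Ioo (-R) R) j u) ∧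
      (∀ j ≤ m, MemLp (w j) 2 (vol R)) ∧ w 0 =ᵐ[vol R] u ∧
      ∀ j < m, ∀ x ∈ Set.Icc (-R) R, w j x = w j 0 + ∫ t in (0 : ℝ)..x, w (j + 1) t := by
  set v : ℕ → ℝ → ℝ := fun j => weakDeriv (Set.Ioo (-R) R) j u with hv
  have hw : ∀ j ≤ m, HasWeakDeriv (Set.Ioo (-R) R) j u (v j) := fun j hj => by
    obtain ⟨_, h1, -⟩ := h j hj
    exact hasWeakDeriv_weakDeriv h1
  have hm : ∀ j ≤ m, MemLp (v j) 2 (vol R) := fun j hj => by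
    obtain ⟨_, h1, h2⟩ := h j hj
    exact h2.ae_eq h1.weakDeriv_ae_eq.symm
  have hc : ∀ j, ∃ c, j < m → ∀ᵐ x ∂(vol R), v j x = c + ∫ t in (0 : ℝ)..x, v (j + 1) t := by
    intro j
    by_cases hj : j < m
    · obtain ⟨c, hc⟩ := exists_ae_eq_const_add_integral hR (hm j hj.le) (hm (j + 1) hj) (by
        intro φ hφ hφc hφs
        have hφ' := (contDiff_infty_iff_deriv.1 hφ).2
        have h1 := (hw j hj.le).2.2 (deriv φ) hφ' hφc.deriv
          ((tsupport_deriv_subset (𝕜 := ℝ)).trans hφs)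
        have h2 := (hw (j + 1) hj).2.2 φ hφ hφc hφs
        rw [iteratedDeriv_succ', h1, pow_succ, mul_assoc] at h2
        have h3 := mul_left_cancel₀ (pow_ne_zero j (by norm_num : (-1 : ℝ) ≠ 0)) h2
        linarith)
      exact ⟨c, fun _ => hc⟩
    · exact ⟨0, fun h => absurd h hj⟩
  choose c hc using hc
  -- Below order `m` the continuous primitive is taken; at order `m` only a square integrable
  -- function is available.
  set w : ℕ → ℝ → ℝ := fun j x =>
    if j < m then c j + ∫ t in (0 : ℝ)..x, v (j + 1) t else v j x with hwdef
  have hae : ∀ j ≤ m, w j =ᵐ[vol R] v j := by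
    intro j hj
    rcases hj.lt_or_eq with hj | rfl
    · filter_upwards [hc j hj] with x hx
      simp only [hwdef, if_pos hj, hx]
    · exact Filter.Eventually.of_forall fun x => by simp [hwdef]
  refine ⟨w, hae, fun j hj => (hm j hj).ae_eq (hae j hj).symm,
    (hae 0 (Nat.zero_le _)).trans (hw 0 (Nat.zero_le _)).zero_ae_eq, fun j hj x hx => ?_⟩
  have e : ∫ t in (0 : ℝ)..x, w (j + 1) t = ∫ t in (0 : ℝ)..x, v (j + 1) t := by
    refine intervalIntegral.integral_congr_ae ?_
    have := hae (j + 1) hj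
    rw [Filter.EventuallyEq, ae_restrict_iff' measurableSet_Ioo] at this
    -- The almost everywhere identity lives on the open interval, whereas the interval of
    -- integration may contain the end point `R`.
    have h1 : ∀ᵐ x : ℝ, x ≠ R := by simp [ae_iff, measure_singleton]
    filter_upwards [this, h1] with t ht htR htm
    refine ht ?_
    rcases Set.mem_uIoc.1 htm with h | h
    · exact ⟨by linarith [h.1], lt_of_le_of_ne (h.2.trans hx.2) htR⟩
    · exact ⟨lt_of_le_of_lt hx.1 h.1, by linarith [h.2]⟩
  rw [e]
  simp [hwdef, hj]

end

section

/-! ### The minimum of the loss -/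

/-- The range of `T` is finite dimensional, hence complete, and orthogonal projection onto it
attains the distance. -/
theorem exists_min_norm_sub {V E : Type*} [AddCommGroup V] [Module ℝ V] [FiniteDimensional ℝ V]
    [NormedAddCommGroup E] [InnerProductSpace ℝ E] (T : V →ₗ[ℝ] E) (b : E) :
    ∃ a₀, ∀ a, ‖b - T a₀‖ ≤ ‖b - T a‖ := by
  obtain ⟨v, ⟨a₀, rfl⟩, hv⟩ := Submodule.exists_norm_eq_iInf_of_complete_subspace
    (LinearMap.range T) (Submodule.complete_of_finiteDimensional _) b
  refine ⟨a₀, fun a => ?_⟩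
  rw [hv]
  exact ciInf_le ⟨0, by rintro _ ⟨w, rfl⟩; exact norm_nonneg _⟩
    (⟨T a, LinearMap.mem_range_self T a⟩ : (LinearMap.range T : Set E))

section Trial

variable {N : ℕ} (k : Fin N → ℝ) (α β : (Fin N → ℝ) × (Fin N → ℝ)) (c x : ℝ)

theorem trial_add : trial k (α + β) x = trial k α x + trial k β x := by
  simp only [trial, Prod.fst_add, Prod.snd_add, Pi.add_apply, add_mul, Finset.sum_add_distrib]
  ring

theorem trial_smul : trial k (c • α) x = c * trial k α x := by
  simp only [trial, Prod.smul_fst, Prod.smul_snd, Pi.smul_apply, smul_eq_mul, mul_add,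
    Finset.mul_sum, mul_assoc]

theorem dcoef_add : dcoef k (α + β) = dcoef k α + dcoef k β := by
  ext i
  · simp [dcoef]; ring
  · simp [dcoef]; ring

theorem dcoef_smul : dcoef k (c • α) = c • dcoef k α := by
  ext i
  · simp [dcoef]; ring
  · simp [dcoef]; ring

theorem continuous_trial : Continuous (trial k α) :=
  continuous_iff_continuousAt.2 fun x => (hasDerivAt_trial k α x).continuousAt

end Trial

variable {R : ℝ}

/-- The differential operator of the problem on trial functions. -/
def BVP.interiorOp (P : BVP R) {N : ℕ} (k : Fin N → ℝ) (α : (Fin N → ℝ) × (Fin N → ℝ)) (x : ℝ) :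
    ℝ :=
  P.a x * trial k (dcoef k (dcoef k α)) x + P.b x * trial k (dcoef k α) x + P.c x * trial k α x

/-- The boundary operator of the problem on trial functions. -/
def BVP.boundaryOp (P : BVP R) {N : ℕ} (k : Fin N → ℝ) (α : (Fin N → ℝ) × (Fin N → ℝ)) (x : ℝ) :
    ℝ :=
  P.g₁ x * trial k (dcoef k α) x + P.g₂ x * trial k α x

theorem BVP.loss_eq (P : BVP R) (γ : ℝ) {N : ℕ} (k : Fin N → ℝ)
    (α : (Fin N → ℝ) × (Fin N → ℝ)) :
    P.loss γ k α = (∫ x in Set.Ioo (-R) R, (P.interiorOp k α x - P.f x) ^ 2) +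
      γ * bdNormSq R (fun x => P.boundaryOp k α x - P.g x) := by
  simp only [BVP.loss, deriv_trial, BVP.interiorOp, BVP.boundaryOp]

theorem memLp_mul_continuous {h T : ℝ → ℝ} (hh : MemLp h ⊤ (vol R)) (hT : Continuous T) :
    MemLp (fun x => h x * T x) 2 (vol R) := by
  obtain ⟨C, hC⟩ := isCompact_Icc.exists_bound_of_continuousOn (s := Set.Icc (-R) R)
    hT.continuousOn
  have h2 : MemLp h 2 (vol R) := hh.mono_exponent le_top
  refine MemLp.of_le_mul h2 (h2.aestronglyMeasurable.mul hT.aestronglyMeasurable) (c := C) ?_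
  filter_upwards [ae_restrict_mem measurableSet_Ioo] with x hx
  rw [norm_mul, mul_comm]
  exact mul_le_mul_of_nonneg_right (hC x (Set.Ioo_subset_Icc_self hx)) (norm_nonneg _)

theorem BVP.memLp_interiorOp (P : BVP R) {N : ℕ} (k : Fin N → ℝ)
    (α : (Fin N → ℝ) × (Fin N → ℝ)) : MemLp (P.interiorOp k α) 2 (vol R) :=
  ((memLp_mul_continuous P.memLp_a (continuous_trial k _)).add
    (memLp_mul_continuous P.memLp_b (continuous_trial k _))).add
    (memLp_mul_continuous P.memLp_c (continuous_trial k _))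

theorem BVP.interiorOp_add (P : BVP R) {N : ℕ} (k : Fin N → ℝ)
    (α β : (Fin N → ℝ) × (Fin N → ℝ)) :
    P.interiorOp k (α + β) = P.interiorOp k α + P.interiorOp k β := by
  ext x
  simp only [BVP.interiorOp, dcoef_add, trial_add, Pi.add_apply]; ring

theorem BVP.interiorOp_smul (P : BVP R) {N : ℕ} (k : Fin N → ℝ) (c : ℝ)
    (α : (Fin N → ℝ) × (Fin N → ℝ)) : P.interiorOp k (c • α) = c • P.interiorOp k α := by
  ext x
  simp only [BVP.interiorOp, dcoef_smul, trial_smul, Pi.smul_apply, smul_eq_mul]; ring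

theorem BVP.boundaryOp_add (P : BVP R) {N : ℕ} (k : Fin N → ℝ)
    (α β : (Fin N → ℝ) × (Fin N → ℝ)) (x : ℝ) :
    P.boundaryOp k (α + β) x = P.boundaryOp k α x + P.boundaryOp k β x := by
  simp only [BVP.boundaryOp, dcoef_add, trial_add]; ring

theorem BVP.boundaryOp_smul (P : BVP R) {N : ℕ} (k : Fin N → ℝ) (c : ℝ)
    (α : (Fin N → ℝ) × (Fin N → ℝ)) (x : ℝ) :
    P.boundaryOp k (c • α) x = c * P.boundaryOp k α x := by
  simp only [BVP.boundaryOp, dcoef_smul, trial_smul]; ring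

/-- The Hilbert space `L²(Ω) × L²(∂Ω)` of the residuals. -/
abbrev Residual (R : ℝ) : Type :=
  WithLp 2 (Lp ℝ 2 (vol R) × WithLp 2 (ℝ × ℝ))

/-- The residual operator, with the boundary part weighted by `√γ`. -/
def BVP.residualOp (P : BVP R) (γ : ℝ) {N : ℕ} (k : Fin N → ℝ) :
    ((Fin N → ℝ) × (Fin N → ℝ)) →ₗ[ℝ] Residual R where
  toFun α := WithLp.toLp 2 ((P.memLp_interiorOp k α).toLp _,
    WithLp.toLp 2 (√γ * P.boundaryOp k α (-R), √γ * P.boundaryOp k α R))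
  map_add' α β := by
    have e : (P.memLp_interiorOp k (α + β)).toLp _ =
        (P.memLp_interiorOp k α).toLp _ + (P.memLp_interiorOp k β).toLp _ := by
      rw [← MemLp.toLp_add]
      exact MemLp.toLp_congr _ _ (by rw [P.interiorOp_add])
    rw [e, P.boundaryOp_add, P.boundaryOp_add, mul_add, mul_add]
    rfl
  map_smul' c α := by
    have e : (P.memLp_interiorOp k (c • α)).toLp _ = c • (P.memLp_interiorOp k α).toLp _ := by
      rw [← MemLp.toLp_const_smul]
      exact MemLp.toLp_congr _ _ (by rw [P.interiorOp_smul])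
    rw [e, P.boundaryOp_smul, P.boundaryOp_smul, mul_left_comm, mul_left_comm (√γ)]
    rfl

/-- The data of the problem in the space of residuals. -/
def BVP.residualData (P : BVP R) (γ : ℝ) : Residual R :=
  WithLp.toLp 2 (P.memLp_f.toLp _, WithLp.toLp 2 (√γ * P.g (-R), √γ * P.g R))

/-- The loss is a linear least squares functional of `α` in the Hilbert space of residuals.
Existence of a minimum, continuity and nonnegativity follow from this. -/
theorem BVP.loss_eq_norm_sq (P : BVP R) {γ : ℝ} (hγ : 0 ≤ γ) {N : ℕ} (k : Fin N → ℝ)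
    (α : (Fin N → ℝ) × (Fin N → ℝ)) :
    P.loss γ k α = ‖P.residualData γ - P.residualOp γ k α‖ ^ 2 := by
  have hm : MemLp (P.f - P.interiorOp k α) 2 (vol R) := P.memLp_f.sub (P.memLp_interiorOp k α)
  have e : P.residualData γ - P.residualOp γ k α =
      WithLp.toLp 2 (hm.toLp _,
        WithLp.toLp 2 (√γ * P.g (-R) - √γ * P.boundaryOp k α (-R),
          √γ * P.g R - √γ * P.boundaryOp k α R)) := by
    rw [MemLp.toLp_sub P.memLp_f (P.memLp_interiorOp k α)]
    rfl
  rw [e, WithLp.prod_norm_sq_eq_of_L2, WithLp.prod_norm_sq_eq_of_L2, P.loss_eq]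
  simp only [Real.norm_eq_abs, sq_abs]
  have h1 : ‖hm.toLp _‖ ^ 2 = ∫ x in Set.Ioo (-R) R, (P.interiorOp k α x - P.f x) ^ 2 := by
    rw [Lp.norm_toLp, eLpNorm_two_eq hm, ENNReal.toReal_ofReal (l2norm_nonneg _ _), l2norm_sq]
    refine integral_congr_ae (Filter.Eventually.of_forall fun x => ?_)
    simp only [Pi.sub_apply]; ring
  change _ = ‖hm.toLp _‖ ^ 2 + ((√γ * P.g (-R) - √γ * P.boundaryOp k α (-R)) ^ 2 +
    (√γ * P.g R - √γ * P.boundaryOp k α R) ^ 2)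
  rw [h1, bdNormSq, ← mul_sub, ← mul_sub, mul_pow, mul_pow, Real.sq_sqrt hγ]
  ring

theorem BVP.exists_min_loss (P : BVP R) {γ : ℝ} (hγ : 0 ≤ γ) {N : ℕ} (k : Fin N → ℝ) :
    ∃ α₀, ∀ α, P.loss γ k α₀ ≤ P.loss γ k α := by
  obtain ⟨a₀, h⟩ := exists_min_norm_sub (P.residualOp γ k) (P.residualData γ)
  refine ⟨a₀, fun a => ?_⟩
  rw [P.loss_eq_norm_sq hγ, P.loss_eq_norm_sq hγ]
  exact pow_le_pow_left₀ (norm_nonneg _) (h a) 2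

theorem BVP.continuous_loss (P : BVP R) {γ : ℝ} (hγ : 0 ≤ γ) {N : ℕ} (k : Fin N → ℝ) :
    Continuous (P.loss γ k) := by
  have : P.loss γ k = fun α => ‖P.residualData γ - P.residualOp γ k α‖ ^ 2 :=
    funext (P.loss_eq_norm_sq hγ k)
  rw [this]
  exact ((continuous_const.sub
    (P.residualOp γ k).continuous_of_finiteDimensional).norm).pow 2

theorem BVP.loss_nonneg (P : BVP R) {γ : ℝ} (hγ : 0 ≤ γ) {N : ℕ} (k : Fin N → ℝ)
    (α : (Fin N → ℝ) × (Fin N → ℝ)) : 0 ≤ P.loss γ k α := by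
  rw [P.loss_eq_norm_sq hγ]; positivity

/-! ### Measurability of the loss and the law of the weights. -/

theorem measurable_trial_uncurry {N : ℕ}
    {A : (Fin N → ℝ) → (Fin N → ℝ) × (Fin N → ℝ)} (hA : Measurable A) :
    Measurable fun p : (Fin N → ℝ) × ℝ => trial p.1 (A p.1) p.2 := by
  simp only [trial]
  fun_prop

theorem measurable_dcoef {N : ℕ} {A : (Fin N → ℝ) → (Fin N → ℝ) × (Fin N → ℝ)}
    (hA : Measurable A) : Measurable fun k => dcoef k (A k) := by
  simp only [dcoef]
  fun_prop

theorem BVP.measurable_loss (P : BVP R) (γ : ℝ) {N : ℕ} (α : (Fin N → ℝ) × (Fin N → ℝ)) :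
    Measurable fun k : Fin N → ℝ => P.loss γ k α := by
  have m0 : Measurable fun _ : Fin N → ℝ => α := measurable_const
  have m1 := measurable_dcoef m0
  have m2 := measurable_dcoef m1
  have t0 := measurable_trial_uncurry m0
  have t1 := measurable_trial_uncurry m1
  have t2 := measurable_trial_uncurry m2
  have ev : ∀ x : ℝ, Measurable fun k : Fin N → ℝ => (k, x) := fun x => by fun_prop
  -- The data are only almost everywhere measurable; measurable versions leave the integral
  -- unchanged and make the integrand jointly measurable in `(k, x)`.
  obtain ⟨a, ha, ha'⟩ := P.memLp_a.aestronglyMeasurable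
  obtain ⟨b, hb, hb'⟩ := P.memLp_b.aestronglyMeasurable
  obtain ⟨c, hc, hc'⟩ := P.memLp_c.aestronglyMeasurable
  obtain ⟨f, hf, hf'⟩ := P.memLp_f.aestronglyMeasurable
  have e : (fun k : Fin N → ℝ => P.loss γ k α) = fun k : Fin N → ℝ =>
      (∫ x in Set.Ioo (-R) R, (a x * trial k (dcoef k (dcoef k α)) x +
        b x * trial k (dcoef k α) x + c x * trial k α x - f x) ^ 2) +
      γ * bdNormSq R (fun x => P.boundaryOp k α x - P.g x) := by
    ext k
    rw [P.loss_eq]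
    congr 1
    refine integral_congr_ae ?_
    filter_upwards [ha', hb', hc', hf'] with x h1 h2 h3 h4
    rw [BVP.interiorOp, h1, h2, h3, h4]
  rw [e]
  refine Measurable.add ?_ ?_
  · have hm : Measurable fun p : (Fin N → ℝ) × ℝ =>
        (a p.2 * trial p.1 (dcoef p.1 (dcoef p.1 α)) p.2 +
          b p.2 * trial p.1 (dcoef p.1 α) p.2 + c p.2 * trial p.1 α p.2 - f p.2) ^ 2 := by
      have := ha.measurable
      have := hb.measurable
      have := hc.measurable
      have := hf.measurable
      fun_prop
    exact (hm.stronglyMeasurable.integral_prod_right (ν := vol R)).measurable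
  · simp only [bdNormSq, BVP.boundaryOp]
    have a1 := t0.comp (ev R)
    have a2 := t0.comp (ev (-R))
    have a3 := t1.comp (ev R)
    have a4 := t1.comp (ev (-R))
    simp only [Function.comp_def] at a1 a2 a3 a4
    fun_prop

/-- By independence two weights have a product law of atomless measures, which does not charge the
diagonal; finitely many pairs occur. -/
theorem ae_weightLaw_mem (N : ℕ) {S : ℝ} (hS : 0 < S) :
    ∀ᵐ k ∂(weightLaw N S), Function.Injective k ∧ ∀ i, k i ∈ Set.Ioo 0 S := by
  set ν : Measure ℝ := ProbabilityTheory.cond volume (Set.Ioo 0 S) with hν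
  have : IsProbabilityMeasure ν :=
    ProbabilityTheory.cond_isProbabilityMeasure_of_finite (by simpa using hS) (by simp)
  have hac : ν ≪ volume := ProbabilityTheory.cond_absolutelyContinuous
  have hna : NullSingletonClass ν := ⟨fun x => hac (measure_singleton x)⟩
  have hmem : ∀ᵐ x ∂ν, x ∈ Set.Ioo 0 S := ProbabilityTheory.ae_cond_mem measurableSet_Ioo
  have hind := ProbabilityTheory.iIndepFun_pi (Ω := fun _ : Fin N => ℝ) (μ := fun _ : Fin N => ν)
    (X := fun _ => id) (fun _ => aemeasurable_id)
  have hev : ∀ i, (weightLaw N S).map (fun k : Fin N → ℝ => k i) = ν := fun i =>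
    (measurePreserving_eval (fun _ : Fin N => ν) i).map_eq
  have hne : ∀ i j : Fin N, i ≠ j → ∀ᵐ k ∂(weightLaw N S), k i ≠ k j := by
    intro i j hij
    have h1 := (ProbabilityTheory.indepFun_iff_map_prod_eq_prod_map_map
      (measurable_pi_apply i).aemeasurable (measurable_pi_apply j).aemeasurable).1 (hind.indepFun hij)
    have h2 : (weightLaw N S).map (fun k : Fin N → ℝ => (k i, k j)) = ν.prod ν := by
      refine h1.trans ?_
      congr 1
      · exact hev i
      · exact hev j
    have hd : MeasurableSet {p : ℝ × ℝ | p.1 = p.2} := measurableSet_eq_fun measurable_fst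
      measurable_snd
    have h3 : (ν.prod ν) {p : ℝ × ℝ | p.1 = p.2} = 0 := by
      rw [Measure.prod_apply hd]
      simp
    rw [← h2, Measure.map_apply (by fun_prop) hd] at h3
    rw [ae_iff]
    convert h3 using 2
    ext k
    simp
  have hm : ∀ i : Fin N, ∀ᵐ k ∂(weightLaw N S), k i ∈ Set.Ioo 0 S := fun i =>
    (measurePreserving_eval (fun _ : Fin N => ν) i).quasiMeasurePreserving.ae hmem
  have hall : ∀ᵐ k ∂(weightLaw N S), ∀ i j : Fin N, i ≠ j → k i ≠ k j := by
    rw [ae_all_iff]; intro i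
    rw [ae_all_iff]; intro j
    by_cases hij : i = j
    · exact Filter.Eventually.of_forall fun _ h => absurd hij h
    · filter_upwards [hne i j hij] with k hk _ using hk
  filter_upwards [hall, ae_all_iff.2 hm] with k h1 h2
  exact ⟨fun i j hij => by_contra fun h => h1 i j h hij, h2⟩

/-- A bound for the minimal loss that holds for all distinct weights holds in expectation. -/
theorem BVP.expectedMinLossLE_of_forall (P : BVP R) {γ : ℝ} (hγ : 0 ≤ γ) {N : ℕ} {S ε : ℝ}
    (hS : 0 < S)
    (h : ∀ k : Fin N → ℝ, Function.Injective k → (∀ i, k i ∈ Set.Ioo 0 S) →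
      ∀ δ > 0, ∃ α, P.loss γ k α ≤ ε + δ) : P.ExpectedMinLossLE γ N S ε := by
  have hprob : IsProbabilityMeasure (weightLaw N S) := by
    have : IsProbabilityMeasure (ProbabilityTheory.cond volume (Set.Ioo 0 S)) :=
      ProbabilityTheory.cond_isProbabilityMeasure_of_finite (by simpa using hS) (by simp)
    unfold weightLaw
    infer_instance
  choose A hA using fun k : Fin N → ℝ => P.exists_min_loss hγ k
  set m : (Fin N → ℝ) → ℝ := fun k => P.loss γ k (A k) with hm
  have hm0 : ∀ k, 0 ≤ m k := fun k => P.loss_nonneg hγ k _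
  -- Continuity in `α` reduces the minimum to a countable infimum over a dense sequence, which is
  -- measurable in `k`.
  have hinf : m = fun k => ⨅ n : ℕ, P.loss γ k (TopologicalSpace.denseSeq _ n) := by
    ext k
    have hbdd : BddBelow (Set.range fun n : ℕ => P.loss γ k (TopologicalSpace.denseSeq _ n)) :=
      ⟨0, by rintro _ ⟨n, rfl⟩; exact P.loss_nonneg hγ k _⟩
    refine le_antisymm (le_ciInf fun n => hA k _) (le_of_forall_pos_lt_add fun ε hε => ?_)
    obtain ⟨n, hn⟩ := (TopologicalSpace.denseRange_denseSeq
      ((Fin N → ℝ) × (Fin N → ℝ))).exists_mem_open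
      ((isOpen_Iio (a := m k + ε)).preimage (P.continuous_loss hγ k))
      ⟨A k, by simpa [hm] using hε⟩
    exact (ciInf_le hbdd n).trans_lt hn
  have hmeas : Measurable m := by
    rw [hinf]
    exact Measurable.iInf fun n => P.measurable_loss γ _
  -- The loss at `α = 0` does not involve `k`, so it bounds the minimum uniformly and gives
  -- integrability.
  have hb0 : ∀ k : Fin N → ℝ, m k ≤ P.loss γ (0 : Fin N → ℝ) 0 := by
    intro k
    refine (hA k 0).trans (le_of_eq ?_)
    have h0 : ∀ k : Fin N → ℝ, dcoef k 0 = 0 := fun k => by ext i <;> simp [dcoef]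
    have h1 : ∀ k : Fin N → ℝ, trial k 0 = 0 := fun k => by ext i; simp [trial]
    simp only [P.loss_eq, BVP.interiorOp, BVP.boundaryOp, h0, h1]
  refine ⟨m, fun k => ⟨⟨A k, rfl⟩, ?_⟩, ?_, ?_⟩
  · rintro _ ⟨α, rfl⟩
    exact hA k α
  · refine Integrable.of_bound hmeas.aestronglyMeasurable (P.loss γ (0 : Fin N → ℝ) 0) ?_
    refine Filter.Eventually.of_forall fun k => ?_
    rw [Real.norm_of_nonneg (hm0 k)]
    exact hb0 k
  · have hle : ∀ᵐ k ∂(weightLaw N S), m k ≤ ε := by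
      filter_upwards [ae_weightLaw_mem N hS] with k hk
      refine le_of_forall_pos_le_add fun δ hδ => ?_
      obtain ⟨α, hα⟩ := h k hk.1 hk.2 δ hδ
      exact (hA k α).trans hα
    have hint : Integrable m (weightLaw N S) := by
      refine Integrable.of_bound hmeas.aestronglyMeasurable (P.loss γ (0 : Fin N → ℝ) 0) ?_
      refine Filter.Eventually.of_forall fun k => ?_
      rw [Real.norm_of_nonneg (hm0 k)]
      exact hb0 k
    calc ∫ k, m k ∂(weightLaw N S) ≤ ∫ _, ε ∂(weightLaw N S) :=
          integral_mono_ae hint (integrable_const _) hle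
      _ = ε := by simp

end

section

/-! ### The loss of a trial function in terms of its second derivative -/

variable {R : ℝ}

/-- `w 0, …, w m` are the representatives of `u` and its first `m` weak derivatives that are
primitives of each other on `[-R, R]`. -/
structure IsRepresentative (R : ℝ) (m : ℕ) (u : ℝ → ℝ) (w : ℕ → ℝ → ℝ) : Prop where
  ae_eq : ∀ j ≤ m, w j =ᵐ[vol R] weakDeriv (Set.Ioo (-R) R) j u
  memLp : ∀ j ≤ m, MemLp (w j) 2 (vol R)
  zero_ae_eq : w 0 =ᵐ[vol R] u
  eq : ∀ j < m, ∀ x ∈ Set.Icc (-R) R, w j x = w j 0 + ∫ t in (0 : ℝ)..x, w (j + 1) t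

theorem IsRepresentative.isPrimitive {m : ℕ} {u : ℝ → ℝ} {w : ℕ → ℝ → ℝ}
    (h : IsRepresentative R m u w) {j : ℕ} (hj : j < m) : IsPrimitive R (w j) (w (j + 1)) :=
  ⟨h.memLp _ hj, fun x hx => h.eq j hj x (Set.Ioo_subset_Icc_self hx)⟩

theorem IsRepresentative.mono {m n : ℕ} {u : ℝ → ℝ} {w : ℕ → ℝ → ℝ}
    (h : IsRepresentative R m u w) (hn : n ≤ m) : IsRepresentative R n u w :=
  ⟨fun j hj => h.ae_eq j (hj.trans hn), fun j hj => h.memLp j (hj.trans hn), h.zero_ae_eq,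
    fun j hj => h.eq j (hj.trans_le hn)⟩

theorem IsRepresentative.continuousOn (hR : 0 < R) {m : ℕ} {u : ℝ → ℝ} {w : ℕ → ℝ → ℝ}
    (h : IsRepresentative R m u w) {j : ℕ} (hj : j < m) :
    ContinuousOn (w j) (Set.Icc (-R) R) :=
  (continuousOn_const.add (continuousOn_integral_zero hR (h.memLp _ hj))).congr (h.eq j hj)

theorem eqOn_Icc_of_ae_eq (hR : 0 < R) {f g : ℝ → ℝ} (h : f =ᵐ[vol R] g)
    (hf : ContinuousOn f (Set.Icc (-R) R)) (hg : ContinuousOn g (Set.Icc (-R) R)) :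
    Set.EqOn f g (Set.Icc (-R) R) := by
  refine Measure.eqOn_Icc_of_ae_eq volume (by linarith) ?_ hf hg
  rwa [← Measure.restrict_congr_set Ioo_ae_eq_Icc]

theorem BVP.IsSolution.interior_representative {P : BVP R} {u : ℝ → ℝ} (hs : P.IsSolution u)
    {w : ℕ → ℝ → ℝ} (hw : IsRepresentative R 2 u w) :
    ∀ᵐ x ∂(vol R), P.a x * w 2 x + P.b x * w 1 x + P.c x * w 0 x = P.f x := by
  filter_upwards [hs.interior, hw.ae_eq 2 le_rfl, hw.ae_eq 1 (by norm_num), hw.zero_ae_eq]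
    with x h h2 h1 h0
  rw [h2, h1, h0, h]

/-- Continuous representatives on `[-R, R]` that agree almost everywhere agree at the end points
too, so the traces may be read off from `w`. -/
theorem BVP.IsSolution.boundary_representative (hR : 0 < R) {P : BVP R} {u : ℝ → ℝ}
    (hs : P.IsSolution u) {w : ℕ → ℝ → ℝ} (hw : IsRepresentative R 2 u w) {x : ℝ}
    (hx : x ∈ ({-R, R} : Set ℝ)) : P.g₁ x * w 1 x + P.g₂ x * w 0 x = P.g x := by
  obtain ⟨u₀, u₁, hc0, hc1, h0, h1, h⟩ := hs.boundary
  have hxI : x ∈ Set.Icc (-R) R := by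
    rcases hx with rfl | rfl <;> constructor <;> linarith
  have e0 := eqOn_Icc_of_ae_eq hR (hw.zero_ae_eq.trans h0.symm)
    (hw.continuousOn hR (by norm_num)) hc0 hxI
  have e1 := eqOn_Icc_of_ae_eq hR ((hw.ae_eq 1 (by norm_num)).trans h1.symm)
    (hw.continuousOn hR (by norm_num)) hc1 hxI
  rw [e0, e1, h x hx]

/-- The constant in the bound of the loss by the error in `H²`. -/
def lossConst (R Λ₁ Λ₂ Λ₃ G₁ G₂ γ : ℝ) : ℝ :=
  3 * Λ₁ ^ 2 + 6 * R * (Λ₂ ^ 2 * (1 + √(2 * R)) ^ 2 + Λ₃ ^ 2 * (1 + R * (1 + √(2 * R))) ^ 2) +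
    2 * γ * (G₁ ^ 2 * (1 + √(2 * R)) ^ 2 + G₂ ^ 2 * (1 + R * (1 + √(2 * R))) ^ 2)

theorem lossConst_nonneg (hR : 0 < R) (Λ₁ Λ₂ Λ₃ G₁ G₂ : ℝ) {γ : ℝ} (hγ : 0 ≤ γ) :
    0 ≤ lossConst R Λ₁ Λ₂ Λ₃ G₁ G₂ γ := by
  unfold lossConst; positivity

theorem trial_eq_add_integral {N : ℕ} (k : Fin N → ℝ) (α : (Fin N → ℝ) × (Fin N → ℝ)) (x : ℝ) :
    trial k α x = trial k α 0 + ∫ t in (0 : ℝ)..x, trial k (dcoef k α) t := by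
  rw [intervalIntegral.integral_eq_sub_of_hasDerivAt (fun t _ => hasDerivAt_trial k α t)
    ((continuous_trial k _).intervalIntegrable _ _)]
  ring

theorem memLp_continuous {T : ℝ → ℝ} (hT : Continuous T) : MemLp T 2 (vol R) := by
  simpa using memLp_mul_continuous (R := R) (h := fun _ => 1) (memLp_const 1) hT

theorem sub_eq_add_integral_sub {N : ℕ} (k : Fin N → ℝ) (α : (Fin N → ℝ) × (Fin N → ℝ))
    {f g : ℝ → ℝ} (hg : MemLp g 2 (vol R)) (hR : 0 < R)
    (hf : ∀ x ∈ Set.Icc (-R) R, f x = f 0 + ∫ t in (0 : ℝ)..x, g t) {x : ℝ}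
    (hx : x ∈ Set.Icc (-R) R) :
    trial k α x - f x = (trial k α 0 - f 0) +
      ∫ t in (0 : ℝ)..x, (trial k (dcoef k α) t - g t) := by
  rw [intervalIntegral.integral_sub ((continuous_trial k _).intervalIntegrable _ _)
    (intervalIntegrable_of_memLp hg (by constructor <;> linarith) hx), trial_eq_add_integral,
    hf x hx]
  ring

theorem abs_le_of_eq_add_integral (hR : 0 < R) {E₀ E₁ : ℝ → ℝ} (hm : MemLp E₁ 2 (vol R))
    (h : ∀ x ∈ Set.Icc (-R) R, E₀ x = E₀ 0 + ∫ t in (0 : ℝ)..x, E₁ t) {x : ℝ}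
    (hx : x ∈ Set.Icc (-R) R) : |E₀ x| ≤ |E₀ 0| + √(2 * R) * l2norm R E₁ := by
  rw [h x hx]
  exact (abs_add_le _ _).trans (add_le_add_right (abs_integral_zero_le hR hm hx) _)

theorem abs_le_of_eq_add_integral_of_abs_le {E₀ E₁ : ℝ → ℝ} {K : ℝ}
    (hb : ∀ x ∈ Set.Icc (-R) R, |E₁ x| ≤ K)
    (h : ∀ x ∈ Set.Icc (-R) R, E₀ x = E₀ 0 + ∫ t in (0 : ℝ)..x, E₁ t) {x : ℝ}
    (hx : x ∈ Set.Icc (-R) R) : |E₀ x| ≤ |E₀ 0| + R * K := by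
  have hR : 0 ≤ R := by linarith [hx.1, hx.2]
  have h2 := intervalIntegral.norm_integral_le_of_norm_le_const (f := E₁) (a := 0) (b := x)
    (C := K) (fun t ht => by
      refine hb t ?_
      rcases Set.mem_uIoc.1 ht with ht | ht
      · exact ⟨by linarith [ht.1], ht.2.trans hx.2⟩
      · exact ⟨hx.1.trans ht.1.le, by linarith [ht.2]⟩)
  rw [Real.norm_eq_abs, sub_zero] at h2
  have hK : 0 ≤ K := (abs_nonneg _).trans (hb x hx)
  have h3 : K * |x| ≤ K * R := mul_le_mul_of_nonneg_left (abs_le.2 ⟨hx.1, hx.2⟩) hK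
  rw [h x hx]
  refine (abs_add_le _ _).trans ?_
  linarith

theorem add_add_sq_le (p q r : ℝ) : (p + q + r) ^ 2 ≤ 3 * (p ^ 2 + q ^ 2 + r ^ 2) := by
  nlinarith [sq_nonneg (p - q), sq_nonneg (p - r), sq_nonneg (q - r)]

theorem mul_sq_le_mul_sq {a b A B : ℝ} (ha : |a| ≤ A) (hb : |b| ≤ B) :
    (a * b) ^ 2 ≤ A ^ 2 * B ^ 2 := by
  rw [mul_pow]
  exact mul_le_mul (sq_le_sq' (abs_le.1 ha).1 (abs_le.1 ha).2)
    (sq_le_sq' (abs_le.1 hb).1 (abs_le.1 hb).2) (sq_nonneg _) (sq_nonneg _)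

theorem integral_sq_le_of_ae_eq (hR : 0 < R) {F a b c E₂ E₁ E₀ : ℝ → ℝ} {A B C K₁ K₀ : ℝ}
    (hF : ∀ᵐ x ∂(vol R), F x = a x * E₂ x + b x * E₁ x + c x * E₀ x)
    (ha : ∀ᵐ x ∂(vol R), |a x| ≤ A) (hb : ∀ᵐ x ∂(vol R), |b x| ≤ B)
    (hc : ∀ᵐ x ∂(vol R), |c x| ≤ C) (hm : MemLp E₂ 2 (vol R))
    (h₁ : ∀ x ∈ Set.Icc (-R) R, |E₁ x| ≤ K₁) (h₀ : ∀ x ∈ Set.Icc (-R) R, |E₀ x| ≤ K₀) :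
    ∫ x in Set.Ioo (-R) R, F x ^ 2 ≤
      3 * A ^ 2 * l2norm R E₂ ^ 2 + 6 * R * (B ^ 2 * K₁ ^ 2 + C ^ 2 * K₀ ^ 2) := by
  have hint2 : Integrable (fun x => E₂ x ^ 2) (vol R) := hm.integrable_sq
  have hle : ∀ᵐ x ∂(vol R), F x ^ 2 ≤
      3 * A ^ 2 * E₂ x ^ 2 + 3 * (B ^ 2 * K₁ ^ 2 + C ^ 2 * K₀ ^ 2) := by
    filter_upwards [hF, ha, hb, hc, ae_restrict_mem measurableSet_Ioo] with x hx ha hb hc hxm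
    have hxI := Set.Ioo_subset_Icc_self hxm
    have s1 := mul_sq_le_mul_sq ha (le_refl |E₂ x|)
    rw [sq_abs] at s1
    have s2 := mul_sq_le_mul_sq hb (h₁ x hxI)
    have s3 := mul_sq_le_mul_sq hc (h₀ x hxI)
    rw [hx]
    linarith [add_add_sq_le (a x * E₂ x) (b x * E₁ x) (c x * E₀ x)]
  refine (integral_mono_of_nonneg (Filter.Eventually.of_forall fun x => sq_nonneg _)
    ((hint2.const_mul _).add (integrable_const _)) hle).trans ?_
  have hvol : (vol R).real Set.univ = 2 * R := by
    rw [Measure.real, Measure.restrict_apply_univ, Real.volume_Ioo,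
      ENNReal.toReal_ofReal (by linarith)]
    ring
  change ∫ x, (3 * A ^ 2 * E₂ x ^ 2 + 3 * (B ^ 2 * K₁ ^ 2 + C ^ 2 * K₀ ^ 2)) ∂(vol R) ≤ _
  rw [integral_add (hint2.const_mul _) (integrable_const _), integral_const_mul,
    integral_const, hvol, ← l2norm_sq, smul_eq_mul]
  linarith

theorem bdNormSq_le_of_eq (hR : 0 < R) {F g₁ g₂ E₁ E₀ : ℝ → ℝ} {G₁ G₂ K₁ K₀ : ℝ}
    (hF : ∀ x ∈ ({-R, R} : Set ℝ), F x = g₁ x * E₁ x + g₂ x * E₀ x)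
    (hG₁ : √(bdNormSq R g₁) ≤ G₁) (hG₂ : √(bdNormSq R g₂) ≤ G₂)
    (h₁ : ∀ x ∈ Set.Icc (-R) R, |E₁ x| ≤ K₁) (h₀ : ∀ x ∈ Set.Icc (-R) R, |E₀ x| ≤ K₀) :
    bdNormSq R F ≤ 2 * (G₁ ^ 2 * K₁ ^ 2 + G₂ ^ 2 * K₀ ^ 2) := by
  have hG1 : bdNormSq R g₁ ≤ G₁ ^ 2 := (Real.sqrt_le_iff.1 hG₁).2
  have hG2 : bdNormSq R g₂ ≤ G₂ ^ 2 := (Real.sqrt_le_iff.1 hG₂).2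
  have hpt : ∀ x ∈ ({-R, R} : Set ℝ), F x ^ 2 ≤ 2 * (g₁ x ^ 2 * K₁ ^ 2 + g₂ x ^ 2 * K₀ ^ 2) := by
    intro x hx
    have hxI : x ∈ Set.Icc (-R) R := by
      rcases hx with rfl | rfl <;> constructor <;> linarith
    have s1 := mul_sq_le_mul_sq (le_refl |g₁ x|) (h₁ x hxI)
    have s0 := mul_sq_le_mul_sq (le_refl |g₂ x|) (h₀ x hxI)
    rw [sq_abs] at s1 s0
    rw [hF x hx]
    linarith [add_sq_le (a := g₁ x * E₁ x) (b := g₂ x * E₀ x)]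
  have h1 := hpt (-R) (by simp)
  have h2 := hpt R (by simp)
  unfold bdNormSq at hG1 hG2 ⊢
  have m1 := mul_le_mul_of_nonneg_right hG1 (sq_nonneg K₁)
  have m2 := mul_le_mul_of_nonneg_right hG2 (sq_nonneg K₀)
  linarith

/-- Subtracting the equation solved by `u` expresses both residuals through `E = u_N - u` and its
first two derivatives. Integrating from `0` bounds `E'` uniformly by `|E' 0| + √(2 R) ‖E''‖`, and
then `E` by `|E 0| + R sup |E'|`. -/
theorem BVP.loss_le (hR : 0 < R) {P : BVP R} {Λ₁ Λ₂ Λ₃ G₁ G₂ γ : ℝ}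
    (hb : P.Bounded Λ₁ Λ₂ Λ₃ G₁ G₂) (hγ : 0 ≤ γ) {u : ℝ → ℝ} (hs : P.IsSolution u)
    {w : ℕ → ℝ → ℝ} (hw : IsRepresentative R 2 u w) {N : ℕ} (k : Fin N → ℝ)
    (α : (Fin N → ℝ) × (Fin N → ℝ)) :
    P.loss γ k α ≤ lossConst R Λ₁ Λ₂ Λ₃ G₁ G₂ γ *
      (l2norm R (fun x => trial k (dcoef k (dcoef k α)) x - w 2 x) +
        |trial k (dcoef k α) 0 - w 1 0| + |trial k α 0 - w 0 0|) ^ 2 := by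
  have hm2 : MemLp (fun x => trial k (dcoef k (dcoef k α)) x - w 2 x) 2 (vol R) :=
    (memLp_continuous (continuous_trial k _)).sub (hw.memLp 2 le_rfl)
  have e1 : ∀ x ∈ Set.Icc (-R) R, _ := fun x hx => sub_eq_add_integral_sub k (dcoef k α)
    (hw.memLp 2 le_rfl) hR (hw.eq 1 (by norm_num)) hx
  have e0 : ∀ x ∈ Set.Icc (-R) R, _ := fun x hx => sub_eq_add_integral_sub k α
    (hw.memLp 1 (by norm_num)) hR (hw.eq 0 (by norm_num)) hx
  have eI : ∀ᵐ x ∂(vol R), P.interiorOp k α x - P.f x =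
      P.a x * (trial k (dcoef k (dcoef k α)) x - w 2 x) +
      P.b x * (trial k (dcoef k α) x - w 1 x) + P.c x * (trial k α x - w 0 x) := by
    filter_upwards [hs.interior_representative hw] with x hx
    rw [← hx, BVP.interiorOp]; ring
  have eB : ∀ x ∈ ({-R, R} : Set ℝ), P.boundaryOp k α x - P.g x =
      P.g₁ x * (trial k (dcoef k α) x - w 1 x) + P.g₂ x * (trial k α x - w 0 x) := by
    intro x hx
    rw [← hs.boundary_representative hR hw hx, BVP.boundaryOp]; ring
  rw [P.loss_eq, lossConst]
  have b1 := fun x hx => abs_le_of_eq_add_integral hR (E₀ := fun x => trial k (dcoef k α) x - w 1 x)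
    hm2 e1 (x := x) hx
  have b0 := fun x hx => abs_le_of_eq_add_integral_of_abs_le b1
    (E₀ := fun x => trial k α x - w 0 x) e0 (x := x) hx
  have hI := integral_sq_le_of_ae_eq hR eI hb.a_le hb.b_le hb.c_le hm2 b1 b0
  have hB := mul_le_mul_of_nonneg_left (bdNormSq_le_of_eq hR eB hb.g₁_le hb.g₂_le b1 b0) hγ
  refine (add_le_add hI hB).trans ?_
  have hl0 := l2norm_nonneg R (fun x => trial k (dcoef k (dcoef k α)) x - w 2 x)
  have p1 := abs_nonneg (trial k (dcoef k α) 0 - w 1 0)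
  have p0 := abs_nonneg (trial k α 0 - w 0 0)
  generalize l2norm R (fun x => trial k (dcoef k (dcoef k α)) x - w 2 x) = l at *
  generalize |trial k (dcoef k α) 0 - w 1 0| = y₁ at *
  generalize |trial k α 0 - w 0 0| = y₀ at *
  set X := l + y₁ + y₀ with hX
  have hX0 : 0 ≤ X := by positivity
  have k1 : y₁ + √(2 * R) * l ≤ (1 + √(2 * R)) * X := by
    rw [add_mul, one_mul]
    exact add_le_add (by linarith) (mul_le_mul_of_nonneg_left (by linarith) (Real.sqrt_nonneg _))
  have k0 : y₀ + R * (y₁ + √(2 * R) * l) ≤ (1 + R * (1 + √(2 * R))) * X := by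
    rw [add_mul, one_mul, mul_assoc]
    exact add_le_add (by linarith) (mul_le_mul_of_nonneg_left k1 hR.le)
  have k2 : l ≤ X := by linarith
  calc _ ≤ 3 * Λ₁ ^ 2 * X ^ 2 + 6 * R * (Λ₂ ^ 2 * ((1 + √(2 * R)) * X) ^ 2 +
        Λ₃ ^ 2 * ((1 + R * (1 + √(2 * R))) * X) ^ 2) +
      γ * (2 * (G₁ ^ 2 * ((1 + √(2 * R)) * X) ^ 2 +
        G₂ ^ 2 * ((1 + R * (1 + √(2 * R))) * X) ^ 2)) := by gcongr
    _ = _ := by ring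

/-! ### Passing from polynomials to trial functions -/

/-- The constant in the error of replacing a polynomial by a trial function. -/
def repConst (R : ℝ) : ℝ :=
  √(2 * R) * (4050 * (R ^ 2)⁻¹ * (1 + R + 2 * R * √(2 * R)))

theorem repConst_nonneg (hR : 0 < R) : 0 ≤ repConst R := by unfold repConst; positivity

/-- After taking fifth powers this reads `27 ^ N exp (15 / 2) ^ N ≤ 3 ^ (10 N)`, and `exp (15 / 2) ≤
3 ^ 7 = 2187`. -/
theorem pow_mul_exp_le {N n : ℕ} (hn : 5 * n ≤ N) :
    (27 : ℝ) ^ n * Real.exp (3 / 2 * N) ≤ 9 ^ N := by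
  have he : Real.exp (15 / 2) ≤ 2187 := by
    have h1 : Real.exp (15 / 2) ^ 2 ≤ 2187 ^ 2 := by
      rw [← Real.exp_nat_mul, show ((2 : ℕ) : ℝ) * (15 / 2) = ((15 : ℕ) : ℝ) * 1 by norm_num,
        Real.exp_nat_mul]
      calc Real.exp 1 ^ 15 ≤ 2.7182818286 ^ 15 :=
            pow_le_pow_left₀ (Real.exp_pos _).le Real.exp_one_lt_d9.le 15
        _ ≤ 2187 ^ 2 := by norm_num
    exact le_of_sq_le_sq h1 (by norm_num)
  have h5 : ((27 : ℝ) ^ n * Real.exp (3 / 2 * N)) ^ 5 ≤ (9 ^ N) ^ 5 := by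
    rw [mul_pow, ← pow_mul, ← Real.exp_nat_mul, ← pow_mul]
    have e1 : ((5 : ℕ) : ℝ) * (3 / 2 * N) = N * (15 / 2) := by push_cast; ring
    rw [e1, Real.exp_nat_mul]
    calc (27 : ℝ) ^ (n * 5) * Real.exp (15 / 2) ^ N ≤ 27 ^ N * 2187 ^ N := by
          gcongr
          · norm_num
          · omega
      _ = 9 ^ (N * 5) := by
          rw [← mul_pow, mul_comm N 5, pow_mul]; norm_num
  exact le_of_pow_le_pow_left₀ (by norm_num) (by positivity) h5

/-- The balance of exponents behind the choice `n = N / 5`: `N ^ 2` costs `2 / 5`, the interpolation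
error costs `9 / 11`, and `27 ^ n / 9 ^ N` gains `3 / 2`. The sum is below `-1 / 4`. -/
theorem sq_mul_pow_mul_exp_le {N n : ℕ} (hn : 5 * n ≤ N) :
    (N : ℝ) ^ 2 * (27 ^ n * Real.exp (9 / 11 * N) * (9 ^ N)⁻¹) ≤
      25 / 2 * Real.exp (-(1 / 4) * N) := by
  have hN0 : (0 : ℝ) ≤ N := Nat.cast_nonneg N
  have h1 : (N : ℝ) ^ 2 ≤ 25 / 2 * Real.exp (2 / 5 * N) := by
    have := Real.pow_div_factorial_le_exp (2 / 5 * (N : ℝ)) (by positivity) 2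
    norm_num [Nat.factorial] at this
    linarith
  have h2 := pow_mul_exp_le hn
  have h9 : (0 : ℝ) < 9 ^ N := by positivity
  have h3 : (27 : ℝ) ^ n * (9 ^ N)⁻¹ ≤ Real.exp (-(3 / 2 * N)) := by
    rw [Real.exp_neg, ← div_eq_mul_inv, div_le_iff₀ h9, ← div_eq_inv_mul,
      le_div_iff₀ (Real.exp_pos _)]
    exact h2
  calc (N : ℝ) ^ 2 * (27 ^ n * Real.exp (9 / 11 * N) * (9 ^ N)⁻¹)
      = (N : ℝ) ^ 2 * Real.exp (9 / 11 * N) * (27 ^ n * (9 ^ N)⁻¹) := by ring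
    _ ≤ (25 / 2 * Real.exp (2 / 5 * N)) * Real.exp (9 / 11 * N) * Real.exp (-(3 / 2 * N)) := by
        gcongr
    _ = 25 / 2 * Real.exp (2 / 5 * N + 9 / 11 * N + -(3 / 2 * N)) := by
        rw [Real.exp_add, Real.exp_add]; ring
    _ ≤ 25 / 2 * Real.exp (-(1 / 4) * N) := by
        gcongr
        linarith

theorem l2norm_sub_le {f g : ℝ → ℝ} (hf : MemLp f 2 (vol R)) (hg : MemLp g 2 (vol R)) :
    l2norm R (fun x => f x - g x) ≤ l2norm R f + l2norm R g := by
  have h := eLpNorm_sub_le (p := 2) hf.aestronglyMeasurable hg.aestronglyMeasurable (by norm_num)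
  have hfg : MemLp (fun x => f x - g x) 2 (vol R) := hf.sub hg
  change eLpNorm (fun x => f x - g x) 2 (vol R) ≤ _ at h
  rw [eLpNorm_two_eq hfg, eLpNorm_two_eq hf, eLpNorm_two_eq hg,
    ← ENNReal.ofReal_add (l2norm_nonneg _ _) (l2norm_nonneg _ _)] at h
  exact (ENNReal.ofReal_le_ofReal_iff (add_nonneg (l2norm_nonneg _ _) (l2norm_nonneg _ _))).1 h

theorem l2norm_neg_sub (f g : ℝ → ℝ) :
    l2norm R (fun x => f x - g x) = l2norm R (fun x => g x - f x) := by
  simp only [l2norm, sub_sq_comm]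

theorem l2norm_sub_le_add {f g h : ℝ → ℝ} (hf : MemLp f 2 (vol R)) (hg : MemLp g 2 (vol R))
    (hh : MemLp h 2 (vol R)) :
    l2norm R (fun x => f x - h x) ≤
      l2norm R (fun x => f x - g x) + l2norm R (fun x => g x - h x) := by
  have := l2norm_sub_le (f := fun x => f x - g x) (g := fun x => h x - g x) (hf.sub hg)
    (hh.sub hg)
  rw [l2norm_neg_sub h g] at this
  simpa using this

theorem l2norm_le_sqrt_mul (hR : 0 < R) {f : ℝ → ℝ} (hf : MemLp f 2 (vol R)) {C : ℝ} (hC0 : 0 ≤ C)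
    (hC : ∀ x ∈ Set.Ioo (-R) R, |f x| ≤ C) : l2norm R f ≤ √(2 * R) * C := by
  have := l2norm_le_of_abs_le hR hC
  rw [eLpNorm_two_eq hf] at this
  exact (ENNReal.ofReal_le_ofReal_iff (by positivity)).1 this

/-- A near-optimal polynomial for `v` is integrated twice, with initial values `c₁` and `c₀`, and
the result is replaced by a trial function. The replacement keeps both initial values and perturbs
the second derivative by an exponentially small amount. -/
theorem exists_trial_l2norm_le (hR : 0 < R) {v : ℝ → ℝ} (hv : MemLp v 2 (vol R)) (c₀ c₁ : ℝ)
    {N : ℕ} (hN : 3 ≤ N) {k : Fin N → ℝ} (hk : Function.Injective k)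
    (hkS : ∀ i, k i ∈ Set.Ioo 0 (N / (11 * R))) {Y : ℝ} (hY : 0 ≤ Y)
    (hE : bestApprox R (N / 5) v ≤ ENNReal.ofReal Y) {δ : ℝ} (hδ : 0 < δ) :
    ∃ α, trial k α 0 = c₀ ∧ trial k (dcoef k α) 0 = c₁ ∧
      l2norm R (fun x => trial k (dcoef k (dcoef k α)) x - v x) ≤
        Y + δ + repConst R * Real.exp (-(1 / 4) * N) * (|c₀| + |c₁| + l2norm R v + δ) := by
  set n := N / 5 with hn
  have hn5 : 5 * n ≤ N := Nat.mul_div_le N 5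
  have hl0 := l2norm_nonneg R v
  -- The minimum ensures that `q` is not only close to `v` but also bounded by `2 ‖v‖ + δ`, so that
  -- `Y` does not enter the coefficient bound.
  set Y' := min Y (l2norm R v) with hY'
  have hY'0 : 0 ≤ Y' := le_min hY hl0
  have hE' : bestApprox R n v < ENNReal.ofReal (Y' + δ) := by
    have h1 : bestApprox R n v ≤ ENNReal.ofReal Y' := by
      rw [hY', ENNReal.ofReal_min, le_min_iff]
      exact ⟨hE, (bestApprox_le_eLpNorm R n v).trans (eLpNorm_two_eq hv).le⟩
    exact h1.trans_lt ((ENNReal.ofReal_lt_ofReal_iff (by positivity)).2 (by linarith))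
  obtain ⟨⟨q, hq⟩, hqE⟩ := iInf_lt_iff.1 hE'
  have hqm := Polynomial_memLp R q
  have hqv : l2norm R (fun x => q.eval x - v x) ≤ Y' + δ := by
    have h1 : MemLp (fun x => v x - q.eval x) 2 (vol R) := hv.sub hqm
    rw [eLpNorm_two_eq h1] at hqE
    rw [l2norm_neg_sub]
    exact ((ENNReal.ofReal_lt_ofReal_iff (by positivity)).1 hqE).le
  have hql : l2norm R (fun x => q.eval x) ≤ 2 * l2norm R v + δ := by
    have h1 := l2norm_sub_le (f := fun x => q.eval x - v x) (g := fun x => -v x) (hqm.sub hv)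
      hv.neg
    have h2 : l2norm R (fun x => -v x) = l2norm R v := by simp [l2norm]
    simp only [sub_neg_eq_add, sub_add_cancel] at h1
    have h3 : Y' ≤ l2norm R v := min_le_right _ _
    linarith
  obtain ⟨q₁, hq₁, hq₁0, hq₁d⟩ := exists_polynomial_primitive c₁ q
  obtain ⟨p, hp, hp0, hpd⟩ := exists_polynomial_primitive c₀ q₁
  have hpdeg : DegLT (n + 2) p := hpd _ (hq₁d _ hq)
  have hpnat : p.natDegree ≤ n + 1 := by
    rw [Polynomial.natDegree_le_iff_coeff_eq_zero]
    intro m hm; exact hpdeg m hm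
  set A := |c₀| + |c₁| + l2norm R v + δ with hA
  have hA0 : 0 < A := by positivity
  set K := 1 + R + 2 * R * √(2 * R) with hK
  have hs0 := Real.sqrt_nonneg (2 * R)
  have hK0 : 0 < K := by positivity
  have hq₁b : ∀ x, |x| ≤ R → |q₁.eval x| ≤ |c₁| + √(2 * R) * (2 * l2norm R v + δ) := by
    intro x hx
    have hxI : x ∈ Set.Icc (-R) R := abs_le.1 hx
    rw [eval_eq_add_integral_derivative, hq₁, hq₁0]
    refine (abs_add_le _ _).trans (add_le_add_right
      ((abs_integral_zero_le hR hqm hxI).trans ?_) _)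
    gcongr
  have hpb : ∀ x, |x| ≤ R → |p.eval x| ≤ K * A := by
    intro x hx
    rw [eval_eq_add_integral_derivative, hp, hp0]
    have h2 := intervalIntegral.norm_integral_le_of_norm_le_const (f := fun t => q₁.eval t)
      (a := 0) (b := x) (C := |c₁| + √(2 * R) * (2 * l2norm R v + δ)) (fun t ht => by
        refine hq₁b t (le_trans ?_ hx)
        rcases Set.mem_uIoc.1 ht with ht | ht
        · rw [abs_of_pos ht.1]; exact ht.2.trans (le_abs_self x)
        · rw [abs_of_nonpos ht.2]; linarith [ht.1, neg_abs_le x])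
    rw [Real.norm_eq_abs, sub_zero] at h2
    have h3 : (|c₁| + √(2 * R) * (2 * l2norm R v + δ)) * |x| ≤
        (|c₁| + √(2 * R) * (2 * l2norm R v + δ)) * R := by gcongr
    refine (abs_add_le _ _).trans ?_
    have h4 : |c₀| ≤ A := by rw [hA]; linarith [abs_nonneg c₁]
    have h5 : |c₁| ≤ A := by rw [hA]; linarith [abs_nonneg c₀]
    have h6 : 2 * l2norm R v + δ ≤ 2 * A := by
      rw [hA]; linarith [abs_nonneg c₀, abs_nonneg c₁]
    have h7 : (|c₁| + √(2 * R) * (2 * l2norm R v + δ)) * R ≤ (A + √(2 * R) * (2 * A)) * R := by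
      gcongr
    calc _ ≤ A + (A + √(2 * R) * (2 * A)) * R := by linarith
      _ = K * A := by rw [hK]; ring
  have hcoef := sum_abs_coeff_mul_pow_le hpnat hR.le (by positivity : 0 < K * A) hpb (n + 2)
  set S : ℝ := N / (11 * R) with hS
  have hNpos : (0 : ℝ) < N := by exact_mod_cast (by omega : 0 < N)
  have hSR : S * R = N / 11 := by rw [hS]; field_simp
  obtain ⟨α, h0, h1, h2⟩ := exists_trial_approx_polynomial hk (S := S) (by positivity)
    (fun i => Set.Ioo_subset_Icc_self (hkS i)) (by omega : 2 ≤ N) (R := R)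
    (by rw [hSR]; linarith) p (n := n + 2) (by omega) (by omega)
  refine ⟨α, by rw [h0, hp0], by rw [h1, hp, hq₁0], ?_⟩
  have hterm : ∀ m ∈ Finset.range (n + 2), |p.coeff m| *
      (4 * N ^ 2 * R ^ (N - 2) * S ^ (N - m) / ((N - m).factorial : ℝ)) ≤
      (|p.coeff m| * R ^ m) * (4 * N ^ 2 * (R ^ 2)⁻¹ * (Real.exp (9 / 11 * N) *
        (9 * 9 ^ n * (9 ^ N)⁻¹))) := by
    intro m hm
    have hm' : m ≤ n + 1 := by have := Finset.mem_range.1 hm; omega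
    obtain ⟨r, hr⟩ : ∃ r, N = m + r := ⟨N - m, by omega⟩
    have hr' : N - m = r := by omega
    rw [hr']
    have e1 : R ^ (N - 2) * S ^ r = (R ^ 2)⁻¹ * R ^ m * (N / 11) ^ r := by
      rw [← hSR, mul_pow]
      have : R ^ (N - 2) = (R ^ 2)⁻¹ * (R ^ m * R ^ r) := by
        rw [← pow_add, ← hr]
        rw [eq_inv_mul_iff_mul_eq₀ (by positivity), ← pow_add]
        congr 1; omega
      rw [this]; ring
    -- A factor `9 ^ r` is traded: `(9 N / 11) ^ r / r!` is at most `exp (9 N / 11)`, and the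
    -- remaining `9 ^ (-r)` is at most `9 ^ (n + 1) / 9 ^ N` since `m ≤ n + 1`.
    have e2 : ((N : ℝ) / 11) ^ r / r.factorial ≤ Real.exp (9 / 11 * N) *
        (9 * 9 ^ n * (9 ^ N)⁻¹) := by
      have h := Real.pow_div_factorial_le_exp (9 / 11 * (N : ℝ)) (by positivity) r
      have h9 : ((9 : ℝ) ^ r)⁻¹ ≤ 9 * 9 ^ n * (9 ^ N)⁻¹ := by
        rw [hr, pow_add]
        have : (9 : ℝ) ^ m ≤ 9 * 9 ^ n := by
          rw [← pow_succ']; exact pow_le_pow_right₀ (by norm_num) hm'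
        rw [mul_inv, ← mul_assoc]
        refine le_mul_of_one_le_left (by positivity) ?_
        rw [← div_eq_mul_inv, le_div_iff₀ (by positivity)]
        linarith
      calc ((N : ℝ) / 11) ^ r / r.factorial
          = (9 / 11 * (N : ℝ)) ^ r / r.factorial * ((9 : ℝ) ^ r)⁻¹ := by
            rw [show (9 / 11 * (N : ℝ)) = (N / 11) * 9 by ring, mul_pow]
            field_simp
        _ ≤ _ := mul_le_mul h h9 (by positivity) (by positivity)
    calc |p.coeff m| * (4 * N ^ 2 * R ^ (N - 2) * S ^ r / (r.factorial : ℝ))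
        = |p.coeff m| * (4 * N ^ 2 * (R ^ (N - 2) * S ^ r) / (r.factorial : ℝ)) := by ring
      _ = (|p.coeff m| * R ^ m) * (4 * N ^ 2 * (R ^ 2)⁻¹ * ((N / 11) ^ r / r.factorial)) := by
          rw [e1]; ring
      _ ≤ _ := by gcongr
  have hsup : ∀ x ∈ Set.Ioo (-R) R,
      |trial k (dcoef k (dcoef k α)) x - q.eval x| ≤
        (4050 * (R ^ 2)⁻¹ * K) * Real.exp (-(1 / 4) * N) * A := by
    intro x hx
    have h3 := h2 x (abs_le.2 (Set.Ioo_subset_Icc_self hx))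
    rw [hp, hq₁] at h3
    refine h3.trans ((Finset.sum_le_sum hterm).trans ?_)
    rw [← Finset.sum_mul]
    have h27 : (3 : ℝ) ^ n * 9 ^ n = 27 ^ n := by rw [← mul_pow]; norm_num
    calc _ ≤ (3 ^ (n + 1 + 1) * (K * A)) * (4 * N ^ 2 * (R ^ 2)⁻¹ * (Real.exp (9 / 11 * N) *
        (9 * 9 ^ n * (9 ^ N)⁻¹))) := by gcongr
      -- `324 = 4 * 9 * 9`; the factor `25 / 2` from the next bound then gives the `4050` of
      -- `repConst`.
      _ = 324 * (R ^ 2)⁻¹ * K * A * (N ^ 2 * (27 ^ n * Real.exp (9 / 11 * N) * (9 ^ N)⁻¹)) := by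
          rw [← h27]; ring
      _ ≤ 324 * (R ^ 2)⁻¹ * K * A * (25 / 2 * Real.exp (-(1 / 4) * N)) := by
          exact mul_le_mul_of_nonneg_left (sq_mul_pow_mul_exp_le hn5) (by positivity)
      _ = _ := by ring
  have hTm : MemLp (trial k (dcoef k (dcoef k α))) 2 (vol R) :=
    memLp_continuous (continuous_trial k _)
  have hl := l2norm_le_sqrt_mul hR (f := fun x => trial k (dcoef k (dcoef k α)) x - q.eval x)
    (hTm.sub hqm) (by positivity) hsup
  have htri := l2norm_sub_le_add hTm hqm hv
  have hYY : Y' ≤ Y := min_le_left _ _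
  have he : √(2 * R) * (4050 * (R ^ 2)⁻¹ * K * Real.exp (-(1 / 4) * N) * A) =
      repConst R * Real.exp (-(1 / 4) * N) * A := by rw [repConst, ← hK]; ring
  rw [he] at hl
  linarith

theorem BVP.ExpectedMinLossLE.mono {P : BVP R} {γ : ℝ} {N : ℕ} {S ε ε' : ℝ}
    (h : P.ExpectedMinLossLE γ N S ε) (hle : ε ≤ ε') : P.ExpectedMinLossLE γ N S ε' := by
  obtain ⟨m, h1, h2, h3⟩ := h
  exact ⟨m, h1, h2, h3.trans hle⟩

theorem BVP.expectedMinLossLE_of_bestApprox (hR : 0 < R) {P : BVP R} {Λ₁ Λ₂ Λ₃ G₁ G₂ γ : ℝ}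
    (hb : P.Bounded Λ₁ Λ₂ Λ₃ G₁ G₂) (hγ : 0 ≤ γ) {u : ℝ → ℝ} (hs : P.IsSolution u)
    {w : ℕ → ℝ → ℝ} (hw : IsRepresentative R 2 u w) {N : ℕ} (hN : 3 ≤ N) {Y : ℝ} (hY : 0 ≤ Y)
    (hE : bestApprox R (N / 5) (w 2) ≤ ENNReal.ofReal Y) :
    P.ExpectedMinLossLE γ N (N / (11 * R)) (lossConst R Λ₁ Λ₂ Λ₃ G₁ G₂ γ *
      (Y + repConst R * Real.exp (-(1 / 4) * N) * (|w 0 0| + |w 1 0| + l2norm R (w 2))) ^ 2) := by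
  have hNpos : (0 : ℝ) < N := by exact_mod_cast (by omega : 0 < N)
  refine P.expectedMinLossLE_of_forall hγ (by positivity) fun k hk hkS δ hδ => ?_
  -- The infimum in `bestApprox` need not be attained by the polynomial used, so a slack `t` is
  -- carried along and absorbed into `δ` by continuity at `0`.
  set F : ℝ → ℝ := fun t => lossConst R Λ₁ Λ₂ Λ₃ G₁ G₂ γ * (Y + t +
    repConst R * Real.exp (-(1 / 4) * N) * (|w 0 0| + |w 1 0| + l2norm R (w 2) + t)) ^ 2 with hF
  have hFc : Continuous F := by fun_prop
  have hev : ∀ᶠ t in nhdsWithin (0 : ℝ) (Set.Ioi 0), F t < F 0 + δ :=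
    (hFc.tendsto 0).mono_left nhdsWithin_le_nhds |>.eventually (gt_mem_nhds (by linarith))
  obtain ⟨t, ht, ht0⟩ := (hev.and self_mem_nhdsWithin).exists
  have ht0' : 0 < t := ht0
  obtain ⟨α, h0, h1, h2⟩ := exists_trial_l2norm_le hR (hw.memLp 2 le_rfl) (w 0 0) (w 1 0) hN hk
    hkS hY hE ht0'
  refine ⟨α, (BVP.loss_le hR hb hγ hs hw k α).trans (le_trans ?_ (ht.le.trans (le_of_eq ?_)))⟩
  · rw [h0, h1, sub_self, sub_self, abs_zero, add_zero, add_zero]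
    exact mul_le_mul_of_nonneg_left (pow_le_pow_left₀ (l2norm_nonneg _ _) h2 2)
      (lossConst_nonneg hR _ _ _ _ _ hγ)
  · simp only [hF, add_zero]

/-- The choice `α = 0`, which serves the finitely many small `N` that the rate estimates do not
reach. -/
theorem BVP.expectedMinLossLE_zero (hR : 0 < R) {P : BVP R} {Λ₁ Λ₂ Λ₃ G₁ G₂ γ : ℝ}
    (hb : P.Bounded Λ₁ Λ₂ Λ₃ G₁ G₂) (hγ : 0 ≤ γ) {u : ℝ → ℝ} (hs : P.IsSolution u)
    {w : ℕ → ℝ → ℝ} (hw : IsRepresentative R 2 u w) {N : ℕ} (hN : 0 < N) :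
    P.ExpectedMinLossLE γ N (N / (11 * R)) (lossConst R Λ₁ Λ₂ Λ₃ G₁ G₂ γ *
      (|w 0 0| + |w 1 0| + l2norm R (w 2)) ^ 2) := by
  have hNpos : (0 : ℝ) < N := by exact_mod_cast hN
  refine P.expectedMinLossLE_of_forall hγ (by positivity) fun k hk hkS δ hδ => ⟨0, ?_⟩
  have h0 : dcoef k 0 = 0 := by ext i <;> simp [dcoef]
  have h1 : ∀ x, trial k 0 x = 0 := fun x => by simp [trial]
  have := BVP.loss_le hR hb hγ hs hw k 0
  simp only [h0, h1, zero_sub, abs_neg] at this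
  have h2 : l2norm R (fun x => -w 2 x) = l2norm R (w 2) := by simp [l2norm]
  rw [h2] at this
  have e : l2norm R (w 2) + |w 1 0| + |w 0 0| = |w 0 0| + |w 1 0| + l2norm R (w 2) := by ring
  rw [e] at this
  linarith

/-- From a rate of polynomial approximation of `u''` to a rate of the expected minimal loss. -/
theorem BVP.expectedMinLossLE_of_rate (hR : 0 < R) {P : BVP R} {Λ₁ Λ₂ Λ₃ G₁ G₂ γ : ℝ}
    (hb : P.Bounded Λ₁ Λ₂ Λ₃ G₁ G₂) (hγ : 0 ≤ γ) {u : ℝ → ℝ} (hs : P.IsSolution u)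
    {w : ℕ → ℝ → ℝ} (hw : IsRepresentative R 2 u w) {r : ℕ → ℝ} (hr : ∀ N, 0 ≤ r N) {H C₁ C₂ C₃ : ℝ}
    (hC₁ : 0 ≤ C₁) (hC₂ : 0 ≤ C₂) (hC₃ : 0 ≤ C₃)
    (hH : |w 0 0| + |w 1 0| + l2norm R (w 2) ≤ H) {N₀ : ℕ} (hN₀ : 3 ≤ N₀)
    (h₁ : ∀ N, N₀ ≤ N → bestApprox R (N / 5) (w 2) ≤ ENNReal.ofReal (C₁ * H * r N))
    (h₂ : ∀ N : ℕ, N₀ ≤ N → Real.exp (-(1 / 4) * N) ≤ C₂ * r N)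
    (h₃ : ∀ N, 0 < N → N < N₀ → 1 ≤ C₃ * r N) {N : ℕ} (hN : 0 < N) :
    P.ExpectedMinLossLE γ N (N / (11 * R)) (lossConst R Λ₁ Λ₂ Λ₃ G₁ G₂ γ *
      (C₁ + repConst R * C₂ + C₃) ^ 2 * H ^ 2 * r N ^ 2) := by
  have hA0 : 0 ≤ |w 0 0| + |w 1 0| + l2norm R (w 2) := by
    have := l2norm_nonneg R (w 2); positivity
  have hH0 : 0 ≤ H := hA0.trans hH
  have hL := lossConst_nonneg hR Λ₁ Λ₂ Λ₃ G₁ G₂ hγ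
  have hRc := repConst_nonneg hR
  have hrN := hr N
  have e : lossConst R Λ₁ Λ₂ Λ₃ G₁ G₂ γ * (C₁ + repConst R * C₂ + C₃) ^ 2 * H ^ 2 * r N ^ 2 =
      lossConst R Λ₁ Λ₂ Λ₃ G₁ G₂ γ * ((C₁ + repConst R * C₂ + C₃) * (H * r N)) ^ 2 := by ring
  rcases lt_or_ge N N₀ with h | h
  · refine (expectedMinLossLE_zero hR hb hγ hs hw hN).mono ?_
    rw [e]
    refine mul_le_mul_of_nonneg_left (pow_le_pow_left₀ hA0 ?_ 2) hL
    have := h₃ N hN h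
    have h5 : H ≤ C₃ * r N * H := le_mul_of_one_le_left hH0 this
    have h6 : 0 ≤ (C₁ + repConst R * C₂) * (H * r N) := by positivity
    linarith
  · refine (expectedMinLossLE_of_bestApprox hR hb hγ hs hw (hN₀.trans h) (by positivity)
      (h₁ N h)).mono ?_
    rw [e]
    refine mul_le_mul_of_nonneg_left (pow_le_pow_left₀ (by positivity) ?_ 2) hL
    have h5 : repConst R * Real.exp (-(1 / 4) * N) * (|w 0 0| + |w 1 0| + l2norm R (w 2)) ≤
        repConst R * (C₂ * r N) * H := by
      have := h₂ N h
      gcongr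
    have h6 : 0 ≤ C₃ * (H * r N) := by positivity
    linarith

end

section

/-! ### Smooth solutions -/

variable {R : ℝ}

theorem MemHs.exists_isRepresentative (hR : 0 < R) {s : ℝ} {u : ℝ → ℝ} (h : MemHs R s u) :
    ∃ w, IsRepresentative R ⌊s⌋₊ u w := by
  obtain ⟨w, h1, h2, h3, h4⟩ := exists_representatives hR h.1
  exact ⟨w, h1, h2, h3, h4⟩

theorem MemHs.exists_isRepresentative_two (hR : 0 < R) {u : ℝ → ℝ} (h : MemHs R 2 u) :
    ∃ w, IsRepresentative R 2 u w := by
  simpa using h.exists_isRepresentative hR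

theorem bestApprox_congr_ae {d : ℕ} {f g : ℝ → ℝ} (h : f =ᵐ[vol R] g) :
    bestApprox R d f = bestApprox R d g := by
  unfold bestApprox
  refine iInf_congr fun p => eLpNorm_congr_ae ?_
  filter_upwards [h] with x hx
  simp only [hx]

/-- Lebesgue's differentiation theorem and uniqueness of derivatives. -/
theorem ae_eq_of_integral_eq (hR : 0 < R) {f g : ℝ → ℝ} (hf : MemLp f 2 (vol R))
    (h : ∀ x ∈ Set.Ioo (-R) R, HasDerivAt (fun y => ∫ t in (0 : ℝ)..y, f t) (g x) x) :
    f =ᵐ[vol R] g := by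
  have hi : IntervalIntegrable f volume (-R) R := intervalIntegrable_of_memLp hf
    (by constructor <;> linarith) (by constructor <;> linarith)
  rw [Filter.EventuallyEq, ae_restrict_iff' measurableSet_Ioo]
  filter_upwards [hi.ae_hasDerivAt_integral] with x hx hxI
  have hu : Set.uIcc (-R) R = Set.Icc (-R) R := Set.uIcc_of_le (by linarith)
  exact (hx (hu ▸ Set.Ioo_subset_Icc_self hxI) 0 (hu ▸ by constructor <;> linarith)).unique
    (h x hxI)

/-- By continuity `w 0 = v` holds at every point of the open interval, so `w 1` is the classical
derivative of `v` there; only the last differentiation is almost everywhere. -/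
theorem IsRepresentative.two_ae_eq (hR : 0 < R) {u v : ℝ → ℝ} {w : ℕ → ℝ → ℝ}
    (hw : IsRepresentative R 2 u w) (hv : ContDiffOn ℝ ∞ v (Set.Ioo (-R) R))
    (huv : Set.EqOn v u (Set.Ioo (-R) R)) : w 2 =ᵐ[vol R] iteratedDeriv 2 v := by
  have hc0 := (hw.continuousOn hR (j := 0) (by norm_num)).mono Set.Ioo_subset_Icc_self
  have hc1 := (hw.continuousOn hR (j := 1) (by norm_num)).mono Set.Ioo_subset_Icc_self
  have hae : w 0 =ᵐ[volume.restrict (Set.Ioo (-R) R)] v := by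
    filter_upwards [hw.zero_ae_eq, ae_restrict_mem measurableSet_Ioo] with x hx hxI
    rw [hx, huv hxI]
  have e0 := Measure.eqOn_open_of_ae_eq hae isOpen_Ioo hc0 hv.continuousOn
  have h0R : (0 : ℝ) ∈ Set.Icc (-R) R := by constructor <;> linarith
  have e1 : Set.EqOn (deriv v) (w 1) (Set.Ioo (-R) R) := by
    intro x hx
    have hd : HasDerivAt (fun y => w 0 0 + ∫ t in (0 : ℝ)..y, w 1 t) (w 1 x) x :=
      (intervalIntegral.integral_hasDerivAt_right
        (intervalIntegrable_of_memLp (hw.memLp 1 (by norm_num)) h0R (Set.Ioo_subset_Icc_self hx))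
        (hc1.stronglyMeasurableAtFilter isOpen_Ioo x hx)
        (hc1.continuousAt (isOpen_Ioo.mem_nhds hx))).const_add _
    refine (hd.congr_of_eventuallyEq ?_).deriv
    filter_upwards [isOpen_Ioo.mem_nhds hx] with y hy
    rw [← e0 hy, hw.eq 0 (by norm_num) y (Set.Ioo_subset_Icc_self hy)]
  have hd1 : ContDiffOn ℝ ∞ (deriv v) (Set.Ioo (-R) R) :=
    hv.deriv_of_isOpen isOpen_Ioo (by simp)
  have e : iteratedDeriv 2 v = deriv (deriv v) := by
    rw [iteratedDeriv_succ, iteratedDeriv_one]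
  rw [e]
  refine ae_eq_of_integral_eq hR (hw.memLp 2 le_rfl) fun x hx => ?_
  have hx' := isOpen_Ioo.mem_nhds hx
  have hd : HasDerivAt (deriv v) (deriv (deriv v) x) x :=
    ((hd1.differentiableOn (by simp)).differentiableAt hx').hasDerivAt
  refine (hd.sub_const (w 1 0)).congr_of_eventuallyEq ?_
  filter_upwards [hx'] with y hy
  rw [e1 hy, hw.eq 1 (by norm_num) y (Set.Ioo_subset_Icc_self hy)]
  ring

theorem contDiffOn_iteratedDeriv {U : Set ℝ} (hU : IsOpen U) {v : ℝ → ℝ}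
    (hv : ContDiffOn ℝ ∞ v U) (j : ℕ) : ContDiffOn ℝ ∞ (iteratedDeriv j v) U := by
  induction j with
  | zero => simpa using hv
  | succ j ih =>
    rw [iteratedDeriv_succ]
    exact ih.deriv_of_isOpen hU (by simp)

theorem memLp_iteratedDeriv {v : ℝ → ℝ} (hv : ContDiffOn ℝ ∞ v (Set.Ioo (-R) R)) {j : ℕ} {C : ℝ}
    (hC : ∀ x ∈ Set.Ioo (-R) R, |iteratedDeriv j v x| ≤ C) : MemLp (iteratedDeriv j v) 2 (vol R) := by
  refine MemLp.of_bound ((contDiffOn_iteratedDeriv isOpen_Ioo hv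
    j).continuousOn.aestronglyMeasurable measurableSet_Ioo) C ?_
  filter_upwards [ae_restrict_mem measurableSet_Ioo] with x hx using hC x hx

theorem isPrimitive_iteratedDeriv (hR : 0 < R) {v : ℝ → ℝ}
    (hv : ContDiffOn ℝ ∞ v (Set.Ioo (-R) R)) {j : ℕ} {C : ℝ}
    (hC : ∀ x ∈ Set.Ioo (-R) R, |iteratedDeriv (j + 1) v x| ≤ C) :
    IsPrimitive R (iteratedDeriv j v) (iteratedDeriv (j + 1) v) := by
  have hm := memLp_iteratedDeriv hv hC
  refine ⟨hm, fun x hx => ?_⟩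
  have h0 : (0 : ℝ) ∈ Set.Ioo (-R) R := by constructor <;> linarith
  have hsub : Set.uIcc 0 x ⊆ Set.Ioo (-R) R := Set.ordConnected_Ioo.uIcc_subset h0 hx
  rw [intervalIntegral.integral_eq_sub_of_hasDerivAt (f := iteratedDeriv j v)
    (f' := iteratedDeriv (j + 1) v) (fun t ht => ?_)
    (intervalIntegrable_of_memLp hm (Set.Ioo_subset_Icc_self h0) (Set.Ioo_subset_Icc_self hx))]
  · ring
  · rw [iteratedDeriv_succ]
    exact (((contDiffOn_iteratedDeriv isOpen_Ioo hv j).differentiableOn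
      (by simp)).differentiableAt (isOpen_Ioo.mem_nhds (hsub ht))).hasDerivAt

/-- The error of polynomial approximation of `v''` in terms of bounds of the derivatives of `v`. -/
theorem bestApprox_iteratedDeriv_two_le (hR : 0 < R) {v : ℝ → ℝ}
    (hv : ContDiffOn ℝ ∞ v (Set.Ioo (-R) R)) {B : ℕ → ℝ}
    (hB : ∀ j, ∀ x ∈ Set.Ioo (-R) R, |iteratedDeriv j v x| ≤ B j) {n k : ℕ} (hk : k ≤ n) :
    bestApprox R n (iteratedDeriv 2 v) ≤ ENNReal.ofReal
      (R ^ k * ((n - k).factorial / n.factorial) * (√(2 * R) * B (k + 2))) := by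
  obtain ⟨d, rfl⟩ := Nat.exists_eq_add_of_le' hk
  have h := bestApprox_le_of_tower hR (w := fun j => iteratedDeriv (j + 2) v) (k := k)
    (fun j _ => isPrimitive_iteratedDeriv hR hv (hB (j + 2 + 1))) d
  rw [Nat.add_sub_cancel, ENNReal.ofReal_mul (by positivity)]
  refine h.trans ?_
  gcongr
  exact (bestApprox_le_eLpNorm R d _).trans (l2norm_le_of_abs_le hR (hB (k + 2)))

/-- The constant may depend on `u` but not on the problem. The representatives are therefore chosen
from `u` alone, before any problem is given. -/
theorem exists_expectedMinLossLE_of_smooth (hR : 0 < R) (Λ₁ Λ₂ Λ₃ G₁ G₂ : ℝ) {γ : ℝ}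
    (hγ : 0 ≤ γ) {u v : ℝ → ℝ} (hv : ContDiffOn ℝ ∞ v (Set.Ioo (-R) R))
    (huv : Set.EqOn v u (Set.Ioo (-R) R)) {r : ℕ → ℝ} (hr : ∀ N, 0 < r N) {C₁ C₂ : ℝ}
    (hC₁ : 0 ≤ C₁) (hC₂ : 0 ≤ C₂) {N₀ : ℕ} (hN₀ : 3 ≤ N₀)
    (h₁ : ∀ N, N₀ ≤ N → bestApprox R (N / 5) (iteratedDeriv 2 v) ≤ ENNReal.ofReal (C₁ * r N))
    (h₂ : ∀ N : ℕ, N₀ ≤ N → Real.exp (-(1 / 4) * N) ≤ C₂ * r N) :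
    ∃ C : ℝ, ∀ P : BVP R, P.Bounded Λ₁ Λ₂ Λ₃ G₁ G₂ → P.IsSolution u →
      ∀ N : ℕ, 0 < N → P.ExpectedMinLossLE γ N (N / (11 * R)) (C * r N ^ 2) := by
  -- If `u` is not in `H²`, it solves no problem and any constant will do.
  by_cases hu : MemHs R 2 u
  swap
  · exact ⟨0, fun P _ hs => absurd hs.mem hu⟩
  obtain ⟨w, hw⟩ := hu.exists_isRepresentative_two hR
  have hl := l2norm_nonneg R (w 2)
  -- The summand `1` allows the hypothesis on `C₁ * r N` to be weakened to one on `C₁ * H * r N`.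
  set H := |w 0 0| + |w 1 0| + l2norm R (w 2) + 1 with hH
  have hH1 : 1 ≤ H := by
    rw [hH]; linarith [abs_nonneg (w 0 0), abs_nonneg (w 1 0)]
  refine ⟨_, fun P hb hs N hN => BVP.expectedMinLossLE_of_rate hR hb hγ hs hw
    (fun N => (hr N).le) hC₁ hC₂ (C₃ := ∑ N ∈ Finset.range N₀, (r N)⁻¹)
    (Finset.sum_nonneg fun N _ => (inv_pos.2 (hr N)).le) (H := H) (by rw [hH]; linarith) hN₀
    (fun N hN => ?_) h₂ (fun N _ hN => ?_) hN⟩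
  · rw [bestApprox_congr_ae (hw.two_ae_eq hR hv huv)]
    refine (h₁ N hN).trans (ENNReal.ofReal_le_ofReal ?_)
    have := (hr N).le
    exact mul_le_mul_of_nonneg_right (le_mul_of_one_le_right hC₁ hH1) this
  · have h : (r N)⁻¹ ≤ ∑ N ∈ Finset.range N₀, (r N)⁻¹ :=
      Finset.single_le_sum (fun N _ => (inv_pos.2 (hr N)).le) (Finset.mem_range.2 hN)
    calc (1 : ℝ) = (r N)⁻¹ * r N := (inv_mul_cancel₀ (hr N).ne').symm
      _ ≤ _ := mul_le_mul_of_nonneg_right h (hr N).le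

end

section

/-! ### Analytic solutions -/

variable {R : ℝ}

theorem iteratedDeriv_re_ofReal {F : ℂ → ℂ} {ρ : ℝ} (hρ : 0 < ρ)
    (hF : AnalyticOnNhd ℂ F {z : ℂ | |z.im| < ρ}) (k : ℕ) :
    iteratedDeriv k (fun x : ℝ => (F x).re) = fun x : ℝ => (iteratedDeriv k F x).re := by
  induction k with
  | zero => simp
  | succ k ih =>
    funext x
    rw [iteratedDeriv_succ, ih, iteratedDeriv_succ]
    have hx : (x : ℂ) ∈ {z : ℂ | |z.im| < ρ} := by simpa using hρ
    have hd : DifferentiableAt ℂ (iteratedDeriv k F) x := by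
      rw [iteratedDeriv_eq_iterate]; exact (hF.iterated_deriv k x hx).differentiableAt
    exact hd.hasDerivAt.real_of_complex.deriv

/-- Cauchy estimates on the real segment for a function analytic in a strip. -/
theorem exists_abs_iteratedDeriv_le {F : ℂ → ℂ} {ρ ρ' : ℝ} (hρ' : 0 < ρ') (hρ : ρ' < ρ)
    (hF : AnalyticOnNhd ℂ F {z : ℂ | |z.im| < ρ}) (R : ℝ) :
    ∃ M : ℝ, 0 ≤ M ∧ ∀ j : ℕ, ∀ x ∈ Set.Ioo (-R) R,
      |iteratedDeriv j (fun x : ℝ => (F x).re) x| ≤ j.factorial * M / ρ' ^ j := by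
  have hK : IsCompact (Set.Icc (-R - ρ') (R + ρ') ×ℂ Set.Icc (-ρ') ρ') :=
    isCompact_Icc.reProdIm isCompact_Icc
  have hsub : Set.Icc (-R - ρ') (R + ρ') ×ℂ Set.Icc (-ρ') ρ' ⊆ {z : ℂ | |z.im| < ρ} := by
    intro z hz
    exact (abs_le.2 (Complex.mem_reProdIm.1 hz).2).trans_lt hρ
  obtain ⟨M, hM⟩ := hK.exists_bound_of_continuousOn (hF.continuousOn.mono hsub)
  refine ⟨max M 0, le_max_right _ _, fun j x hx => ?_⟩
  rw [iteratedDeriv_re_ofReal (hρ'.trans hρ) hF]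
  refine (Complex.abs_re_le_norm _).trans ?_
  have hball : Metric.closedBall (x : ℂ) ρ' ⊆ Set.Icc (-R - ρ') (R + ρ') ×ℂ Set.Icc (-ρ') ρ' := by
    intro z hz
    rw [Metric.mem_closedBall, dist_eq_norm] at hz
    have h1 := abs_le.1 ((Complex.abs_re_le_norm _).trans hz)
    have h2 := abs_le.1 ((Complex.abs_im_le_norm _).trans hz)
    simp only [Complex.sub_re, Complex.sub_im, Complex.ofReal_re, Complex.ofReal_im,
      sub_zero] at h1 h2
    exact Complex.mem_reProdIm.2 ⟨⟨by linarith [hx.1], by linarith [hx.2]⟩, h2⟩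
  refine Complex.norm_iteratedDeriv_le_of_forall_mem_sphere_norm_le j hρ'
    (hF.differentiableOn.diffContOnCl_ball (hball.trans hsub)) fun z hz => ?_
  exact (hM z (hball (Metric.sphere_subset_closedBall hz))).trans (le_max_left _ _)

/-- The largest of the `n + 1` terms of the binomial expansion is at least their average. -/
theorem exists_one_add_pow_le {y : ℝ} (n : ℕ) :
    ∃ k ≤ n, (1 + y) ^ n ≤ (n + 1) * (n.choose k * y ^ k) := by
  have h : ∑ k ∈ Finset.range (n + 1), (1 + y) ^ n / (n + 1) ≤
      ∑ k ∈ Finset.range (n + 1), (n.choose k * y ^ k : ℝ) := by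
    rw [Finset.sum_const, Finset.card_range, nsmul_eq_mul, add_comm (1 : ℝ) y, add_pow]
    refine le_of_eq ?_
    push_cast
    rw [mul_div_cancel₀ _ (by positivity)]
    exact Finset.sum_congr rfl fun k _ => by rw [one_pow]; ring
  obtain ⟨k, hk, h⟩ := Finset.exists_le_of_sum_le ⟨0, by simp⟩ h
  refine ⟨k, by have := Finset.mem_range.1 hk; omega, ?_⟩
  rwa [div_le_iff₀' (by positivity)] at h

/-- Iterated Jackson with `k` derivatives gives essentially `(R / ρ') ^ k / n.choose k`, the
reciprocal of a term in the expansion of `(1 + ρ' / R) ^ n`. The best `k` is the index of a large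
term, at the cost of a cubic factor. -/
theorem bestApprox_le_of_factorial_bound (hR : 0 < R) {v : ℝ → ℝ}
    (hv : ContDiffOn ℝ ∞ v (Set.Ioo (-R) R)) {M ρ' : ℝ} (hM : 0 ≤ M) (hρ' : 0 < ρ')
    (hB : ∀ j : ℕ, ∀ x ∈ Set.Ioo (-R) R, |iteratedDeriv j v x| ≤ j.factorial * M / ρ' ^ j)
    (n : ℕ) : bestApprox R n (iteratedDeriv 2 v) ≤ ENNReal.ofReal
      (√(2 * R) * M / ρ' ^ 2 * ((n + 2) ^ 3 / (1 + ρ' / R) ^ n)) := by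
  obtain ⟨k, hk, h⟩ := exists_one_add_pow_le (y := ρ' / R) n
  refine (bestApprox_iteratedDeriv_two_le hR hv hB hk).trans (ENNReal.ofReal_le_ofReal ?_)
  have hf : ((k + 2).factorial : ℝ) ≤ (n + 2) ^ 2 * k.factorial := by
    have hkn : (k : ℝ) ≤ n := by exact_mod_cast hk
    rw [Nat.factorial_succ, Nat.factorial_succ]
    push_cast
    rw [← mul_assoc, sq]
    gcongr ?_ * ?_ * _ <;> linarith
  have hc : (n.choose k : ℝ) * (k.factorial * (n - k).factorial) = n.factorial := by
    rw [← mul_assoc]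
    exact_mod_cast Nat.choose_mul_factorial_mul_factorial hk
  have hcp : (0 : ℝ) < n.choose k := by exact_mod_cast Nat.choose_pos hk
  have hkp : (0 : ℝ) < k.factorial := by exact_mod_cast k.factorial_pos
  have hnkp : (0 : ℝ) < (n - k).factorial := by exact_mod_cast (n - k).factorial_pos
  have hP : 0 < (1 + ρ' / R) ^ n := by positivity
  have h' : (n.choose k * (ρ' / R) ^ k)⁻¹ ≤ (n + 1) / (1 + ρ' / R) ^ n := by
    rw [le_div_iff₀ hP, inv_mul_le_iff₀ (by positivity)]
    linarith
  calc R ^ k * ((n - k).factorial / n.factorial) *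
        (√(2 * R) * ((k + 2).factorial * M / ρ' ^ (k + 2)))
      ≤ R ^ k * ((n - k).factorial / n.factorial) *
        (√(2 * R) * ((n + 2) ^ 2 * k.factorial * M / ρ' ^ (k + 2))) := by gcongr
    _ = √(2 * R) * M / ρ' ^ 2 * (n + 2) ^ 2 * (n.choose k * (ρ' / R) ^ k)⁻¹ := by
      rw [← hc, div_pow, pow_add]
      field_simp
    _ ≤ √(2 * R) * M / ρ' ^ 2 * (n + 2) ^ 2 * ((n + 1) / (1 + ρ' / R) ^ n) := by gcongr
    _ ≤ √(2 * R) * M / ρ' ^ 2 * (n + 2) ^ 2 * ((n + 2) / (1 + ρ' / R) ^ n) := by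
      gcongr; norm_num
    _ = _ := by ring

/-- By convexity `exp` lies below its chord over `[0, 3 / 2]`, where `exp (3 / 2) ≤ 5`. -/
theorem exp_three_mul_le {κ : ℝ} (h0 : 0 ≤ κ) (h1 : κ ≤ 1 / 2) :
    Real.exp (3 * κ) ≤ 1 + 99 / 10 * κ := by
  have he : Real.exp (3 / 2) ≤ 5 := by
    have h : Real.exp (3 / 2) ^ 2 ≤ 5 ^ 2 := by
      rw [← Real.exp_nat_mul, show ((2 : ℕ) : ℝ) * (3 / 2) = ((3 : ℕ) : ℝ) * 1 by norm_num,
        Real.exp_nat_mul]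
      calc Real.exp 1 ^ 3 ≤ 2.7182818286 ^ 3 :=
            pow_le_pow_left₀ (Real.exp_pos _).le Real.exp_one_lt_d9.le 3
        _ ≤ 5 ^ 2 := by norm_num
    exact le_of_sq_le_sq h (by norm_num)
  have h := convexOn_exp.2 (Set.mem_univ 0) (Set.mem_univ (3 / 2)) (by linarith : 0 ≤ 1 - 2 * κ)
    (by linarith : 0 ≤ 2 * κ) (by ring)
  simp only [smul_eq_mul, mul_zero, zero_add, Real.exp_zero, mul_one] at h
  rw [show 2 * κ * (3 / 2) = 3 * κ by ring] at h
  have := mul_le_mul_of_nonneg_left he (by linarith : 0 ≤ 2 * κ)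
  linarith

/-- The geometric decay is `exp (-3 κ n)` with `n` about `N / 5`, that is, rate `3 κ / 5`. Only `κ /
2` is needed, and the spare `κ / 10` absorbs the cubic factor. -/
theorem pow_three_div_le {κ : ℝ} (h0 : 0 < κ) (h1 : κ ≤ 1 / 2) (N : ℕ) :
    ((N / 5 : ℕ) + 2 : ℝ) ^ 3 / (1 + 99 / 10 * κ) ^ (N / 5) ≤
      6 / (κ / 10) ^ 3 * Real.exp (26 / 10 * κ) * Real.exp (-(κ / 2) * N) := by
  set n := N / 5 with hn
  have hn1 : (N : ℝ) ≤ 5 * n + 4 := by exact_mod_cast (by omega : N ≤ 5 * n + 4)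
  have hn2 : (n : ℝ) ≤ N := by exact_mod_cast (by omega : n ≤ N)
  have e1 : Real.exp (3 / 5 * κ * (N - 4)) ≤ (1 + 99 / 10 * κ) ^ n := by
    calc _ ≤ Real.exp (n * (3 * κ)) := Real.exp_le_exp.2 (by
          linarith [mul_le_mul_of_nonneg_left hn1 h0.le])
      _ = Real.exp (3 * κ) ^ n := Real.exp_nat_mul _ _
      _ ≤ _ := pow_le_pow_left₀ (Real.exp_pos _).le (exp_three_mul_le h0.le h1) n
  have e2 : ((n : ℝ) + 2) ^ 3 ≤ 6 / (κ / 10) ^ 3 * Real.exp (κ / 10 * (N + 2)) := by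
    have h := Real.pow_div_factorial_le_exp (κ / 10 * (N + 2 : ℝ)) (by positivity) 3
    have h6 : ((Nat.factorial 3 : ℕ) : ℝ) = 6 := by norm_num [Nat.factorial]
    rw [h6, mul_pow] at h
    calc ((n : ℝ) + 2) ^ 3 ≤ ((N : ℝ) + 2) ^ 3 := by gcongr
      _ = 6 / (κ / 10) ^ 3 * ((κ / 10) ^ 3 * (N + 2) ^ 3 / 6) := by field_simp
      _ ≤ _ := by gcongr
  calc ((n : ℝ) + 2) ^ 3 / (1 + 99 / 10 * κ) ^ n
      ≤ 6 / (κ / 10) ^ 3 * Real.exp (κ / 10 * (N + 2)) / Real.exp (3 / 5 * κ * (N - 4)) := by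
        gcongr
    _ = 6 / (κ / 10) ^ 3 * (Real.exp (κ / 10 * (N + 2)) / Real.exp (3 / 5 * κ * (N - 4))) := by
        ring
    _ = 6 / (κ / 10) ^ 3 * (Real.exp (26 / 10 * κ) * Real.exp (-(κ / 2) * N)) := by
        rw [← Real.exp_sub, ← Real.exp_add]
        ring_nf
    _ = _ := by ring

theorem exists_expectedMinLossLE_of_analytic (hR : 0 < R) {ρ : ℝ} (hρ : 0 < ρ)
    (Λ₁ Λ₂ Λ₃ G₁ G₂ : ℝ) {γ : ℝ} (hγ : 0 ≤ γ) {u : ℝ → ℝ} {F : ℂ → ℂ}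
    (hF : AnalyticOnNhd ℂ F {z : ℂ | |z.im| < ρ})
    (hFu : ∀ x ∈ Set.Ioo (-R) R, F (x : ℂ) = (u x : ℂ)) :
    ∃ C : ℝ, ∀ P : BVP R, P.Bounded Λ₁ Λ₂ Λ₃ G₁ G₂ → P.IsSolution u →
      ∀ N : ℕ, 0 < N → P.ExpectedMinLossLE γ N (N / (11 * R))
        (C * Real.exp (-(min (1 / 2) (ρ / (11 * R))) * N)) := by
  set κ := min (1 / 2) (ρ / (11 * R)) with hκ
  have hκ0 : 0 < κ := by positivity
  have hκ1 : κ ≤ 1 / 2 := min_le_left _ _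
  have hκ2 : 11 * R * κ ≤ ρ := by
    have : κ ≤ ρ / (11 * R) := min_le_right _ _
    rwa [le_div_iff₀' (by positivity)] at this
  -- `99 / 10 < 11` puts `ρ'` strictly inside the strip, as Cauchy's estimates on closed discs
  -- require, and `1 + ρ' / R` still dominates `exp (3 κ)`.
  set ρ' := 99 / 10 * κ * R with hρ'
  have hρ'0 : 0 < ρ' := by positivity
  have hρ'1 : ρ' < ρ := by
    have : 0 < κ * R := by positivity
    rw [hρ']; linarith
  have hy : ρ' / R = 99 / 10 * κ := by rw [hρ']; field_simp
  obtain ⟨M, hM, hB⟩ := exists_abs_iteratedDeriv_le hρ'0 hρ'1 hF R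
  set v : ℝ → ℝ := fun x => (F x).re with hv
  have hvs : ContDiffOn ℝ ∞ v (Set.Ioo (-R) R) := fun x _ =>
    ((hF x (by simpa using hρ)).contDiffAt.real_of_complex).contDiffWithinAt
  have hvu : Set.EqOn v u (Set.Ioo (-R) R) := fun x hx => by simp [hv, hFu x hx]
  obtain ⟨C, hC⟩ := exists_expectedMinLossLE_of_smooth hR Λ₁ Λ₂ Λ₃ G₁ G₂ hγ hvs hvu
    (r := fun N => Real.exp (-(κ / 2) * N)) (fun N => Real.exp_pos _)
    (C₁ := √(2 * R) * M / ρ' ^ 2 * (6 / (κ / 10) ^ 3 * Real.exp (26 / 10 * κ))) (C₂ := 1)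
    (by positivity) zero_le_one (N₀ := 3) le_rfl (fun N _ => by
      refine (bestApprox_le_of_factorial_bound hR hvs hM hρ'0 hB _).trans
        (ENNReal.ofReal_le_ofReal ?_)
      rw [hy, mul_assoc]
      exact mul_le_mul_of_nonneg_left (pow_three_div_le hκ0 hκ1 N) (by positivity))
    (fun N _ => by
      rw [one_mul, Real.exp_le_exp]
      have : (0 : ℝ) ≤ N := Nat.cast_nonneg N
      have := mul_le_mul_of_nonneg_right hκ1 this
      linarith)
  refine ⟨C, fun P hb hs N hN => ?_⟩
  have := hC P hb hs N hN
  rwa [← Real.exp_nat_mul, show ((2 : ℕ) : ℝ) * (-(κ / 2) * N) = -κ * N by push_cast; ring] at this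

/-! ### Gevrey solutions -/

/-- Each of the `k` derivatives contributes at most `R D k ^ s / (n + 1 - k)`: use `(n - k)! / n! ≤
(n + 1 - k) ^ (-k)` and `k! ≤ k ^ k`. The two derivatives already spent on `v''` account for `(k +
2) ^ (2 s)`. -/
theorem bestApprox_le_of_gevreyBound (hR : 0 < R) {v : ℝ → ℝ}
    (hv : ContDiffOn ℝ ∞ v (Set.Ioo (-R) R)) {M D s : ℝ} (hM : 0 ≤ M) (hD : 0 < D) (hs : 0 ≤ s)
    (hB : ∀ j : ℕ, ∀ x ∈ Set.Ioo (-R) R,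
      |iteratedDeriv j v x| ≤ M * D ^ j * (Nat.factorial j : ℝ) ^ s)
    {n k : ℕ} (hk : k ≤ n) {q : ℝ} (hq : R * D * (k : ℝ) ^ s ≤ q * (n + 1 - k : ℕ)) :
    bestApprox R n (iteratedDeriv 2 v) ≤ ENNReal.ofReal
      (√(2 * R) * M * D ^ 2 * (((k : ℝ) + 2) ^ (2 * s) * q ^ k)) := by
  refine (bestApprox_iteratedDeriv_two_le hR hv hB hk).trans (ENNReal.ofReal_le_ofReal ?_)
  have hpos : (0 : ℝ) < (n + 1 - k : ℕ) := by exact_mod_cast (by omega : 0 < n + 1 - k)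
  have h1 : ((n - k).factorial : ℝ) / n.factorial ≤ ((n + 1 - k : ℕ) ^ k : ℝ)⁻¹ := by
    have hd : ((n + 1 - k : ℕ) ^ k : ℝ) ≤ n.descFactorial k := by
      exact_mod_cast Nat.pow_sub_le_descFactorial n k
    have hf : ((n - k).factorial : ℝ) * n.descFactorial k = n.factorial := by
      exact_mod_cast Nat.factorial_mul_descFactorial hk
    have hnk : (0 : ℝ) < (n - k).factorial := by exact_mod_cast (n - k).factorial_pos
    rw [← hf, div_mul_eq_div_div, div_self hnk.ne', one_div]
    gcongr
  have h2 : ((k + 2).factorial : ℝ) ^ s ≤ ((k : ℝ) + 2) ^ (2 * s) * ((k : ℝ) ^ s) ^ k := by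
    have hf : ((k + 2).factorial : ℝ) ≤ ((k : ℝ) + 2) ^ 2 * (k : ℝ) ^ k := by
      rw [Nat.factorial_succ, Nat.factorial_succ]
      have h : ((k.factorial : ℕ) : ℝ) ≤ (k : ℝ) ^ k := by exact_mod_cast k.factorial_le_pow
      push_cast
      rw [← mul_assoc, sq]
      gcongr ?_ * ?_ * ?_ <;> linarith
    calc ((k + 2).factorial : ℝ) ^ s ≤ (((k : ℝ) + 2) ^ 2 * (k : ℝ) ^ k) ^ s :=
          Real.rpow_le_rpow (by positivity) hf hs
      _ = _ := by
          rw [Real.mul_rpow (by positivity) (by positivity), ← Real.rpow_natCast (_ + 2),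
            ← Real.rpow_mul (by positivity), ← Real.rpow_natCast (k : ℝ),
            ← Real.rpow_mul (by positivity), ← Real.rpow_natCast ((k : ℝ) ^ s),
            ← Real.rpow_mul (by positivity)]
          norm_num [mul_comm]
  have h3 : (R * D * (k : ℝ) ^ s / (n + 1 - k : ℕ)) ^ k ≤ q ^ k :=
    pow_le_pow_left₀ (by positivity) ((div_le_iff₀ hpos).2 hq) k
  calc R ^ k * ((n - k).factorial / n.factorial) *
        (√(2 * R) * (M * D ^ (k + 2) * ((k + 2).factorial : ℝ) ^ s))
      ≤ R ^ k * ((n + 1 - k : ℕ) ^ k : ℝ)⁻¹ * (√(2 * R) * (M * D ^ (k + 2) *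
        (((k : ℝ) + 2) ^ (2 * s) * ((k : ℝ) ^ s) ^ k))) := by gcongr
    _ = √(2 * R) * M * D ^ 2 * (((k : ℝ) + 2) ^ (2 * s) *
        (R * D * (k : ℝ) ^ s / (n + 1 - k : ℕ)) ^ k) := by
      rw [div_pow, mul_pow, mul_pow]; ring
    _ ≤ _ := by gcongr

theorem eventually_mul_rpow_le {s : ℝ} (hs : 1 < s) (c : ℝ) {d : ℝ} (hd : 0 < d) :
    ∀ᶠ N : ℕ in Filter.atTop, c * (N : ℝ) ^ (1 / s) ≤ d * N := by
  have hs' : 0 < 1 - 1 / s := by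
    have : 1 / s < 1 := (div_lt_one (by linarith)).2 hs
    linarith
  have ht := (tendsto_rpow_atTop hs').comp (tendsto_natCast_atTop_atTop (R := ℝ))
  filter_upwards [ht.eventually_ge_atTop (c / d), Filter.eventually_gt_atTop 0] with N hN h0
  have hN0 : (0 : ℝ) < N := by exact_mod_cast h0
  have h1 : (N : ℝ) = (N : ℝ) ^ (1 - 1 / s) * (N : ℝ) ^ (1 / s) := by
    rw [← Real.rpow_add hN0, sub_add_cancel, Real.rpow_one]
  simp only [Function.comp] at hN
  rw [div_le_iff₀' hd] at hN
  calc c * (N : ℝ) ^ (1 / s) ≤ d * (N : ℝ) ^ (1 - 1 / s) * (N : ℝ) ^ (1 / s) := by gcongr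
    _ = d * N := by rw [mul_assoc, ← h1]

/-- The right side is `(N / (44 R D)) ^ (1 / s)` with `44 = 4 * 11`, so the claim reduces to `4 ^ (1
/ s) ≤ 4 s`. -/
theorem gevrey_rate_le {s : ℝ} (hs : 1 < s) {D : ℝ} (hD : 0 < D) (hR : 0 < R) (N : ℕ) :
    D ^ (-(1 / s)) * (11 * R) ^ (-(1 / s)) / (2 * s) / 2 * (N : ℝ) ^ (1 / s) ≤
      (10 / 11) ^ (1 / s) * ((N : ℝ) / (40 * R * D)) ^ (1 / s) := by
  have hN : (0 : ℝ) ≤ N := Nat.cast_nonneg N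
  have h4 : (4 : ℝ) ^ (1 / s) ≤ 4 * s := by
    have : (4 : ℝ) ^ (1 / s) ≤ 4 ^ (1 : ℝ) :=
      Real.rpow_le_rpow_of_exponent_le (by norm_num) ((div_le_one (by linarith)).2 hs.le)
    rw [Real.rpow_one] at this
    linarith
  have e1 : D ^ (-(1 / s)) * (11 * R) ^ (-(1 / s)) = ((D * (11 * R)) ^ (1 / s))⁻¹ := by
    rw [← Real.mul_rpow hD.le (by positivity), Real.rpow_neg (by positivity)]
  have e2 : (10 / 11 : ℝ) ^ (1 / s) * ((N : ℝ) / (40 * R * D)) ^ (1 / s) =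
      ((D * (11 * R)) ^ (1 / s))⁻¹ / 4 ^ (1 / s) * (N : ℝ) ^ (1 / s) := by
    rw [← Real.mul_rpow (by norm_num) (by positivity), ← Real.inv_rpow (by positivity),
      ← Real.div_rpow (by positivity) (by norm_num), ← Real.mul_rpow (by positivity) hN]
    congr 1
    field_simp
    ring
  rw [e1, e2, div_div]
  gcongr
  linarith

/-- With `k` the integer part of `(N / (40 R D)) ^ (1 / s)`, each derivative gains a factor at most
`exp (-1)`. Half of `κ` is needed here, because the loss squares the rate. -/
theorem exists_expectedMinLossLE_of_gevrey (hR : 0 < R) {s : ℝ} (hs : 1 < s)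
    (Λ₁ Λ₂ Λ₃ G₁ G₂ : ℝ) {γ : ℝ} (hγ : 0 ≤ γ) {u v : ℝ → ℝ}
    (hv : ContDiffOn ℝ ∞ v (Set.Ioo (-R) R)) (hvu : Set.EqOn v u (Set.Ioo (-R) R)) {D : ℝ}
    (hD : 0 < D) (hB : GevreyBound s (Set.Ioo (-R) R) D v) :
    ∃ C : ℝ, ∀ P : BVP R, P.Bounded Λ₁ Λ₂ Λ₃ G₁ G₂ → P.IsSolution u →
      ∀ N : ℕ, 0 < N → P.ExpectedMinLossLE γ N (N / (11 * R))
        (C * Real.exp (-(D ^ (-(1 / s)) * (11 * R) ^ (-(1 / s)) / (2 * s)) *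
          (N : ℝ) ^ (1 / s))) := by
  obtain ⟨M, hM, hB⟩ := hB
  set κ := D ^ (-(1 / s)) * (11 * R) ^ (-(1 / s)) / (2 * s) with hκ
  have hs0 : 0 < s := by linarith
  -- The gap between `40` and `44`: the fraction `1 - θ` of the exponent is spent on the factor `(k
  -- + 2) ^ (2 s)`.
  set θ := (10 / 11 : ℝ) ^ (1 / s) with hθ
  have hθ0 : 0 < θ := by positivity
  have hθ1 : θ < 1 := Real.rpow_lt_one (by norm_num) (by norm_num) (by positivity)
  set x : ℕ → ℝ := fun N => ((N : ℝ) / (40 * R * D)) ^ (1 / s) with hx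
  have hx0 : ∀ N, 0 ≤ x N := fun N => by positivity
  have hxs : ∀ N, x N ^ s = N / (40 * R * D) := fun N => by
    rw [hx, ← Real.rpow_mul (by positivity), one_div_mul_cancel hs0.ne', Real.rpow_one]
  have hxc : ∀ N : ℕ, x N = (1 / (40 * R * D)) ^ (1 / s) * (N : ℝ) ^ (1 / s) := fun N => by
    rw [hx, ← Real.mul_rpow (by positivity) (by positivity), one_div_mul_eq_div]
  have hxt : Filter.Tendsto (fun N => x N + 2) Filter.atTop Filter.atTop := by
    refine Filter.tendsto_atTop_add_const_right _ _ ?_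
    rw [show x = _ from funext hxc]
    exact (((tendsto_rpow_atTop (by positivity : 0 < 1 / s)).comp
      tendsto_natCast_atTop_atTop).const_mul_atTop (by positivity))
  have ev1 : ∀ᶠ N : ℕ in Filter.atTop, x N ≤ 1 / 10 * N := by
    simp_rw [hxc]; exact eventually_mul_rpow_le hs _ (by norm_num)
  have ev2 : ∀ᶠ N : ℕ in Filter.atTop, κ / 2 * (N : ℝ) ^ (1 / s) ≤ 1 / 4 * N :=
    eventually_mul_rpow_le hs _ (by norm_num)
  have ev3 : ∀ᶠ N : ℕ in Filter.atTop,
      (x N + 2) ^ (2 * s) ≤ Real.exp ((1 - θ) * (x N + 2)) := by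
    have h := (isLittleO_rpow_exp_pos_mul_atTop (2 * s) (by linarith : 0 < 1 - θ)).bound
      one_pos
    filter_upwards [hxt.eventually h] with N hN
    have hx2 : 0 ≤ x N + 2 := by linarith [hx0 N]
    rw [one_mul, Real.norm_of_nonneg (Real.rpow_nonneg hx2 _),
      Real.norm_of_nonneg (Real.exp_pos _).le] at hN
    exact hN
  obtain ⟨N₀, hN₀⟩ := Filter.eventually_atTop.1 (ev1.and (ev2.and ev3))
  -- From `N = 8` on, `N / 10 ≤ (N - 4) / 5`, which guarantees `k ≤ N / 5` despite the rounding.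
  have hrate₁ : ∀ N, max N₀ 8 ≤ N → bestApprox R (N / 5) (iteratedDeriv 2 v) ≤ ENNReal.ofReal
      (√(2 * R) * M * D ^ 2 * Real.exp 3 * Real.exp (-(κ / 2 * (N : ℝ) ^ (1 / s)))) := by
    intro N hN
    obtain ⟨h1, -, h3⟩ := hN₀ N ((le_max_left _ _).trans hN)
    have hN8 : (8 : ℝ) ≤ N := by exact_mod_cast (le_max_right _ _).trans hN
    set n := N / 5 with hn
    have hn1 : (N : ℝ) ≤ 5 * n + 4 := by exact_mod_cast (by omega : N ≤ 5 * n + 4)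
    set k := ⌊x N⌋₊ with hk
    have hkx : (k : ℝ) ≤ x N := Nat.floor_le (hx0 N)
    have hkx' : x N < k + 1 := Nat.lt_floor_add_one _
    have hkn : k ≤ n := by
      have : (k : ℝ) ≤ n := by linarith
      exact_mod_cast this
    -- The left side is at most `N / 40` and `n + 1 - k` is at least `N / 10`; the ratio `1 / 4` is
    -- below `exp (-1)`.
    have hq : R * D * (k : ℝ) ^ s ≤ Real.exp (-1) * (n + 1 - k : ℕ) := by
      have hks : (k : ℝ) ^ s ≤ N / (40 * R * D) := by
        rw [← hxs]; exact Real.rpow_le_rpow (Nat.cast_nonneg _) hkx hs0.le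
      have he : (1 : ℝ) / 4 ≤ Real.exp (-1) := by
        rw [Real.exp_neg, ← one_div]
        exact one_div_le_one_div_of_le (Real.exp_pos _) (by linarith [Real.exp_one_lt_d9])
      have hc : (N : ℝ) / 10 ≤ (n + 1 - k : ℕ) := by
        rw [Nat.cast_sub (by omega)]; push_cast; linarith
      calc R * D * (k : ℝ) ^ s ≤ R * D * (N / (40 * R * D)) := by gcongr
        _ = 1 / 4 * (N / 10) := by field_simp; norm_num
        _ ≤ _ := by gcongr
    refine (bestApprox_le_of_gevreyBound hR hv hM.le hD hs0.le hB hkn hq).trans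
      (ENNReal.ofReal_le_ofReal ?_)
    rw [mul_assoc (√(2 * R) * M * D ^ 2)]
    refine mul_le_mul_of_nonneg_left ?_ (by positivity)
    have hrate := gevrey_rate_le hs hD hR N
    calc ((k : ℝ) + 2) ^ (2 * s) * Real.exp (-1) ^ k
        ≤ (x N + 2) ^ (2 * s) * Real.exp (-1) ^ k := by gcongr
      _ ≤ Real.exp ((1 - θ) * (x N + 2)) * Real.exp (-1) ^ k := by gcongr
      _ = Real.exp ((1 - θ) * (x N + 2) - k) := by
          rw [← Real.exp_nat_mul, ← Real.exp_add]; ring_nf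
      _ ≤ Real.exp (3 + -(κ / 2 * (N : ℝ) ^ (1 / s))) := by
          rw [Real.exp_le_exp]
          linarith
      _ = _ := Real.exp_add _ _
  have hrate₂ : ∀ N : ℕ, max N₀ 8 ≤ N →
      Real.exp (-(1 / 4) * N) ≤ 1 * Real.exp (-(κ / 2 * (N : ℝ) ^ (1 / s))) := by
    intro N hN
    obtain ⟨-, h2, -⟩ := hN₀ N ((le_max_left _ _).trans hN)
    rw [one_mul, Real.exp_le_exp]
    linarith
  obtain ⟨C, hC⟩ := exists_expectedMinLossLE_of_smooth hR Λ₁ Λ₂ Λ₃ G₁ G₂ hγ hv hvu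
    (r := fun N => Real.exp (-(κ / 2 * (N : ℝ) ^ (1 / s)))) (fun N => Real.exp_pos _)
    (by positivity) zero_le_one (by omega) hrate₁ hrate₂
  refine ⟨C, fun P hb hs N hN => ?_⟩
  have := hC P hb hs N hN
  rwa [← Real.exp_nat_mul, show ((2 : ℕ) : ℝ) * (-(κ / 2 * (N : ℝ) ^ (1 / s))) =
    -κ * (N : ℝ) ^ (1 / s) by push_cast; ring] at this

end

section

/-! ### Approximation of functions with finite Gagliardo seminorm -/

variable {R : ℝ}

/-- The Steklov mean of `f` over `(y, y + h)`. -/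
def steklov (h : ℝ) (f : ℝ → ℝ) (y : ℝ) : ℝ := h⁻¹ * ∫ t in y..y + h, f t

theorem steklov_eq_sub {f : ℝ → ℝ} (hf : ∀ a b, IntervalIntegrable f volume a b) (h : ℝ) :
    steklov h f = fun y => h⁻¹ * ((∫ t in (0 : ℝ)..y + h, f t) - ∫ t in (0 : ℝ)..y, f t) := by
  funext y
  rw [steklov, intervalIntegral.integral_interval_sub_left (hf _ _) (hf _ _)]

theorem continuous_steklov {f : ℝ → ℝ} (hf : ∀ a b, IntervalIntegrable f volume a b) (h : ℝ) :
    Continuous (steklov h f) := by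
  rw [steklov_eq_sub hf]
  have hc := intervalIntegral.continuous_primitive hf 0
  exact continuous_const.mul ((hc.comp (continuous_id.add continuous_const)).sub hc)

theorem hasDerivAt_steklov {f : ℝ → ℝ} (hf : Continuous f) (h y : ℝ) :
    HasDerivAt (steklov h f) (h⁻¹ * (f (y + h) - f y)) y := by
  rw [steklov_eq_sub fun a b => hf.intervalIntegrable a b]
  have h1 := (hf.integral_hasStrictDerivAt 0 (y + h)).hasDerivAt.comp_add_const y h
  exact (h1.sub (hf.integral_hasStrictDerivAt 0 y).hasDerivAt).const_mul _

theorem steklov_sub_const {f : ℝ → ℝ} {h y : ℝ} (hf : IntervalIntegrable f volume y (y + h))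
    (hh : h ≠ 0) (c : ℝ) : steklov h f y - c = h⁻¹ * ∫ t in y..y + h, (f t - c) := by
  rw [intervalIntegral.integral_sub hf intervalIntegrable_const, steklov,
    intervalIntegral.integral_const, add_sub_cancel_left, smul_eq_mul]
  field_simp

theorem abs_steklov_sub_le {f : ℝ → ℝ} (hf : Continuous f) {h y c K : ℝ} (hh : 0 < h)
    (hK : ∀ t ∈ Set.Icc y (y + h), |f t - c| ≤ K) : |steklov h f y - c| ≤ K := by
  rw [steklov_sub_const (hf.intervalIntegrable _ _) hh.ne', abs_mul, abs_of_pos (inv_pos.2 hh)]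
  have h1 := intervalIntegral.norm_integral_le_of_norm_le_const (f := fun t => f t - c) (a := y)
    (b := y + h) (C := K) fun t ht => by
      rw [Set.uIoc_of_le (by linarith)] at ht
      exact hK t (Set.Ioc_subset_Icc_self ht)
  rw [add_sub_cancel_left, abs_of_pos hh, Real.norm_eq_abs] at h1
  rwa [inv_mul_le_iff₀ hh, mul_comm]

theorem ofReal_sq_eq_enorm_sq (r : ℝ) : ENNReal.ofReal (r ^ 2) = ‖r‖ₑ ^ 2 := by
  rw [Real.enorm_eq_ofReal_abs, ← ENNReal.ofReal_pow (abs_nonneg r), sq_abs]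

theorem eLpNorm_two_sq (μ : Measure ℝ) (f : ℝ → ℝ) :
    eLpNorm f 2 μ ^ 2 = ∫⁻ x, ENNReal.ofReal (f x ^ 2) ∂μ := by
  have h := eLpNorm_nnreal_pow_eq_lintegral (μ := μ) (f := f) (p := 2) two_ne_zero
  simp only [NNReal.coe_ofNat, ENNReal.coe_ofNat, ENNReal.rpow_two] at h
  simp_rw [ofReal_sq_eq_enorm_sq, h]

/-- Cauchy–Schwarz: the square of a mean is at most the mean of the squares. -/
theorem ofReal_sq_steklov_sub_le {f : ℝ → ℝ} (hf : ∀ a b, IntervalIntegrable f volume a b)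
    {h : ℝ} (hh : 0 < h) (y c : ℝ) :
    ENNReal.ofReal ((steklov h f y - c) ^ 2) ≤
      ENNReal.ofReal h⁻¹ * ∫⁻ t in Set.Ioo y (y + h), ENNReal.ofReal ((f t - c) ^ 2) := by
  set μ := volume.restrict (Set.Ioo y (y + h)) with hμ
  have hfm : AEStronglyMeasurable (fun t => f t - c) μ := by
    have h1 : IntegrableOn f (Set.Ioc y (y + h)) volume := (hf y (y + h)).1
    exact ((h1.mono_set Set.Ioo_subset_Ioc_self).aestronglyMeasurable).sub
      aestronglyMeasurable_const
  have hμu : μ Set.univ = ENNReal.ofReal h := by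
    rw [hμ, Measure.restrict_apply_univ, Real.volume_Ioo, add_sub_cancel_left]
  have h1 : ‖∫ t, (f t - c) ∂μ‖ₑ ≤ eLpNorm (fun t => f t - c) 2 μ * ENNReal.ofReal h ^ (1 / 2 : ℝ) := by
    refine (enorm_integral_le_lintegral_enorm _).trans ?_
    rw [← eLpNorm_one_eq_lintegral_enorm, ← hμu]
    refine (eLpNorm_le_eLpNorm_mul_rpow_measure_univ (q := 2) (by norm_num) hfm).trans
      (le_of_eq ?_)
    norm_num
  have h2 : (ENNReal.ofReal h ^ (1 / 2 : ℝ)) ^ 2 = ENNReal.ofReal h := by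
    rw [← ENNReal.rpow_natCast, ← ENNReal.rpow_mul]; norm_num
  rw [steklov_sub_const (hf _ _) hh.ne', intervalIntegral.integral_of_le (by linarith),
    integral_Ioc_eq_integral_Ioo, ofReal_sq_eq_enorm_sq, enorm_mul, mul_pow,
    Real.enorm_of_nonneg (inv_pos.2 hh).le, ← eLpNorm_two_sq]
  calc ENNReal.ofReal h⁻¹ ^ 2 * ‖∫ t, (f t - c) ∂μ‖ₑ ^ 2
      ≤ ENNReal.ofReal h⁻¹ ^ 2 *
        (eLpNorm (fun t => f t - c) 2 μ * ENNReal.ofReal h ^ (1 / 2 : ℝ)) ^ 2 := by gcongr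
    _ = ENNReal.ofReal h⁻¹ * (ENNReal.ofReal h⁻¹ * ENNReal.ofReal h) *
        eLpNorm (fun t => f t - c) 2 μ ^ 2 := by rw [mul_pow, h2]; ring
    _ = _ := by
      rw [← ENNReal.ofReal_mul (inv_pos.2 hh).le, inv_mul_cancel₀ hh.ne', ENNReal.ofReal_one,
        mul_one]

/-- The inner integral in the Gagliardo seminorm. -/
def gagliardoInner (R σ : ℝ) (g : ℝ → ℝ) (x : ℝ) : ENNReal :=
  ∫⁻ y in Set.Ioo (-R) R, ENNReal.ofReal (|g x - g y| ^ 2 / |x - y| ^ (1 + 2 * σ))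

/-- On the window `|x - t| ≤ 2 h`, so inserting the Gagliardo kernel costs at most `(2 h) ^ (1 + 2
σ)`; averaging divides by `h`. -/
theorem ofReal_sq_steklov_sub_le_gagliardoInner {g : ℝ → ℝ}
    (hg : ∀ a b, IntervalIntegrable g volume a b) {σ : ℝ} (hσ : 0 < σ) {h : ℝ} (hh : 0 < h)
    {x y : ℝ} (hy : Set.Ioo y (y + h) ⊆ Set.Ioo (-R) R)
    (hxy : ∀ t ∈ Set.Ioo y (y + h), |x - t| ≤ 2 * h) :
    ENNReal.ofReal ((steklov h g y - g x) ^ 2) ≤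
      ENNReal.ofReal (2 * (2 * h) ^ (2 * σ)) * gagliardoInner R σ g x := by
  refine (ofReal_sq_steklov_sub_le hg hh y (g x)).trans ?_
  have hpt : ∀ t ∈ Set.Ioo y (y + h), ENNReal.ofReal ((g t - g x) ^ 2) ≤
      ENNReal.ofReal ((2 * h) ^ (1 + 2 * σ)) *
        ENNReal.ofReal (|g x - g t| ^ 2 / |x - t| ^ (1 + 2 * σ)) := by
    intro t ht
    rw [← ENNReal.ofReal_mul (by positivity)]
    refine ENNReal.ofReal_le_ofReal ?_
    rcases eq_or_ne x t with rfl | hne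
    · simp
    have hpos : 0 < |x - t| := abs_pos.2 (sub_ne_zero.2 hne)
    have hp : 0 < |x - t| ^ (1 + 2 * σ) := Real.rpow_pos_of_pos hpos _
    rw [mul_div_assoc', le_div_iff₀ hp, mul_comm, sq_abs, sub_sq_comm]
    refine mul_le_mul_of_nonneg_right ?_ (sq_nonneg _)
    exact Real.rpow_le_rpow hpos.le (hxy t ht) (by linarith)
  calc _ ≤ ENNReal.ofReal h⁻¹ * ∫⁻ t in Set.Ioo y (y + h), ENNReal.ofReal ((2 * h) ^ (1 + 2 * σ)) *
        ENNReal.ofReal (|g x - g t| ^ 2 / |x - t| ^ (1 + 2 * σ)) := by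
        gcongr 1
        exact setLIntegral_mono' measurableSet_Ioo hpt
    _ = ENNReal.ofReal h⁻¹ * (ENNReal.ofReal ((2 * h) ^ (1 + 2 * σ)) *
        ∫⁻ t in Set.Ioo y (y + h),
          ENNReal.ofReal (|g x - g t| ^ 2 / |x - t| ^ (1 + 2 * σ))) := by
        rw [lintegral_const_mul' _ _ ENNReal.ofReal_ne_top]
    _ ≤ ENNReal.ofReal h⁻¹ * (ENNReal.ofReal ((2 * h) ^ (1 + 2 * σ)) * gagliardoInner R σ g x) := by
        gcongr
        exact lintegral_mono_set hy
    _ = _ := by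
        rw [← mul_assoc, ← ENNReal.ofReal_mul (inv_pos.2 hh).le,
          Real.rpow_add (by positivity), Real.rpow_one]
        congr 2
        field_simp

theorem abs_le_sqrt_toReal {z c : ℝ} (hc : 0 ≤ c) {J : ENNReal} (hJ : J ≠ ⊤)
    (h : ENNReal.ofReal (z ^ 2) ≤ ENNReal.ofReal c * J) : |z| ≤ √(c * J.toReal) := by
  refine Real.abs_le_sqrt ?_
  rw [← ENNReal.ofReal_toReal hJ, ← ENNReal.ofReal_mul hc] at h
  exact (ENNReal.ofReal_le_ofReal_iff (by positivity)).1 h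

theorem ofReal_sq_le_of_abs_le {z c : ℝ} (hc : 0 < c) {J : ENNReal}
    (h : J ≠ ⊤ → |z| ≤ √(c * J.toReal)) : ENNReal.ofReal (z ^ 2) ≤ ENNReal.ofReal c * J := by
  rcases eq_or_ne J ⊤ with rfl | hJ
  · rw [ENNReal.mul_top (by simpa using hc)]; exact le_top
  · rw [← ENNReal.ofReal_toReal hJ, ← ENNReal.ofReal_mul hc.le]
    refine ENNReal.ofReal_le_ofReal ?_
    rw [← sq_abs, ← Real.le_sqrt (abs_nonneg _) (by positivity)]
    exact h hJ

theorem eLpNorm_two_le_of_gagliardoInner {f g : ℝ → ℝ} {σ c : ℝ} (hc : 0 ≤ c)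
    (hfin : gagliardoSq (Set.Ioo (-R) R) σ g < ⊤)
    (h : ∀ x ∈ Set.Ioo (-R) R,
      ENNReal.ofReal (f x ^ 2) ≤ ENNReal.ofReal c * gagliardoInner R σ g x) :
    eLpNorm f 2 (vol R) ≤
      ENNReal.ofReal (√c * √(gagliardoSq (Set.Ioo (-R) R) σ g).toReal) := by
  have h1 : eLpNorm f 2 (vol R) ^ 2 ≤ ENNReal.ofReal c * gagliardoSq (Set.Ioo (-R) R) σ g := by
    rw [eLpNorm_two_sq, gagliardoSq, ← lintegral_const_mul' _ _ ENNReal.ofReal_ne_top]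
    exact setLIntegral_mono' measurableSet_Ioo h
  rw [← ENNReal.ofReal_toReal hfin.ne, ← ENNReal.ofReal_mul hc,
    ← Real.sq_sqrt (mul_nonneg hc ENNReal.toReal_nonneg),
    ENNReal.ofReal_pow (Real.sqrt_nonneg _), Real.sqrt_mul hc] at h1
  exact (ENNReal.pow_le_pow_left_iff two_ne_zero).1 h1

/-- Smooth `g` at scale `h = R / n` to a function `G`, bound `g - G` and `G'` by the Gagliardo
seminorm, and apply Jackson to `G`. Two Steklov means are used: the first makes `g` continuous, the
second makes it differentiable everywhere. -/
theorem bestApprox_le_gagliardo_of_intervalIntegrable (hR : 0 < R) {g : ℝ → ℝ}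
    (hg : ∀ a b, IntervalIntegrable g volume a b) {σ : ℝ} (hσ : 0 < σ)
    (hfin : gagliardoSq (Set.Ioo (-R) R) σ g < ⊤) {n : ℕ} (hn : 0 < n) :
    bestApprox R n g ≤ ENNReal.ofReal (3 * √(2 * (2 * (R / n)) ^ (2 * σ)) *
      √(gagliardoSq (Set.Ioo (-R) R) σ g).toReal) := by
  have hn1 : (1 : ℝ) ≤ n := by exact_mod_cast hn
  set ε : ℝ := 1 / n with hε
  have hε0 : 0 < ε := by positivity
  have hε1 : ε ≤ 1 := (div_le_one (by positivity)).2 hn1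
  set h : ℝ := R / n with hh
  have hh0 : 0 < h := by positivity
  have hRh : ε * R = h := by rw [hε, hh]; ring
  -- A slightly contracted and shifted base point: `[φ x, φ x + 2 h]` stays inside `[-R, R]` and
  -- within distance `2 h` of `x`, so no extension of `g` enters.
  set φ : ℝ → ℝ := fun x => (1 - ε) * x - h with hφ
  set A := steklov h g with hA
  have hAc : Continuous A := continuous_steklov hg h
  set G : ℝ → ℝ := fun x => steklov h A (φ x) with hG
  set G' : ℝ → ℝ := fun x => h⁻¹ * (A (φ x + h) - A (φ x)) * (1 - ε) with hG'
  have hGd : ∀ x, HasDerivAt G (G' x) x := by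
    intro x
    have h1 : HasDerivAt φ (1 - ε) x := by
      simpa only [mul_one] using ((hasDerivAt_id' x).const_mul (1 - ε)).sub_const h
    exact (hasDerivAt_steklov hAc h (φ x)).comp x h1
  have hφc : Continuous φ := by fun_prop
  have hG'c : Continuous G' := by fun_prop
  have hGc : Continuous G := continuous_iff_continuousAt.2 fun x => (hGd x).continuousAt
  set c := 2 * (2 * h) ^ (2 * σ) with hc
  have hc0 : 0 < c := by positivity
  have hkey : ∀ x ∈ Set.Ioo (-R) R, gagliardoInner R σ g x ≠ ⊤ →
      ∀ y ∈ Set.Icc (φ x) (φ x + h), |A y - g x| ≤ √(c * (gagliardoInner R σ g x).toReal) := by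
    intro x hx hJ y hy
    have hεx1 : ε * x ≤ h := hRh ▸ mul_le_mul_of_nonneg_left hx.2.le hε0.le
    have hεx2 : -h ≤ ε * x := by
      have := mul_le_mul_of_nonneg_left hx.1.le hε0.le
      linarith
    have hφ1 : -R ≤ φ x := by
      have := mul_nonneg (by linarith : 0 ≤ 1 - ε) (by linarith [hx.1] : 0 ≤ x + R)
      simp only [hφ]; linarith
    have hφ2 : φ x + 2 * h ≤ R := by
      have := mul_nonneg (by linarith : 0 ≤ 1 - ε) (by linarith [hx.2] : 0 ≤ R - x)
      simp only [hφ]; linarith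
    have hφ3 : φ x = x - ε * x - h := by simp only [hφ]; ring
    refine abs_le_sqrt_toReal hc0.le hJ
      (ofReal_sq_steklov_sub_le_gagliardoInner hg hσ hh0 (fun t ht => ?_) fun t ht => ?_)
    · exact ⟨by linarith [ht.1, hy.1], by linarith [ht.2, hy.2]⟩
    · rw [abs_le]
      constructor <;> linarith [ht.1, ht.2, hy.1, hy.2]
  have e1 : eLpNorm (fun x => g x - G x) 2 (vol R) ≤
      ENNReal.ofReal (√c * √(gagliardoSq (Set.Ioo (-R) R) σ g).toReal) := by
    refine eLpNorm_two_le_of_gagliardoInner hc0.le hfin fun x hx =>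
      ofReal_sq_le_of_abs_le hc0 fun hJ => ?_
    rw [abs_sub_comm]
    exact abs_steklov_sub_le hAc hh0 (hkey x hx hJ)
  have e2 : eLpNorm G' 2 (vol R) ≤
      ENNReal.ofReal (√((2 / h) ^ 2 * c) * √(gagliardoSq (Set.Ioo (-R) R) σ g).toReal) := by
    refine eLpNorm_two_le_of_gagliardoInner (by positivity) hfin fun x hx =>
      ofReal_sq_le_of_abs_le (by positivity) fun hJ => ?_
    have h1 := hkey x hx hJ (φ x) ⟨le_rfl, by linarith⟩
    have h2 := hkey x hx hJ (φ x + h) ⟨by linarith, le_rfl⟩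
    rw [mul_assoc, Real.sqrt_mul (by positivity), Real.sqrt_sq (by positivity)]
    set K := √(c * (gagliardoInner R σ g x).toReal)
    have h3 : |A (φ x + h) - A (φ x)| ≤ 2 * K := by
      have := abs_sub_le (A (φ x + h)) (g x) (A (φ x))
      rw [abs_sub_comm (g x)] at this
      linarith
    simp only [hG']
    rw [abs_mul, abs_mul, abs_of_pos (inv_pos.2 hh0), abs_of_nonneg (by linarith : 0 ≤ 1 - ε)]
    calc h⁻¹ * |A (φ x + h) - A (φ x)| * (1 - ε) ≤ h⁻¹ * (2 * K) * 1 := by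
          gcongr
          linarith
      _ = 2 / h * K := by ring
  have hprim : IsPrimitive R G G' := by
    refine ⟨memLp_continuous hG'c, fun x _ => ?_⟩
    rw [intervalIntegral.integral_eq_sub_of_hasDerivAt (fun t _ => hGd t)
      (hG'c.intervalIntegrable _ _)]
    ring
  have hgm : AEStronglyMeasurable g (vol R) := by
    have h1 : IntegrableOn g (Set.Ioc (-R) R) volume := (hg (-R) R).1
    exact (h1.mono_set Set.Ioo_subset_Ioc_self).aestronglyMeasurable
  refine (bestApprox_le_add hgm hGc.aestronglyMeasurable).trans ?_
  -- Jackson's factor `R / n = h` cancels the `1 / h` in the bound of `G'`, leaving `2`; with the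
  -- smoothing error the constant is `3`.
  refine (add_le_add e1 ((hprim.bestApprox_le hR hn).trans (mul_le_mul_right e2 _))).trans
    (le_of_eq ?_)
  rw [← ENNReal.ofReal_mul (by positivity), ← ENNReal.ofReal_add (by positivity) (by positivity),
    Real.sqrt_mul (by positivity : 0 ≤ (2 / h) ^ 2), Real.sqrt_sq (by positivity), ← hh]
  congr 1
  field_simp
  ring

/-- Extension by zero makes `g` integrable on the line without changing anything on `(-R, R)`. -/
theorem bestApprox_le_gagliardo (hR : 0 < R) {g : ℝ → ℝ} (hg : MemLp g 2 (vol R)) {σ : ℝ}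
    (hσ : 0 < σ) (hfin : gagliardoSq (Set.Ioo (-R) R) σ g < ⊤) {n : ℕ} (hn : 0 < n) :
    bestApprox R n g ≤ ENNReal.ofReal (3 * √(2 * (2 * (R / n)) ^ (2 * σ)) *
      √(gagliardoSq (Set.Ioo (-R) R) σ g).toReal) := by
  set f := (Set.Ioo (-R) R).indicator g with hf
  have hfg : f =ᵐ[vol R] g := indicator_ae_eq_restrict measurableSet_Ioo
  have hgag : gagliardoSq (Set.Ioo (-R) R) σ f = gagliardoSq (Set.Ioo (-R) R) σ g :=
    setLIntegral_congr_fun measurableSet_Ioo fun x hx =>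
      setLIntegral_congr_fun measurableSet_Ioo fun y hy => by
        simp only [hf, Set.indicator_of_mem hx, Set.indicator_of_mem hy]
  have hfi : Integrable f volume :=
    (integrable_indicator_iff measurableSet_Ioo).2 (hg.integrable (by norm_num))
  rw [← bestApprox_congr_ae hfg, ← hgag]
  exact bestApprox_le_gagliardo_of_intervalIntegrable hR (fun a b => hfi.intervalIntegrable) hσ
    (hgag ▸ hfin) hn

end

section

/-! ### Solutions in Sobolev spaces -/

variable {R : ℝ}

theorem sum_le_hsNormSq (R s : ℝ) (u : ℝ → ℝ) :
    ∑ j ∈ Finset.range (⌊s⌋₊ + 1), ∫ x in Set.Ioo (-R) R, weakDeriv (Set.Ioo (-R) R) j u x ^ 2 ≤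
      hsNormSq R s u := by
  unfold hsNormSq
  split_ifs <;> simp

theorem hsNormSq_nonneg (R s : ℝ) (u : ℝ → ℝ) : 0 ≤ hsNormSq R s u :=
  (Finset.sum_nonneg fun _ _ => integral_nonneg fun _ => sq_nonneg _).trans (sum_le_hsNormSq R s u)

theorem IsRepresentative.l2norm_le {s : ℝ} {u : ℝ → ℝ} {w : ℕ → ℝ → ℝ}
    (hw : IsRepresentative R ⌊s⌋₊ u w) {j : ℕ} (hj : j ≤ ⌊s⌋₊) :
    l2norm R (w j) ≤ √(hsNormSq R s u) := by
  refine Real.sqrt_le_sqrt (le_trans ?_ (sum_le_hsNormSq R s u))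
  have h : ∫ x in Set.Ioo (-R) R, w j x ^ 2 =
      ∫ x in Set.Ioo (-R) R, weakDeriv (Set.Ioo (-R) R) j u x ^ 2 := by
    refine integral_congr_ae ?_
    filter_upwards [hw.ae_eq j hj] with x hx
    rw [hx]
  rw [h]
  exact Finset.single_le_sum (f := fun j => ∫ x in Set.Ioo (-R) R,
    weakDeriv (Set.Ioo (-R) R) j u x ^ 2) (fun _ _ => integral_nonneg fun _ => sq_nonneg _)
    (Finset.mem_range.2 (by omega))

theorem gagliardoSq_congr_ae {σ : ℝ} {f g : ℝ → ℝ} (h : f =ᵐ[vol R] g) :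
    gagliardoSq (Set.Ioo (-R) R) σ f = gagliardoSq (Set.Ioo (-R) R) σ g := by
  refine lintegral_congr_ae ?_
  filter_upwards [h] with x hx
  refine lintegral_congr_ae ?_
  filter_upwards [h] with y hy
  rw [hx, hy]

/-- The constant `f 0` is `f` minus the integral of `g`, and `√(2 R)` is the `L²` norm of `1`. Point
values at `0` are thus controlled by the Sobolev norm. -/
theorem sqrt_two_mul_mul_abs_zero_le (hR : 0 < R) {f g : ℝ → ℝ} (hf : MemLp f 2 (vol R))
    (hg : MemLp g 2 (vol R))
    (h : ∀ x ∈ Set.Icc (-R) R, f x = f 0 + ∫ t in (0 : ℝ)..x, g t) :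
    √(2 * R) * |f 0| ≤ l2norm R f + 2 * R * l2norm R g := by
  have hc : l2norm R (fun _ => f 0) = √(2 * R) * |f 0| := by
    rw [l2norm, integral_const, smul_eq_mul, Measure.real, Measure.restrict_apply_univ,
      Real.volume_Ioo, ENNReal.toReal_ofReal (by linarith), Real.sqrt_mul (by linarith),
      Real.sqrt_sq_eq_abs]
    ring_nf
  have hd : MemLp (fun x => f x - f 0) 2 (vol R) := hf.sub (memLp_const _)
  have h1 := l2norm_sub_le (g := fun x => f x - f 0) hf hd
  simp only [sub_sub_cancel] at h1
  have h2 := l2norm_le_sqrt_mul hR hd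
    (mul_nonneg (Real.sqrt_nonneg (2 * R)) (l2norm_nonneg R g)) fun x hx => by
      rw [h x (Set.Ioo_subset_Icc_self hx), add_sub_cancel_left]
      exact abs_integral_zero_le hR hg (Set.Ioo_subset_Icc_self hx)
  rw [← mul_assoc, Real.mul_self_sqrt (by linarith)] at h2
  rw [← hc]
  linarith

theorem IsRepresentative.bestApprox_top_le (hR : 0 < R) {s : ℝ} {u : ℝ → ℝ} (hu : MemHs R s u)
    {w : ℕ → ℝ → ℝ} (hw : IsRepresentative R ⌊s⌋₊ u w) {n : ℕ} (hn : 0 < n) :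
    bestApprox R n (w ⌊s⌋₊) ≤ ENNReal.ofReal
      ((3 * √2 * (2 * R) ^ Int.fract s + 1) * (n : ℝ) ^ (-Int.fract s) * √(hsNormSq R s u)) := by
  have hm := hw.memLp _ le_rfl
  have hn0 : (0 : ℝ) < n := by exact_mod_cast hn
  have hh := Real.sqrt_nonneg (hsNormSq R s u)
  have hp : (0 : ℝ) ≤ 3 * √2 * (2 * R) ^ Int.fract s := by positivity
  by_cases hσ : Int.fract s = 0
  · refine (bestApprox_le_eLpNorm R n _).trans ((eLpNorm_two_eq hm).le.trans
      (ENNReal.ofReal_le_ofReal ((hw.l2norm_le le_rfl).trans ?_)))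
    rw [hσ] at hp
    rw [hσ, neg_zero, Real.rpow_zero (n : ℝ), mul_one]
    exact le_mul_of_one_le_left hh (by linarith)
  · have hσ0 : 0 < Int.fract s := lt_of_le_of_ne (Int.fract_nonneg s) (Ne.symm hσ)
    have hg := gagliardoSq_congr_ae (σ := Int.fract s) (hw.ae_eq _ le_rfl)
    refine (bestApprox_le_gagliardo hR hm hσ0 (hg ▸ hu.2 hσ) hn).trans
      (ENNReal.ofReal_le_ofReal ?_)
    have h1 : √(gagliardoSq (Set.Ioo (-R) R) (Int.fract s) (w ⌊s⌋₊)).toReal ≤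
        √(hsNormSq R s u) := by
      refine Real.sqrt_le_sqrt ?_
      rw [hg, hsNormSq, if_neg hσ]
      exact le_add_of_nonneg_left
        (Finset.sum_nonneg fun _ _ => integral_nonneg fun _ => sq_nonneg _)
    have h2 : √(2 * (2 * (R / n)) ^ (2 * Int.fract s)) =
        √2 * (2 * R) ^ Int.fract s * (n : ℝ) ^ (-Int.fract s) := by
      rw [Real.sqrt_mul (by norm_num), mul_comm 2 (Int.fract s), Real.rpow_mul (by positivity),
        Real.rpow_two, Real.sqrt_sq (by positivity), mul_div_assoc',
        Real.div_rpow (by positivity) hn0.le, Real.rpow_neg hn0.le]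
      ring
    rw [h2]
    have h3 : (0 : ℝ) ≤ (n : ℝ) ^ (-Int.fract s) := by positivity
    refine mul_le_mul ?_ h1 (Real.sqrt_nonneg _) (by positivity)
    linarith

/-- Jackson is applied to the `⌊s⌋ - 2` derivatives above `w 2`, each gaining `1 / d`, and the
fractional part of `s` is gained at the top order. The lower bound on `N` keeps the remaining level
`d` above `N / 10`. -/
theorem IsRepresentative.bestApprox_two_le (hR : 0 < R) {s : ℝ} (hs : 2 ≤ s) {u : ℝ → ℝ}
    (hu : MemHs R s u) {w : ℕ → ℝ → ℝ} (hw : IsRepresentative R ⌊s⌋₊ u w) {N : ℕ}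
    (hN : 10 * (⌊s⌋₊ - 2) + 20 ≤ N) :
    bestApprox R (N / 5) (w 2) ≤ ENNReal.ofReal
      (R ^ (⌊s⌋₊ - 2) * (3 * √2 * (2 * R) ^ Int.fract s + 1) * 10 ^ (s - 2) * √(hsNormSq R s u) *
        (N : ℝ) ^ (-(s - 2))) := by
  have hm2 : 2 ≤ ⌊s⌋₊ := Nat.le_floor (by exact_mod_cast hs)
  have htop := fun {n : ℕ} (hn : 0 < n) => hw.bestApprox_top_le hR hu hn
  have hsk : s - 2 = (⌊s⌋₊ - 2 : ℕ) + Int.fract s := by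
    rw [Nat.cast_sub hm2, natCast_floor_eq_intCast_floor (by linarith), ← Int.self_sub_floor]
    push_cast; ring
  set k := ⌊s⌋₊ - 2 with hk
  have hkm : ⌊s⌋₊ = k + 2 := by omega
  have hNpos : (0 : ℝ) < N := by exact_mod_cast (by omega : 0 < N)
  obtain ⟨d, hd⟩ : ∃ d, N / 5 = d + k := ⟨N / 5 - k, by omega⟩
  have hd0 : 0 < d := by omega
  have hdN : (N : ℝ) / 10 ≤ d := by
    rw [div_le_iff₀ (by norm_num)]
    exact_mod_cast (by omega : N ≤ d * 10)
  have hdpos : (0 : ℝ) < d := by exact_mod_cast hd0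
  set c := 3 * √2 * (2 * R) ^ Int.fract s + 1 with hc
  have hc0 : 0 ≤ c := by positivity
  have hh := Real.sqrt_nonneg (hsNormSq R s u)
  have h := bestApprox_le_of_tower hR (w := fun j => w (j + 2)) (k := k)
    (fun j hj => hw.isPrimitive (by omega)) d
  rw [hd]
  refine h.trans ((mul_le_mul_right (hkm ▸ htop hd0) _).trans ?_)
  rw [← ENNReal.ofReal_mul (by positivity)]
  refine ENNReal.ofReal_le_ofReal ?_
  have hf : (d.factorial : ℝ) / (d + k).factorial ≤ ((d : ℝ) ^ k)⁻¹ := by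
    have h1 : (d.factorial : ℝ) * (d : ℝ) ^ k ≤ (d + k).factorial := by
      exact_mod_cast (Nat.mul_le_mul_left _ (Nat.pow_le_pow_left (Nat.le_succ d) k)).trans
        Nat.factorial_mul_pow_le_factorial
    rw [div_le_iff₀ (by positivity), inv_mul_eq_div, le_div_iff₀ (by positivity)]
    exact h1
  have hr : ((d : ℝ) ^ k)⁻¹ * (d : ℝ) ^ (-Int.fract s) ≤
      10 ^ (s - 2) * (N : ℝ) ^ (-(s - 2)) := by
    rw [← Real.rpow_natCast, ← Real.rpow_neg hdpos.le, ← Real.rpow_add hdpos, ← neg_add, ← hsk]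
    refine (Real.rpow_le_rpow_of_nonpos (by positivity) hdN (by linarith)).trans (le_of_eq ?_)
    rw [Real.div_rpow hNpos.le (by norm_num), Real.rpow_neg (by norm_num : (0 : ℝ) ≤ 10)]
    field_simp
  calc R ^ k * (d.factorial / (d + k).factorial) *
        (c * (d : ℝ) ^ (-Int.fract s) * √(hsNormSq R s u))
      ≤ R ^ k * ((d : ℝ) ^ k)⁻¹ * (c * (d : ℝ) ^ (-Int.fract s) * √(hsNormSq R s u)) := by gcongr
    _ = R ^ k * c * √(hsNormSq R s u) * (((d : ℝ) ^ k)⁻¹ * (d : ℝ) ^ (-Int.fract s)) := by ring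
    _ ≤ R ^ k * c * √(hsNormSq R s u) * (10 ^ (s - 2) * (N : ℝ) ^ (-(s - 2))) := by gcongr
    _ = _ := by ring

theorem exp_neg_le_mul_rpow {p : ℝ} {N : ℕ} (hN : 0 < N) :
    Real.exp (-(1 / 4) * N) ≤ 4 ^ ⌈p⌉₊ * (⌈p⌉₊.factorial : ℝ) * (N : ℝ) ^ (-p) := by
  have hN1 : (1 : ℝ) ≤ N := by exact_mod_cast hN
  have h := Real.pow_div_factorial_le_exp (1 / 4 * (N : ℝ)) (by positivity) ⌈p⌉₊
  have h1 : (N : ℝ) ^ p ≤ (N : ℝ) ^ ⌈p⌉₊ := by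
    rw [← Real.rpow_natCast]
    exact Real.rpow_le_rpow_of_exponent_le hN1 (Nat.le_ceil p)
  have hp : 0 < (N : ℝ) ^ p := by positivity
  rw [neg_mul, Real.exp_neg, Real.rpow_neg (by positivity), ← div_eq_mul_inv,
    le_div_iff₀ hp, inv_mul_le_iff₀ (Real.exp_pos _)]
  rw [mul_pow, div_le_iff₀ (by positivity), div_pow, one_pow, one_div_mul_eq_div,
    div_le_iff₀ (by positivity)] at h
  linarith

theorem exists_expectedMinLossLE_of_memHs (hR : 0 < R) {s : ℝ} (hs : 2 ≤ s)
    (Λ₁ Λ₂ Λ₃ G₁ G₂ : ℝ) {γ : ℝ} (hγ : 0 ≤ γ) :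
    ∃ C : ℝ, ∀ (P : BVP R) (u : ℝ → ℝ), P.Bounded Λ₁ Λ₂ Λ₃ G₁ G₂ → P.IsSolution u →
      MemHs R s u → ∀ N : ℕ, 0 < N → P.ExpectedMinLossLE γ N (N / (11 * R))
        (C * hsNormSq R s u * (N : ℝ) ^ (-2 * s + 4)) := by
  have hm2 : 2 ≤ ⌊s⌋₊ := Nat.le_floor (by exact_mod_cast hs)
  -- Two point values at `0` and one `L²` norm, each in multiples of the Sobolev norm. The quotient
  -- `C₀ / K` below undoes the factor `K` contained in `H = K X`.
  set K := 2 * (1 + 2 * R) / √(2 * R) + 1 with hK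
  have hs2R : 0 < √(2 * R) := Real.sqrt_pos.2 (by linarith)
  have hK0 : 0 < K := by positivity
  set C₀ := R ^ (⌊s⌋₊ - 2) * (3 * √2 * (2 * R) ^ Int.fract s + 1) * 10 ^ (s - 2) with hC₀
  have hC₀0 : 0 ≤ C₀ := by positivity
  set N₀ := 10 * (⌊s⌋₊ - 2) + 20 with hN₀
  set A := lossConst R Λ₁ Λ₂ Λ₃ G₁ G₂ γ * (C₀ / K + repConst R *
    (4 ^ ⌈s - 2⌉₊ * (⌈s - 2⌉₊.factorial : ℝ)) + (N₀ : ℝ) ^ (s - 2)) ^ 2 with hA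
  refine ⟨A * K ^ 2, fun P u hb hsol hu N hN => ?_⟩
  obtain ⟨w, hw⟩ := hu.exists_isRepresentative hR
  have hh := Real.sqrt_nonneg (hsNormSq R s u)
  set X := √(hsNormSq R s u) with hX
  have hXs : hsNormSq R s u = X ^ 2 := (Real.sq_sqrt (hsNormSq_nonneg R s u)).symm
  have b : ∀ j ≤ ⌊s⌋₊, l2norm R (w j) ≤ X := fun j hj => hw.l2norm_le hj
  have z : ∀ j < ⌊s⌋₊, |w j 0| ≤ (1 + 2 * R) / √(2 * R) * X := by
    intro j hj
    have h := sqrt_two_mul_mul_abs_zero_le hR (hw.memLp j hj.le) (hw.memLp (j + 1) hj)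
      (hw.eq j hj)
    have h1 := mul_le_mul_of_nonneg_left (b (j + 1) hj) (by linarith : 0 ≤ 2 * R)
    rw [div_mul_eq_mul_div, le_div_iff₀' hs2R]
    linarith [b j hj.le]
  have hH : |w 0 0| + |w 1 0| + l2norm R (w 2) ≤ K * X := by
    have e : K * X = (1 + 2 * R) / √(2 * R) * X + (1 + 2 * R) / √(2 * R) * X + X := by
      rw [hK]; ring
    rw [e]
    exact add_le_add (add_le_add (z 0 (by omega)) (z 1 (by omega))) (b 2 hm2)
  have hNpos : (0 : ℝ) < N := by exact_mod_cast hN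
  have hfin := BVP.expectedMinLossLE_of_rate hR hb hγ hsol (hw.mono hm2)
    (r := fun N => (N : ℝ) ^ (-(s - 2))) (fun N => by positivity)
    (C₁ := C₀ / K) (C₂ := 4 ^ ⌈s - 2⌉₊ * (⌈s - 2⌉₊.factorial : ℝ)) (C₃ := (N₀ : ℝ) ^ (s - 2))
    (by positivity) (by positivity) (by positivity) hH (N₀ := N₀) (by omega)
    (fun N hN => by
      refine (hw.bestApprox_two_le hR hs hu hN).trans (le_of_eq ?_)
      rw [← hC₀, ← mul_assoc, div_mul_cancel₀ _ hK0.ne'])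
    (fun N hN => exp_neg_le_mul_rpow (by omega))
    (fun N h0 hN => by
      have h0' : (0 : ℝ) < N := by exact_mod_cast h0
      rw [Real.rpow_neg h0'.le, ← div_eq_mul_inv, one_le_div (by positivity)]
      exact Real.rpow_le_rpow h0'.le (by exact_mod_cast hN.le) (by linarith)) hN
  refine hfin.mono (le_of_eq ?_)
  have e : ((N : ℝ) ^ (-(s - 2))) ^ 2 = (N : ℝ) ^ (-2 * s + 4) := by
    rw [← Real.rpow_natCast, ← Real.rpow_mul hNpos.le]
    congr 1; push_cast; ring
  rw [e, hXs, ← hA]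
  ring

end

end RFM

end

/-! ### The analytic, Gevrey and Sobolev estimates. -/

theorem corollary2p7 (R : ℝ) (hR : 0 < R) :
    -- (a) analytic class, with an explicit rate
    (∀ ρ : ℝ, 0 < ρ → ∀ Λ₁ Λ₂ Λ₃ G₁ G₂ γ : ℝ, 0 < Λ₁ → 0 < Λ₂ → 0 < Λ₃ → 0 ≤ γ →
      ∀ u : ℝ → ℝ,
        (∃ F : ℂ → ℂ, RFM.AnalyticInStrip ρ F ∧ ∀ x ∈ Set.Ioo (-R) R, F (x : ℂ) = (u x : ℂ)) →
        ∃ C : ℝ, ∀ P : RFM.BVP R, P.Bounded Λ₁ Λ₂ Λ₃ G₁ G₂ → P.IsSolution u →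
          ∀ N : ℕ, 0 < N → P.ExpectedMinLossLE γ N (N / (11 * R))
            (C * Real.exp (-(min (1 / 2) (ρ / (11 * R))) * N))) ∧
    -- (b) Gevrey class; the rate depends on `u` only through its Gevrey constant on `[-R, R]`
    (∀ ρ : ℝ, 0 < ρ → ∀ s : ℝ, 1 < s → ∀ Cu : ℝ, 0 < Cu →
      ∃ κ : ℝ, 0 < κ ∧
        ∀ Λ₁ Λ₂ Λ₃ G₁ G₂ γ : ℝ, 0 < Λ₁ → 0 < Λ₂ → 0 < Λ₃ → 0 ≤ γ →
        ∀ u : ℝ → ℝ,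
          (∃ v : ℝ → ℝ, RFM.GevreyOn s (Set.Ioo (-R - ρ) (R + ρ)) v ∧
            Set.EqOn v u (Set.Ioo (-R) R) ∧ RFM.GevreyBound s (Set.Icc (-R) R) Cu v) →
          ∃ C : ℝ, ∀ P : RFM.BVP R, P.Bounded Λ₁ Λ₂ Λ₃ G₁ G₂ → P.IsSolution u →
            ∀ N : ℕ, 0 < N → P.ExpectedMinLossLE γ N (N / (11 * R))
              (C * Real.exp (-κ * (N : ℝ) ^ (1 / s)))) ∧
    -- (b) the explicit rate in terms of a Gevrey constant `D` of a cut-off `φ v` of the extension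
    (∀ ρ : ℝ, 0 < ρ → ∀ s : ℝ, 1 < s →
      ∀ Λ₁ Λ₂ Λ₃ G₁ G₂ γ : ℝ, 0 < Λ₁ → 0 < Λ₂ → 0 < Λ₃ → 0 ≤ γ →
      ∀ u v φ : ℝ → ℝ, RFM.GevreyOn s (Set.Ioo (-R - ρ) (R + ρ)) v →
        Set.EqOn v u (Set.Ioo (-R) R) →
        RFM.GevreyCompact s (Set.Ioo (-R - ρ) (R + ρ)) φ → (∀ x ∈ Set.Icc (-R) R, φ x = 1) →
        ∀ D : ℝ, 0 < D →
          RFM.GevreyBound s (Set.Ioo (-R - ρ) (R + ρ)) D (fun x => φ x * v x) →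
          ∃ C : ℝ, ∀ P : RFM.BVP R, P.Bounded Λ₁ Λ₂ Λ₃ G₁ G₂ → P.IsSolution u →
            ∀ N : ℕ, 0 < N → P.ExpectedMinLossLE γ N (N / (11 * R))
              (C * Real.exp (-(D ^ (-(1 / s)) * (11 * R) ^ (-(1 / s)) / (2 * s))
                * (N : ℝ) ^ (1 / s)))) ∧
    -- (c) Sobolev space; the constant does not depend on the solution
    (∀ s : ℝ, 2 ≤ s → ∀ Λ₁ Λ₂ Λ₃ G₁ G₂ γ : ℝ, 0 < Λ₁ → 0 < Λ₂ → 0 < Λ₃ → 0 ≤ γ →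
      ∃ C : ℝ, ∀ (P : RFM.BVP R) (u : ℝ → ℝ), P.Bounded Λ₁ Λ₂ Λ₃ G₁ G₂ → P.IsSolution u →
        RFM.MemHs R s u →
        ∀ N : ℕ, 0 < N → P.ExpectedMinLossLE γ N (N / (11 * R))
          (C * RFM.hsNormSq R s u * (N : ℝ) ^ (-2 * s + 4))) := by
  refine ⟨fun ρ hρ Λ₁ Λ₂ Λ₃ G₁ G₂ γ _ _ _ hγ u ⟨F, hF, hFu⟩ =>
      RFM.exists_expectedMinLossLE_of_analytic hR hρ Λ₁ Λ₂ Λ₃ G₁ G₂ hγ hF.1 hFu,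
    fun ρ hρ s hs Cu hCu => ⟨Cu ^ (-(1 / s)) * (11 * R) ^ (-(1 / s)) / (2 * s), by positivity,
      fun Λ₁ Λ₂ Λ₃ G₁ G₂ γ _ _ _ hγ u ⟨v, hv, hvu, M, hM, hB⟩ =>
        RFM.exists_expectedMinLossLE_of_gevrey hR hs Λ₁ Λ₂ Λ₃ G₁ G₂ hγ (hv.1.mono
          (Set.Ioo_subset_Ioo (by linarith) (by linarith))) hvu hCu
          ⟨M, hM, fun n x hx => hB n x (Set.Ioo_subset_Icc_self hx)⟩⟩,
    fun ρ hρ s hs Λ₁ Λ₂ Λ₃ G₁ G₂ γ _ _ _ hγ u v φ hv hvu hφ hφ1 D hD ⟨M, hM, hB⟩ => ?_,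
    fun s hs Λ₁ Λ₂ Λ₃ G₁ G₂ γ _ _ _ hγ =>
      RFM.exists_expectedMinLossLE_of_memHs hR hs Λ₁ Λ₂ Λ₃ G₁ G₂ hγ⟩
  have hsub : Set.Ioo (-R) R ⊆ Set.Ioo (-R - ρ) (R + ρ) :=
    Set.Ioo_subset_Ioo (by linarith) (by linarith)
  -- The cut-off product equals `u` on `(-R, R)`, so it may play the role of the smooth
  -- representative, with `D` as its Gevrey constant.
  refine RFM.exists_expectedMinLossLE_of_gevrey hR hs Λ₁ Λ₂ Λ₃ G₁ G₂ hγ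
    ((hφ.1.1.mul hv.1).mono hsub) (fun x hx => ?_) hD
    ⟨M, hM, fun n x hx => hB n x (hsub hx)⟩
  simp only [hφ1 x (Set.Ioo_subset_Icc_self hx), one_mul]
  exact hvu hx
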